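/- Let $\Delta>1$ be a fundamental discriminant and $F=\mathbb{Q}(\sqrt\Delta)\subset\mathbb{R}$ the real quadratic field of discriminant $\Delta$, with ring of integers $\mathcal{O}_F$, conjugation $x\mapsto x'$, norm $\mathrm{Nm}(x)=xx'$, and different $\mathfrak{d}=\sqrt\Delta\,\mathcal{O}_F$. Let $I_{\mathfrak d}$ be the group of fractional ideals prime to $\mathfrak d$, and $\mathrm{Cl}^+(F)$ the narrow class group, i.e. the quotient of $I_{\mathfrak d}$ by its subgroup of principal ideals with a totally positive generator; the class $[\mathfrak c]$ of an arbitrary nonzero fractional ideal $\mathfrak c$ is the class of any $J\in I_{\mathfrak d}$ with $\mathfrak c=xJ$, $x\in F$ totally positive. Put $A_\Delta=\mathfrak{d}^{-1}/\mathcal{O}_F$. For $\mathfrak a\in I_{\mathfrak d}$, $A_\Delta$ is canonically identified with $\mathfrak a\mathfrak d^{-1}/\mathfrak a$ (both being identified with $(\mathfrak a\cap\mathcal O_F)\mathfrak d^{-1}/(\mathfrak a\cap\mathcal O_F)$ via the inclusions), so that the coset $\mathfrak a+h\subset\mathfrak a\mathfrak d^{-1}$ is defined for $h\in A_\Delta$.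 Write $\mathbf e(z)=e^{2\pi i z}$. For $\mathfrak a\in I_{\mathfrak d}$ of norm $A$, $h\in A_\Delta$, $\tau=u+iv$ with $v>0$, and $w\in\mathbb R$, let $$\Theta^-_{\mathfrak a,h}(\tau,w)=\sqrt v\sum_{\lambda\in\mathfrak a+h}\frac{\lambda e^{-w}-\lambda'e^{w}}{\sqrt A}\;\mathbf e\!\left(\frac{(\lambda e^{-w}-\lambda'e^{w})^2}{4A}\tau-\frac{(\lambda e^{-w}+\lambda'e^{w})^2}{4A}\overline\tau\right),\qquad \vartheta^-_{\mathfrak a,h}(\tau)=\int_0^{\log\varepsilon_\Delta}\Theta^-_{\mathfrak a,h}(\tau,w)\,dw,$$ where $\varepsilon_\Delta=(\varepsilon_F^+)^2$ and $\varepsilon_F^+>1$ generates the group of totally positive units of $\mathcal O_F$. For $\mathfrak B=[\mathfrak b]\in\mathrm{Cl}^+(F)$ with $\mathfrak b\in I_{\mathfrak d}$, let $\vartheta^-_{\mathfrak B,h}=\vartheta^-_{\mathfrak b/\mathfrak b',h}$ (this does not depend on the choice of $\mathfrak b$). Let $\chi:\mathrm{Cl}^+(F)\to\{\pm1\}$ be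 a genus character, i.e. there are coprime fundamental discriminants $\Delta_1,\Delta_2$ ($1$ being allowed) with $\Delta=\Delta_1\Delta_2$ such that $\chi([\mathfrak a])$ is the Kronecker symbol $\left(\frac{\Delta_1}{\mathrm{Nm}(\mathfrak a)}\right)$ for every integral ideal $\mathfrak a$ of norm prime to $\Delta$. Let $c_\chi(m,h)$, for $m\in\mathbb Q$ and $h\in A_\Delta$, be the coefficient of $q^m$, $q=\mathbf e(\tau)$, in the Fourier expansion of $$\vartheta_{\chi,h}(\tau)=\sum_{\mathfrak B\in\mathrm{Cl}^+(F)}\chi(\mathfrak B)\,\vartheta^-_{\mathfrak B,h}(\tau).$$ **Proposition.** Let $\ell$ be a rational prime such that there is only one prime $\mathfrak l$ of $\mathcal O_F$ above it. Let $n\in\mathbb Z$ and $h\in A_\Delta$; if $\ell\mid\Delta$, assume moreover that $\frac n\Delta+\mathrm{Nm}(h)\in\mathbb Q/\mathbb Z$ has a representative whose denominator is prime to $\ell$ (this holds in particular whenever $\mathrm{Nm}(h)\equiv-\frac n\Delta\bmod\mathbb Z$). Then $$c_\chi\!\left(\frac{\ell^2n}{\Delta},\ell h\right)=\begin{cases}c_\chi\!\left(\frac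 n\Delta,h\right),&\text{if }\ell\nmid\Delta\text{ or }\ell\mid\gcd(\Delta,n),\\[2pt](1+\chi([\mathfrak l]))\,c_\chi\!\left(\frac n\Delta,h\right),&\text{if }\ell\mid\Delta\text{ and }\ell\nmid n.\end{cases}$$ -/

import Mathlib

open scoped NumberField nonZeroDivisors

namespace HeckeTheta

noncomputable section

/-- Fundamental discriminants (with `1` counted as one): `D ≡ 1 mod 4` squarefree, or `D = 4m` with
`m ≡ 2, 3 mod 4` squarefree. -/
def IsFundamentalDiscriminant (D : ℤ) : Prop :=
  (D % 4 = 1 ∧ Squarefree D) ∨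
    ∃ m : ℤ, D = 4 * m ∧ (m % 4 = 2 ∨ m % 4 = 3) ∧ Squarefree m

/-- The Kronecker symbol `(D / A)` for a positive integer `A`, multiplicative in `A`. -/
def kroneckerSymbol (D : ℤ) (A : ℕ) : ℤ :=
  (A.primeFactorsList.map fun p => if p = 2 then ZMod.χ₈ (D : ZMod 8) else jacobiSym D p).prod

/-- The field `F = ℚ(√Δ)`, as a subfield of `ℝ`. -/
abbrev QuadField (Δ : ℤ) : IntermediateField ℚ ℝ :=
  IntermediateField.adjoin ℚ {√(Δ : ℝ)}

lemma isIntegral_sqrt (Δ : ℤ) : IsIntegral ℤ (√(Δ : ℝ)) := by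
  rcases le_total (0 : ℤ) Δ with h | h
  · have h' : √(Δ : ℝ) ^ 2 = algebraMap ℤ ℝ Δ := by
      rw [Real.sq_sqrt (by exact_mod_cast h)]; simp
    exact IsIntegral.of_pow (n := 2) (by norm_num) (h' ▸ isIntegral_algebraMap)
  · rw [Real.sqrt_eq_zero_of_nonpos (by exact_mod_cast h)]
    exact isIntegral_zero

instance (Δ : ℤ) : NumberField (QuadField Δ) where
  to_charZero := inferInstance
  to_finiteDimensional :=
    IntermediateField.adjoin.finiteDimensional (isIntegral_sqrt Δ).tower_top

variable (Δ : ℤ)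

/-- `√Δ` as an element of `F`. -/
def sqrtDisc : QuadField Δ :=
  ⟨√(Δ : ℝ), IntermediateField.mem_adjoin_simple_self ℚ _⟩

open Classical in
/-- The nontrivial Galois conjugation `x ↦ x'` of `F`, characterised by `√Δ ↦ -√Δ`
(see `conj_sqrtDisc`). -/
def conj : QuadField Δ ≃ₐ[ℚ] QuadField Δ :=
  if h : ∃ σ : QuadField Δ ≃ₐ[ℚ] QuadField Δ, σ (sqrtDisc Δ) = -sqrtDisc Δ then h.choose else 1

lemma not_isSquare_of_fundamental {D : ℤ} (hD : IsFundamentalDiscriminant D) (h1 : 1 < D) :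
    ¬ IsSquare (D : ℚ) := by
  rw [Rat.isSquare_intCast_iff]
  rintro ⟨k, hk⟩
  rcases hD with ⟨-, hs⟩ | ⟨m, hm, hm4, hs⟩
  · rcases Int.isUnit_iff.1 (hs k ⟨1, by linarith⟩) with h | h <;> subst h <;> omega
  · obtain ⟨j, hj⟩ : (2 : ℤ) ∣ k := by
      refine (or_self_iff).1 (Int.prime_two.dvd_or_dvd (a := k) (b := k) ⟨2 * m, ?_⟩)
      linarith
    subst hj
    have hmj : m = j * j := by linarith
    rcases Int.isUnit_iff.1 (hs j ⟨1, by linarith⟩) with h | h <;> subst h <;> omega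

/-- For a fundamental discriminant `Δ > 1`, the automorphism `conj` is the conjugation. -/
lemma conj_sqrtDisc (hΔ : IsFundamentalDiscriminant Δ) (h1 : 1 < Δ) :
    conj Δ (sqrtDisc Δ) = -sqrtDisc Δ := by
  have hs : IsIntegral ℚ (√(Δ : ℝ)) := (isIntegral_sqrt Δ).tower_top
  have hsq : sqrtDisc Δ ^ 2 = (Δ : QuadField Δ) := by
    apply Subtype.ext
    have h0 : (0 : ℝ) ≤ (Δ : ℝ) := by exact_mod_cast (by omega : (0 : ℤ) ≤ Δ)
    simpa [sqrtDisc] using Real.sq_sqrt h0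
  have hmin : minpoly ℚ (√(Δ : ℝ)) = Polynomial.X ^ 2 - Polynomial.C (Δ : ℚ) := by
    refine (minpoly.eq_of_irreducible_of_monic
      (X_pow_sub_C_irreducible_of_prime Nat.prime_two fun b hb =>
        not_isSquare_of_fundamental hΔ h1 ⟨b, by rw [← hb, sq]⟩) ?_
      (Polynomial.monic_X_pow_sub_C _ two_ne_zero)).symm
    have h0 : (0 : ℝ) ≤ (Δ : ℝ) := by exact_mod_cast (by omega : (0 : ℤ) ≤ Δ)
    simp [Real.sq_sqrt h0]
  let pb := IntermediateField.adjoin.powerBasis hs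
  have hgen : pb.gen = sqrtDisc Δ := IntermediateField.adjoin.powerBasis_gen hs
  have hroot : Polynomial.aeval (-sqrtDisc Δ) (minpoly ℚ pb.gen) = 0 := by
    rw [show minpoly ℚ pb.gen = minpoly ℚ (√(Δ : ℝ)) by
      rw [hgen]; exact (minpoly.algebraMap_eq (algebraMap (QuadField Δ) ℝ).injective (sqrtDisc Δ)).symm, hmin]
    simp [hsq]
  have hex : ∃ σ : QuadField Δ ≃ₐ[ℚ] QuadField Δ, σ (sqrtDisc Δ) = -sqrtDisc Δ :=
    ⟨AlgEquiv.ofBijective (pb.lift _ hroot) (pb.lift _ hroot).bijective, by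
      have := pb.lift_gen _ hroot
      rw [hgen] at this
      exact this⟩
  rw [conj, dif_pos hex]
  exact hex.choose_spec

/-- The norm `Nm(x) = x x'`, as an element of `F`. -/
def nm (x : QuadField Δ) : QuadField Δ := x * conj Δ x

/-- Totally positive elements of `F`. -/
def IsTotallyPositive (x : QuadField Δ) : Prop :=
  0 < (x : ℝ) ∧ 0 < (conj Δ x : ℝ)

/-- Fractional ideals of `𝓞 F`. -/
abbrev FracIdeal : Type := FractionalIdeal (𝓞 (QuadField Δ))⁰ (QuadField Δ)

/-- The different `𝔡 = √Δ 𝓞_F`. -/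
def different : FracIdeal Δ := FractionalIdeal.spanSingleton _ (sqrtDisc Δ)

/-- The inverse different `𝔡⁻¹ = (1/√Δ) 𝓞_F`. -/
def invDifferent : FracIdeal Δ := FractionalIdeal.spanSingleton _ (sqrtDisc Δ)⁻¹

/-- `𝔡⁻¹` as an `𝓞_F`-submodule of `F`. -/
abbrev invDiffModule : Submodule (𝓞 (QuadField Δ)) (QuadField Δ) :=
  (invDifferent Δ : Submodule (𝓞 (QuadField Δ)) (QuadField Δ))

/-- The finite abelian group `A_Δ = 𝔡⁻¹ / 𝓞_F`. -/
abbrev DiscModule : Type :=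
  invDiffModule Δ ⧸ Submodule.comap (invDiffModule Δ).subtype
    (1 : Submodule (𝓞 (QuadField Δ)) (QuadField Δ))

/-- The class in `A_Δ` of an element of `𝔡⁻¹`. -/
abbrev DiscModule.mk (x : invDiffModule Δ) : DiscModule Δ := Submodule.Quotient.mk x

/-- The Galois conjugate `𝔟'` of a fractional ideal `𝔟`. -/
def conjIdeal (I : FracIdeal Δ) : FracIdeal Δ :=
  I.extended (QuadField Δ)
    (f := (NumberField.RingOfIntegers.mapRingEquiv (conj Δ).toRingEquiv).toRingHom)
    (nonZeroDivisors_le_comap_nonZeroDivisors_of_injective _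
      (NumberField.RingOfIntegers.mapRingEquiv (conj Δ).toRingEquiv).injective)

/-- `Nm⁻(𝔟) = 𝔟 / 𝔟'`. -/
def nmMinus (I : FracIdeal Δ) : FracIdeal Δ := I / conjIdeal Δ I

/-- The group `I_𝔡` of (nonzero) fractional ideals relatively prime to `𝔡`: no prime ideal that
divides `𝔡` (equivalently, contains `√Δ`) occurs in the factorization. -/
def coprimeIdeals : Subgroup (FracIdeal Δ)ˣ where
  carrier := {I | ∀ v : IsDedekindDomain.HeightOneSpectrum (𝓞 (QuadField Δ)),
    different Δ ≤ (v.asIdeal : FracIdeal Δ) →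
      FractionalIdeal.count (QuadField Δ) v (I : FracIdeal Δ) = 0}
  one_mem' := fun v _ => by
    simpa using FractionalIdeal.count_one (QuadField Δ) v
  mul_mem' := fun {I J} hI hJ v hv => by
    rw [Units.val_mul, FractionalIdeal.count_mul (QuadField Δ) v I.ne_zero J.ne_zero,
      hI v hv, hJ v hv, add_zero]
  inv_mem' := fun {I} hI v hv => by
    rw [Units.val_inv_eq_inv_val, FractionalIdeal.count_inv, hI v hv, neg_zero]

/-- The subgroup of `I_𝔡` of principal ideals with a totally positive generator. -/
def positivePrincipal : Subgroup (coprimeIdeals Δ) where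
  carrier := {I | ∃ x : QuadField Δ, IsTotallyPositive Δ x ∧
    ((I : (FracIdeal Δ)ˣ) : FracIdeal Δ) = FractionalIdeal.spanSingleton _ x}
  one_mem' := ⟨1, by simp [IsTotallyPositive], by simp⟩
  mul_mem' := fun {I J} => by
    rintro ⟨x, ⟨hx, hx'⟩, hI⟩ ⟨y, ⟨hy, hy'⟩, hJ⟩
    refine ⟨x * y, ⟨?_, ?_⟩, ?_⟩
    · simpa using mul_pos hx hy
    · simpa using mul_pos hx' hy'
    · simp [hI, hJ, FractionalIdeal.spanSingleton_mul_spanSingleton]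
  inv_mem' := fun {I} => by
    rintro ⟨x, ⟨hx, hx'⟩, hI⟩
    refine ⟨x⁻¹, ⟨?_, ?_⟩, ?_⟩
    · simpa using hx
    · simpa using hx'
    · simp [hI, FractionalIdeal.spanSingleton_inv]

/-- The narrow class group `Cl⁺(F)`. -/
abbrev NarrowClassGroup : Type := coprimeIdeals Δ ⧸ positivePrincipal Δ

open Classical in
/-- The class in `Cl⁺(F)` of an arbitrary nonzero fractional ideal `I`: the class of any `J ∈ I_𝔡`
with `I = (x) J` for a totally positive `x`. -/
def narrowClass (I : FracIdeal Δ) : NarrowClassGroup Δ :=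
  if h : ∃ J : coprimeIdeals Δ, ∃ x : QuadField Δ, IsTotallyPositive Δ x ∧
      I = FractionalIdeal.spanSingleton _ x * ((J : (FracIdeal Δ)ˣ) : FracIdeal Δ)
  then QuotientGroup.mk h.choose else 1

/-- Genus characters of `F`: the characters `χ_{Δ₁,Δ₂}` attached to the factorizations
`Δ = Δ₁ Δ₂` into coprime fundamental discriminants, given by `χ([𝔞]) = (Δ₁ / Nm 𝔞)` for integral
ideals `𝔞` of norm prime to `Δ`. -/
def IsGenusCharacter (χ : NarrowClassGroup Δ →* ℤˣ) : Prop :=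
  ∃ Δ₁ Δ₂ : ℤ, IsFundamentalDiscriminant Δ₁ ∧ IsFundamentalDiscriminant Δ₂ ∧
    IsCoprime Δ₁ Δ₂ ∧ Δ = Δ₁ * Δ₂ ∧
    ∀ (J : coprimeIdeals Δ) (𝔞 : Ideal (𝓞 (QuadField Δ))),
      ((J : (FracIdeal Δ)ˣ) : FracIdeal Δ) = (𝔞 : FracIdeal Δ) →
      IsCoprime (Ideal.absNorm 𝔞 : ℤ) Δ →
      ((χ (QuotientGroup.mk J) : ℤˣ) : ℤ) = kroneckerSymbol Δ₁ (Ideal.absNorm 𝔞)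

/-- The coset `𝔞 + h` in `𝔞𝔡⁻¹`, for `𝔞` prime to `𝔡` and `h ∈ A_Δ`. Here `A_Δ` is identified with
`𝔞𝔡⁻¹/𝔞` through the isomorphisms induced by the inclusions of `𝔞 ∩ 𝓞_F` into `𝓞_F` and `𝔞`:
the class of `x ∈ (𝔞 ∩ 𝓞_F)𝔡⁻¹` in `A_Δ` corresponds to its class modulo `𝔞`. -/
def coset (𝔞 : FracIdeal Δ) (h : DiscModule Δ) : Set (QuadField Δ) :=
  {l | ∃ x : invDiffModule Δ, DiscModule.mk Δ x = h ∧
    (x : QuadField Δ) ∈ (𝔞 ⊓ 1) * invDifferent Δ ∧ l - x ∈ 𝔞}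

/-- The `h`-component of the theta kernel `Θ⁻_𝔞(τ, w)`:
`√v ∑_{λ ∈ 𝔞 + h} (λe^{-w} - λ'e^w)/√A · e((λe^{-w} - λ'e^w)² τ / 4A - (λe^{-w} + λ'e^w)² τ̄ / 4A)`,
where `v = Im τ`, `A = Nm 𝔞` and `e(z) = exp(2πiz)`. -/
def thetaKernelMinus (𝔞 : FracIdeal Δ) (h : DiscModule Δ) (τ : ℂ) (w : ℝ) : ℂ :=
  let A : ℝ := ((FractionalIdeal.absNorm 𝔞 : ℚ) : ℝ)
  (√τ.im : ℂ) * ∑' l : coset Δ 𝔞 h,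
    let X : ℝ := (l.1 : ℝ) * Real.exp (-w) - (conj Δ l.1 : ℝ) * Real.exp w
    let Y : ℝ := (l.1 : ℝ) * Real.exp (-w) + (conj Δ l.1 : ℝ) * Real.exp w
    ((X / √A : ℝ) : ℂ) * Complex.exp (2 * Real.pi * Complex.I *
      (((X ^ 2 / (4 * A) : ℝ) : ℂ) * τ - ((Y ^ 2 / (4 * A) : ℝ) : ℂ) * (starRingEnd ℂ) τ))

/-- The generator `ε_F⁺ > 1` of the group of totally positive units of `𝓞_F`, i.e. the smallest
totally positive unit greater than `1`. -/
def epsPlus : ℝ :=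
  sInf {x : ℝ | 1 < x ∧ ∃ u : (𝓞 (QuadField Δ))ˣ,
    IsTotallyPositive Δ ((u : 𝓞 (QuadField Δ)) : QuadField Δ) ∧
      x = (((u : 𝓞 (QuadField Δ)) : QuadField Δ) : ℝ)}

/-- `ε_Δ = (ε_F⁺)²`, the generator of `Γ_Δ`, which acts on `ℝ` by `w ↦ w + log ε_Δ`. -/
def epsDisc : ℝ := epsPlus Δ ^ 2

/-- The `h`-component of Hecke's cusp form `ϑ⁻_𝔞(τ) = ∫_{Γ_Δ \ ℝ} Θ⁻_𝔞(τ, w) dw`. -/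
def heckeThetaMinus (𝔞 : FracIdeal Δ) (h : DiscModule Δ) (τ : ℂ) : ℂ :=
  ∫ w in (0 : ℝ)..Real.log (epsDisc Δ), thetaKernelMinus Δ 𝔞 h τ w

/-- The `h`-component of `ϑ⁻_𝔅 = ϑ⁻_{Nm⁻(𝔟)}`, where `𝔟 ∈ I_𝔡` represents `𝔅 ∈ Cl⁺(F)`. -/
def heckeThetaClass (𝔅 : NarrowClassGroup Δ) (h : DiscModule Δ) (τ : ℂ) : ℂ :=
  heckeThetaMinus Δ (nmMinus Δ ((Quotient.out 𝔅 : coprimeIdeals Δ) : (FracIdeal Δ)ˣ)) h τ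

variable {Δ}

/-- The `h`-component of `ϑ_χ = ∑_{𝔅 ∈ Cl⁺(F)} χ(𝔅) ϑ⁻_𝔅` (the group `Cl⁺(F)` is finite). -/
def thetaChi (χ : NarrowClassGroup Δ →* ℤˣ) (h : DiscModule Δ) (τ : ℂ) : ℂ :=
  ∑ᶠ 𝔅 : NarrowClassGroup Δ, (((χ 𝔅 : ℤˣ) : ℤ) : ℂ) * heckeThetaClass Δ 𝔅 h τ

/-- The Fourier coefficient `c_χ(m, h)` of `q^m`, `q = e^{2πiτ}`, in the `h`-component of `ϑ_χ`:
`(1/N) ∫_0^N ϑ_{χ,h}(u + i) e^{-2πim(u + i)} du`. As `ϑ_{χ,h}` has period `Δ`, the number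
`N = Δ · den(m)` is a common period of `ϑ_{χ,h}` and `e^{-2πimτ}`. -/
def coeffChi (χ : NarrowClassGroup Δ →* ℤˣ) (m : ℚ) (h : DiscModule Δ) : ℂ :=
  let N : ℝ := (Δ : ℝ) * (m.den : ℝ)
  (1 / (N : ℂ)) * ∫ u in (0 : ℝ)..N, thetaChi χ h ((u : ℂ) + Complex.I) *
    Complex.exp (-(2 * Real.pi * Complex.I * (m : ℂ) * ((u : ℂ) + Complex.I)))

/-- `n/Δ + Nm(h)`, which is well defined modulo `ℤ`, is integral at the prime `ℓ`, i.e. can be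
written as a fraction with denominator prime to `ℓ`. -/
def IsLocallyCompatible (ℓ : ℕ) (n : ℤ) (h : DiscModule Δ) : Prop :=
  ∃ x : invDiffModule Δ, DiscModule.mk Δ x = h ∧ ∃ d k : ℤ, ¬ (ℓ : ℤ) ∣ d ∧
    (d : QuadField Δ) * ((n : QuadField Δ) / (Δ : QuadField Δ) + nm Δ x) = k

end

end HeckeTheta

/-! Analysis. Every ideal 𝔞 = 𝔟/𝔟' that occurs has norm 1, and c_χ(m, h) unfolds into a sum over
narrow classes, weighted by χ, and over the λ ∈ 𝔞 + h with λλ' = -m. Up to the factor e^{2πm} that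
comes from Im τ = 1, the integrand in w is the derivative of a Gaussian primitive G evaluated at a
trace, so λ contributes G(tr λ) - G(tr ηλ), where η is the square of the conjugate of a totally
positive unit (`integral_kern`, `fourier_theta`, `coeffChi_eq`). Replacing λ by tλ with t totally
positive changes this term by d(λ) - d(ηλ), where d(λ) = G(tr tλ) - G(tr λ). For fixed norm, d is
summable, and η permutes the λ, so the sum does not change (`orbitSum_image_mul`). Only the sets of
λ, up to totally positive scaling, matter.

Divisibility. The only prime 𝔩 above ℓ is stable under conjugation, so an element of 𝔞 whose norm is
divisible by ℓ² lies in ℓ𝔞 (`IsUniquePrimeAbove.div_mem`). Hence the λ ∈ 𝔞 + ℓh of norm -ℓ²n/Δ are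
the ℓλ₁ with λ₁ of norm -n/Δ in a class h₁ such that ℓh₁ = ℓh. If ℓ ∤ Δ, multiplication by ℓ is
injective on A_Δ and h₁ = h. If ℓ ∣ Δ, the norm of h₁ at ℓ is prescribed: this leaves only h when ℓ
∣ n (`class_unique`), and h together with one further class h' when ℓ ∤ n (`exists_twistDatum`).

Twist. For ℓ ∣ Δ there is a totally positive y ∈ 𝔩 of norm ℓk with k prime to Δ. The ideal J = y𝔩⁻¹
is prime to 𝔡 and J/J' = (y/y'). Multiplication by y/y' carries the class h for 𝔞 to the class h'
for 𝔞J/J' (`TwistDatum.normSet_twist`). So the h'-sum at 𝔅[J] is the h-sum at 𝔅, and summation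
against χ gives χ([J]) = χ([𝔩])⁻¹ = χ([𝔩]) times c_χ(n/Δ, h).

Classes in 𝔞𝔡⁻¹/𝔞 are compared with A_Δ through multipliers c ≡ 1 mod 𝔡 with c𝔞 ⊆ 𝒪 (`IsMultiplier`,
`mem_coset_iff`). -/

namespace HeckeTheta

/-! ### Integers, traces and norms in ℚ(√Δ) -/

section Field

set_option linter.unusedSectionVars false

variable {Δ : ℤ} [hΔ : Fact (IsFundamentalDiscriminant Δ)] [hΔ1 : Fact (1 < Δ)]

lemma disc_pos_real : (0 : ℝ) < (Δ : ℝ) := by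
  exact_mod_cast (by have := hΔ1.out; omega : (0 : ℤ) < Δ)

lemma sqrtDisc_sq : sqrtDisc Δ ^ 2 = (Δ : QuadField Δ) := by
  apply Subtype.ext
  simpa [sqrtDisc] using Real.sq_sqrt (disc_pos_real (Δ := Δ)).le

lemma sqrtDisc_mul_self : sqrtDisc Δ * sqrtDisc Δ = (Δ : QuadField Δ) := by
  rw [← sq, sqrtDisc_sq]

lemma disc_ne_zero : (Δ : QuadField Δ) ≠ 0 := by
  exact_mod_cast (by have := hΔ1.out; omega : Δ ≠ 0)

lemma sqrtDisc_ne_zero : sqrtDisc Δ ≠ 0 := by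
  intro h
  have := sqrtDisc_sq (Δ := Δ)
  rw [h] at this
  exact disc_ne_zero (Δ := Δ) (by rw [← this]; simp)

lemma conj_sqrt : conj Δ (sqrtDisc Δ) = -sqrtDisc Δ := conj_sqrtDisc Δ hΔ.out hΔ1.out

lemma not_isSquare_disc : ¬ IsSquare (Δ : ℚ) := not_isSquare_of_fundamental hΔ.out hΔ1.out

lemma exists_rat_repr (x : QuadField Δ) :
    ∃ a b : ℚ, x = (a : QuadField Δ) + (b : QuadField Δ) * sqrtDisc Δ := by
  have hs : IsIntegral ℚ (√(Δ : ℝ)) := (isIntegral_sqrt Δ).tower_top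
  have hmin : minpoly ℚ (√(Δ : ℝ)) = Polynomial.X ^ 2 - Polynomial.C (Δ : ℚ) := by
    refine (minpoly.eq_of_irreducible_of_monic
      (X_pow_sub_C_irreducible_of_prime Nat.prime_two fun b hb =>
        not_isSquare_disc ⟨b, by rw [← hb, sq]⟩) ?_
      (Polynomial.monic_X_pow_sub_C _ two_ne_zero)).symm
    simp [Real.sq_sqrt (disc_pos_real (Δ := Δ)).le]
  let pb := IntermediateField.adjoin.powerBasis hs
  have hgen : pb.gen = sqrtDisc Δ := IntermediateField.adjoin.powerBasis_gen hs
  have hdim : pb.dim = 2 := by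
    rw [IntermediateField.adjoin.powerBasis_dim hs, hmin, Polynomial.natDegree_X_pow_sub_C]
  obtain ⟨f, hf, hx⟩ := pb.exists_eq_aeval x
  rw [hdim] at hf
  rw [hgen] at hx
  refine ⟨f.coeff 0, f.coeff 1, ?_⟩
  rw [hx, Polynomial.eq_X_add_C_of_natDegree_le_one (by omega : f.natDegree ≤ 1)]
  simp [add_comm]

lemma conj_rat_repr (a b : ℚ) :
    conj Δ ((a : QuadField Δ) + (b : QuadField Δ) * sqrtDisc Δ) = a - b * sqrtDisc Δ := by
  rw [map_add, map_mul, conj_sqrt, map_ratCast, map_ratCast]; ring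

@[simp] lemma conj_conj (x : QuadField Δ) : conj Δ (conj Δ x) = x := by
  obtain ⟨a, b, rfl⟩ := exists_rat_repr x
  rw [conj_rat_repr, map_sub, map_mul, conj_sqrt, map_ratCast, map_ratCast]; ring

lemma nm_conj (x : QuadField Δ) : nm Δ (conj Δ x) = nm Δ x := by
  simp [nm, mul_comm]

lemma nm_mul (x y : QuadField Δ) : nm Δ (x * y) = nm Δ x * nm Δ y := by
  simp only [nm, map_mul]; ring

lemma isIntegral_conj {x : QuadField Δ} (hx : IsIntegral ℤ x) : IsIntegral ℤ (conj Δ x) :=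
  hx.map ((conj Δ).toAlgHom.restrictScalars ℤ)

lemma int_of_isIntegral_rat {q : ℚ} (h : IsIntegral ℤ (q : QuadField Δ)) : ∃ k : ℤ, q = k := by
  have h' : IsIntegral ℤ q := by
    refine (isIntegral_algebraMap_iff (algebraMap ℚ (QuadField Δ)).injective).1 ?_
    simpa using h
  obtain ⟨k, hk⟩ := IsIntegrallyClosed.isIntegral_iff.1 h'
  exact ⟨k, by simpa using hk.symm⟩

lemma rat_add_mul_sqrt_inj {a b c d : ℚ}
    (h : (a : QuadField Δ) + (b : QuadField Δ) * sqrtDisc Δ = c + d * sqrtDisc Δ) :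
    a = c ∧ b = d := by
  have hc := congrArg (conj Δ) h
  rw [conj_rat_repr, conj_rat_repr] at hc
  have h1 : (a : QuadField Δ) = c := by linear_combination (h + hc) / 2
  have h2 : (b : QuadField Δ) = d :=
    mul_right_cancel₀ sqrtDisc_ne_zero (by linear_combination (h - hc) / 2)
  exact ⟨by exact_mod_cast h1, by exact_mod_cast h2⟩

/-- The squared denominator of `q` is prime to the squared numerator, hence divides `m`;
squarefreeness makes it 1. -/
lemma exists_int_of_sq_mul {m : ℤ} (hm : Squarefree m) {q : ℚ} {k : ℤ} (h : (m : ℚ) * q ^ 2 = k) :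
    ∃ j : ℤ, q = j := by
  have hm0 : m ≠ 0 := hm.ne_zero
  have h1 : m * q.num ^ 2 = k * (q.den : ℤ) ^ 2 := by
    have hq : q = q.num / q.den := (Rat.num_div_den q).symm
    have hd : (q.den : ℚ) ≠ 0 := by exact_mod_cast q.den_nz
    have : (m : ℚ) * (q.num : ℚ) ^ 2 = k * (q.den : ℚ) ^ 2 := by
      rw [← h, mul_assoc, ← mul_pow, Rat.mul_den_eq_num]
    exact_mod_cast this
  have hcop : IsCoprime ((q.den : ℤ) ^ 2) (q.num ^ 2) := by
    have := q.reduced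
    refine IsCoprime.pow (Int.isCoprime_iff_gcd_eq_one.2 ?_)
    rw [Int.gcd_comm]; simpa [Int.gcd] using this
  have h2 : (q.den : ℤ) ^ 2 ∣ m := hcop.dvd_of_dvd_mul_right ⟨k, by rw [h1]; ring⟩
  have h3 := hm (q.den : ℤ) (by rwa [sq] at h2)
  have h4 : q.den = 1 := by
    have := Int.isUnit_iff.1 h3
    have := q.den_pos
    omega
  exact ⟨q.num, by rw [← Rat.num_div_den q, h4]; simp⟩

/-- Integers of `F` are `(T + B√Δ)/2` with `T² ≡ ΔB² mod 4`. -/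
lemma exists_trace_repr {z : QuadField Δ} (hz : IsIntegral ℤ z) :
    ∃ T B : ℤ, z + conj Δ z = T ∧ z - conj Δ z = B * sqrtDisc Δ ∧ 4 ∣ T ^ 2 - Δ * B ^ 2 := by
  obtain ⟨a, b, rfl⟩ := exists_rat_repr z
  have hzc := isIntegral_conj hz
  have ht := hz.add hzc
  have hn := hz.mul hzc
  rw [conj_rat_repr] at ht hn ⊢
  obtain ⟨T, hT⟩ := int_of_isIntegral_rat (Δ := Δ) (q := 2 * a) (by
    have : ((2 * a : ℚ) : QuadField Δ) = a + b * sqrtDisc Δ + (a - b * sqrtDisc Δ) := by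
      push_cast; ring
    rwa [this])
  obtain ⟨N, hN⟩ := int_of_isIntegral_rat (Δ := Δ) (q := a ^ 2 - Δ * b ^ 2) (by
    have : ((a ^ 2 - Δ * b ^ 2 : ℚ) : QuadField Δ) =
        (a + b * sqrtDisc Δ) * (a - b * sqrtDisc Δ) := by
      push_cast; rw [← sqrtDisc_sq]; ring
    rwa [this])
  have key : ∀ B : ℤ, 2 * b = B → 4 ∣ T ^ 2 - Δ * B ^ 2 := by
    intro B hB
    refine ⟨N, ?_⟩
    have : (T : ℚ) ^ 2 - Δ * B ^ 2 = 4 * N := by rw [← hT, ← hB, ← hN]; ring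
    exact_mod_cast this
  suffices hB : ∃ B : ℤ, 2 * b = B by
    obtain ⟨B, hB⟩ := hB
    refine ⟨T, B, ?_, ?_, key B hB⟩
    · have := congrArg (fun q : ℚ => (q : QuadField Δ)) hT
      push_cast at this; rw [← this]; ring
    · have := congrArg (fun q : ℚ => (q : QuadField Δ)) hB
      push_cast at this; rw [← this]; ring
  have hTN : (Δ : ℚ) * (2 * b) ^ 2 = ((T ^ 2 - 4 * N : ℤ) : ℚ) := by
    push_cast; rw [← hT, ← hN]; ring
  rcases hΔ.out with ⟨-, hs⟩ | ⟨m, hm, hm4, hs⟩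
  · exact exists_int_of_sq_mul hs hTN
  -- Here squarefreeness of m only gives that γ = 4b is an integer. An odd γ would give m ≡ T² mod
  -- 4, that is m ≡ 0 or 1; so γ is even and 2b is an integer.
  · obtain ⟨γ, hγ⟩ := exists_int_of_sq_mul hs (q := 4 * b) (k := T ^ 2 - 4 * N) (by
      rw [← hTN, hm]; push_cast; ring)
    have hγ2 : m * γ ^ 2 = T ^ 2 - 4 * N := by
      have : (m : ℚ) * γ ^ 2 = ((T ^ 2 - 4 * N : ℤ) : ℚ) := by
        rw [← hTN, hm, ← hγ]; push_cast; ring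
      exact_mod_cast this
    have heven : γ % 2 = 0 := by
      by_contra hodd
      obtain ⟨c, rfl⟩ : ∃ c, γ = 2 * c + 1 := ⟨γ / 2, by omega⟩
      obtain ⟨t, ht | ht⟩ : ∃ t, T = 2 * t ∨ T = 2 * t + 1 := ⟨T / 2, by omega⟩
      · subst ht
        have : m = 4 * (t ^ 2 - N - m * (c ^ 2 + c)) := by linear_combination hγ2
        omega
      · subst ht
        have : m = 4 * (t ^ 2 + t - N - m * (c ^ 2 + c)) + 1 := by linear_combination hγ2
        omega
    refine ⟨γ / 2, ?_⟩
    have : γ = 2 * (γ / 2) := by omega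
    have h2 : (γ : ℚ) = 2 * ((γ / 2 : ℤ) : ℚ) := by exact_mod_cast this
    rw [← mul_left_cancel_iff_of_pos (by norm_num : (0 : ℚ) < 2), ← h2, ← hγ]; ring

lemma isIntegral_sqrtDisc : IsIntegral ℤ (sqrtDisc Δ) :=
  (isIntegral_algebraMap_iff (algebraMap (QuadField Δ) ℝ).injective).1 (isIntegral_sqrt Δ)

lemma isIntegral_intCast (k : ℤ) : IsIntegral ℤ (k : QuadField Δ) := by
  simpa using (isIntegral_algebraMap (R := ℤ) (A := QuadField Δ) (x := k))

/-- An element with integral trace and norm is integral. -/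
lemma isIntegral_of_trace_norm {z : QuadField Δ} {T N : ℤ} (hT : z + conj Δ z = T)
    (hN : nm Δ z = N) : IsIntegral ℤ z := by
  refine ⟨Polynomial.X ^ 2 - Polynomial.C T * Polynomial.X + Polynomial.C N, ?_, ?_⟩
  · monicity!
  · rw [Polynomial.eval₂_add, Polynomial.eval₂_sub, Polynomial.eval₂_mul,
      Polynomial.eval₂_pow, Polynomial.eval₂_X, Polynomial.eval₂_C, Polynomial.eval₂_C,
      eq_intCast, eq_intCast, ← hT, ← hN, nm]
    ring

lemma exists_norm_int {z : QuadField Δ} (hz : IsIntegral ℤ z) : ∃ N : ℤ, nm Δ z = N := by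
  obtain ⟨T, B, hT, hB, k, hk⟩ := exists_trace_repr hz
  refine ⟨k, ?_⟩
  have hk' : (T : QuadField Δ) ^ 2 - Δ * B ^ 2 = 4 * k := by exact_mod_cast hk
  rw [← hT, ← sqrtDisc_sq] at hk'
  have : (z - conj Δ z) ^ 2 = (B * sqrtDisc Δ) ^ 2 := by rw [hB]
  rw [nm]
  linear_combination (hk' - this) / 4

/-- `x - x'` is a multiple of `√Δ` for integral `x`. -/
lemma sub_conj_dvd {z : QuadField Δ} (hz : IsIntegral ℤ z) :
    IsIntegral ℤ ((z - conj Δ z) / sqrtDisc Δ) := by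
  obtain ⟨T, B, hT, hB, -⟩ := exists_trace_repr hz
  rw [hB, mul_div_cancel_right₀ _ sqrtDisc_ne_zero]
  exact isIntegral_intCast B

lemma conj_ne_zero {x : QuadField Δ} (hx : x ≠ 0) : conj Δ x ≠ 0 := by simpa using hx

end Field
end HeckeTheta

namespace HeckeTheta

/-! ### Conjugate ideals, 𝔟/𝔟', and congruences modulo 𝔡 -/

section Ideals

set_option linter.unusedSectionVars false

variable {Δ : ℤ} [hΔ : Fact (IsFundamentalDiscriminant Δ)] [hΔ1 : Fact (1 < Δ)]

lemma mem_one_iff {z : QuadField Δ} : z ∈ (1 : FracIdeal Δ) ↔ IsIntegral ℤ z := by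
  rw [FractionalIdeal.mem_one_iff]
  constructor
  · rintro ⟨x, rfl⟩
    exact NumberField.RingOfIntegers.isIntegral_coe x
  · intro h
    exact ⟨⟨z, h⟩, rfl⟩

lemma smul_mem_fracIdeal {I : FracIdeal Δ} {z c : QuadField Δ} (hz : z ∈ I)
    (hc : IsIntegral ℤ c) : c * z ∈ I := by
  have := (I : Submodule (𝓞 (QuadField Δ)) (QuadField Δ)).smul_mem (⟨c, hc⟩ : 𝓞 (QuadField Δ)) hz
  exact this

/-- `conjIdeal` is built from the map that `extended` induces on fractions; identifying this map
with `conj` gives elementwise access to conjugate ideals. -/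
lemma map_eq_conj (x : QuadField Δ) :
    IsLocalization.map (S := QuadField Δ) (QuadField Δ)
      (NumberField.RingOfIntegers.mapRingEquiv (conj Δ).toRingEquiv).toRingHom
      (nonZeroDivisors_le_comap_nonZeroDivisors_of_injective _
      (NumberField.RingOfIntegers.mapRingEquiv (conj Δ).toRingEquiv).injective) x = conj Δ x := by
  have : IsLocalization.map (S := QuadField Δ) (QuadField Δ)
      (NumberField.RingOfIntegers.mapRingEquiv (conj Δ).toRingEquiv).toRingHom
      (nonZeroDivisors_le_comap_nonZeroDivisors_of_injective _
      (NumberField.RingOfIntegers.mapRingEquiv (conj Δ).toRingEquiv).injective) =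
      ((conj Δ : QuadField Δ →+* QuadField Δ)) := by
    refine IsLocalization.ringHom_ext (nonZeroDivisors (𝓞 (QuadField Δ))) ?_
    ext y
    simp only [RingHom.comp_apply, IsLocalization.map_eq]
    rfl
  rw [this]; rfl

lemma mem_conjIdeal {I : FracIdeal Δ} {z : QuadField Δ} :
    z ∈ conjIdeal Δ I ↔ conj Δ z ∈ I := by
  rw [conjIdeal, FractionalIdeal.mem_extended_iff]
  constructor
  · intro h
    refine Submodule.span_induction (p := fun z _ => conj Δ z ∈ I) ?_ ?_ ?_ ?_ h
    · rintro _ ⟨y, hy, rfl⟩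
      rw [map_eq_conj, conj_conj]
      exact hy
    · rw [map_zero]; exact I.zero_mem
    · intro x y _ _ hx hy
      rw [map_add]
      exact (I : Submodule (𝓞 (QuadField Δ)) (QuadField Δ)).add_mem hx hy
    · intro a x _ hx
      rw [Algebra.smul_def, map_mul]
      exact smul_mem_fracIdeal hx (isIntegral_conj (NumberField.RingOfIntegers.isIntegral_coe a))
  · intro h
    refine Submodule.subset_span ⟨conj Δ z, h, ?_⟩
    rw [map_eq_conj, conj_conj]

lemma conjIdeal_mul (I J : FracIdeal Δ) :
    conjIdeal Δ (I * J) = conjIdeal Δ I * conjIdeal Δ J :=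
  FractionalIdeal.extended_mul _ _ _ _

lemma conjIdeal_one : conjIdeal Δ 1 = 1 := FractionalIdeal.extended_one _ _

lemma conjIdeal_conjIdeal (I : FracIdeal Δ) : conjIdeal Δ (conjIdeal Δ I) = I := by
  ext z
  rw [mem_conjIdeal, mem_conjIdeal, conj_conj]

lemma conjIdeal_spanSingleton (x : QuadField Δ) :
    conjIdeal Δ (FractionalIdeal.spanSingleton _ x) =
      FractionalIdeal.spanSingleton _ (conj Δ x) := by
  rw [conjIdeal, FractionalIdeal.extended_spanSingleton, map_eq_conj]

lemma conjIdeal_ne_zero {I : FracIdeal Δ} (hI : I ≠ 0) : conjIdeal Δ I ≠ 0 := by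
  intro h
  apply hI
  rw [← conjIdeal_conjIdeal I, h]
  exact FractionalIdeal.extended_zero _ _

lemma conjIdeal_inv {I : FracIdeal Δ} (hI : I ≠ 0) : conjIdeal Δ I⁻¹ = (conjIdeal Δ I)⁻¹ := by
  refine eq_inv_of_mul_eq_one_left ?_
  rw [← conjIdeal_mul, inv_mul_cancel₀ hI, conjIdeal_one]

lemma absNorm_conjIdeal (I : FracIdeal Δ) :
    FractionalIdeal.absNorm (conjIdeal Δ I) = FractionalIdeal.absNorm I := by
  obtain ⟨a, J, ha, rfl⟩ := FractionalIdeal.exists_eq_spanSingleton_mul I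
  rw [conjIdeal_mul, conjIdeal_spanSingleton, map_mul, map_mul]
  congr 1
  · rw [FractionalIdeal.absNorm_span_singleton, FractionalIdeal.absNorm_span_singleton,
      Algebra.norm_eq_of_algEquiv (conj Δ)]
  · rw [conjIdeal, FractionalIdeal.extended_coeIdeal_eq_map, FractionalIdeal.coeIdeal_absNorm,
      FractionalIdeal.coeIdeal_absNorm, Ideal.absNorm_apply, Ideal.absNorm_apply]
    congr 1
    rw [Submodule.cardQuot_apply, Submodule.cardQuot_apply]
    exact (Nat.card_congr (Ideal.quotientEquiv J _
      (NumberField.RingOfIntegers.mapRingEquiv (conj Δ).toRingEquiv) rfl).toEquiv).symm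

lemma nmMinus_eq (I : FracIdeal Δ) : nmMinus Δ I = I * (conjIdeal Δ I)⁻¹ := div_eq_mul_inv _ _

lemma nmMinus_mul (I J : FracIdeal Δ) : nmMinus Δ (I * J) = nmMinus Δ I * nmMinus Δ J := by
  simp only [nmMinus_eq, conjIdeal_mul, mul_inv]; ring

lemma nmMinus_ne_zero {I : FracIdeal Δ} (hI : I ≠ 0) : nmMinus Δ I ≠ 0 := by
  rw [nmMinus_eq]
  exact mul_ne_zero hI (inv_ne_zero (conjIdeal_ne_zero hI))

/-- Sets A = 1 in every theta kernel that enters the coefficients. -/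
lemma absNorm_nmMinus {I : FracIdeal Δ} (hI : I ≠ 0) :
    FractionalIdeal.absNorm (nmMinus Δ I) = 1 := by
  rw [nmMinus, map_div₀, absNorm_conjIdeal, div_self]
  rwa [ne_eq, FractionalIdeal.absNorm_eq_zero_iff]

/-- Makes norms integral: if z ∈ 𝔞 = 𝔟/𝔟', then z' ∈ 𝔞⁻¹, so zz' ∈ 𝒪. -/
lemma conjIdeal_nmMinus {I : FracIdeal Δ} (hI : I ≠ 0) :
    conjIdeal Δ (nmMinus Δ I) = (nmMinus Δ I)⁻¹ := by
  rw [nmMinus_eq, conjIdeal_mul, conjIdeal_inv (conjIdeal_ne_zero hI), conjIdeal_conjIdeal,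
    mul_inv, inv_inv, mul_comm]

lemma nmMinus_spanSingleton (x : QuadField Δ) :
    nmMinus Δ (FractionalIdeal.spanSingleton _ x) =
      FractionalIdeal.spanSingleton _ (x / conj Δ x) := by
  rw [nmMinus_eq, conjIdeal_spanSingleton, FractionalIdeal.spanSingleton_inv,
    FractionalIdeal.spanSingleton_mul_spanSingleton, div_eq_mul_inv]

lemma mem_mul_invDifferent {I : FracIdeal Δ} {z : QuadField Δ} :
    z ∈ I * invDifferent Δ ↔ sqrtDisc Δ * z ∈ I := by
  rw [invDifferent, mul_comm, FractionalIdeal.mem_singleton_mul]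
  constructor
  · rintro ⟨y, hy, rfl⟩
    rwa [mul_inv_cancel_left₀ sqrtDisc_ne_zero]
  · intro h
    exact ⟨_, h, by rw [inv_mul_cancel_left₀ sqrtDisc_ne_zero]⟩

lemma mem_invDifferent {z : QuadField Δ} :
    z ∈ invDifferent Δ ↔ IsIntegral ℤ (sqrtDisc Δ * z) := by
  rw [← mem_one_iff, ← mem_mul_invDifferent, one_mul]

/-- `c ≡ 1 mod 𝔡`. -/
def CongOne (c : QuadField Δ) : Prop := IsIntegral ℤ ((c - 1) / sqrtDisc Δ)

lemma CongOne.isIntegral {c : QuadField Δ} (hc : CongOne c) : IsIntegral ℤ c := by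
  have : c = (c - 1) / sqrtDisc Δ * sqrtDisc Δ + 1 := by
    rw [div_mul_cancel₀ _ sqrtDisc_ne_zero]; ring
  rw [this]
  exact (hc.mul isIntegral_sqrtDisc).add isIntegral_one

lemma CongOne.mul {c d : QuadField Δ} (hc : CongOne c) (hd : CongOne d) : CongOne (c * d) := by
  have : (c * d - 1) / sqrtDisc Δ = (c - 1) / sqrtDisc Δ * d + (d - 1) / sqrtDisc Δ := by
    field_simp; ring
  rw [CongOne, this]
  exact (IsIntegral.mul hc hd.isIntegral).add hd

lemma CongOne.conj {c : QuadField Δ} (hc : CongOne c) : CongOne (conj Δ c) := by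
  have := (isIntegral_conj hc).neg
  rw [map_div₀, map_sub, map_one, conj_sqrt, div_neg, neg_neg] at this
  exact this

lemma CongOne.of_congr {c d : QuadField Δ} (hc : CongOne c)
    (h : IsIntegral ℤ ((d - c) / sqrtDisc Δ)) : CongOne d := by
  have : (d - 1) / sqrtDisc Δ = (d - c) / sqrtDisc Δ + (c - 1) / sqrtDisc Δ := by
    field_simp; ring
  rw [CongOne, this]
  exact h.add hc

lemma congOne_intCast {k : ℤ} (h : Δ ∣ k - 1) : CongOne (k : QuadField Δ) := by
  obtain ⟨j, hj⟩ := h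
  have : ((k : QuadField Δ) - 1) / sqrtDisc Δ = j * sqrtDisc Δ := by
    rw [div_eq_iff sqrtDisc_ne_zero, mul_assoc, sqrtDisc_mul_self]
    have : ((k - 1 : ℤ) : QuadField Δ) = (Δ * j : ℤ) := by rw [hj]
    push_cast at this
    rw [this, mul_comm]
  rw [CongOne, this]
  exact (isIntegral_intCast j).mul isIntegral_sqrtDisc

/-- With c = 1 + √Δγ the norm is 1 + √Δ(γ - γ') - Δ Nm(γ), and γ - γ' is an integer multiple of √Δ.
-/
lemma CongOne.nm_congr {c : QuadField Δ} (hc : CongOne c) :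
    ∃ j : ℤ, nm Δ c = 1 + Δ * j := by
  obtain ⟨γ, hγ⟩ : ∃ γ, γ = (c - 1) / sqrtDisc Δ := ⟨_, rfl⟩
  have hγi : IsIntegral ℤ γ := hγ ▸ hc
  have hc' : c = 1 + sqrtDisc Δ * γ := by
    rw [hγ, mul_div_cancel₀ _ sqrtDisc_ne_zero]; ring
  obtain ⟨T, B, hT, hB, -⟩ := exists_trace_repr hγi
  obtain ⟨N, hN⟩ := exists_norm_int hγi
  refine ⟨B - N, ?_⟩
  rw [nm] at hN
  rw [hc', nm, map_add, map_mul, map_one, conj_sqrt]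
  push_cast
  have h2 := sqrtDisc_mul_self (Δ := Δ)
  linear_combination sqrtDisc Δ * hB + (B - γ * HeckeTheta.conj Δ γ) * h2 - Δ * hN

open IsDedekindDomain FractionalIdeal in
-- Write I = a⁻¹J. The prime v divides (a) and J to the same power; cancelling it leaves A₁I = J₁
-- with A₁ not contained in v, and any c ∈ A₁ outside v works.
lemma exists_not_mem_of_count_eq_zero (v : HeightOneSpectrum (𝓞 (QuadField Δ)))
    {I : FracIdeal Δ} (hI : I ≠ 0) (h : count (QuadField Δ) v I = 0) :
    ∃ c : 𝓞 (QuadField Δ), c ∉ v.asIdeal ∧ ∀ z ∈ I, IsIntegral ℤ ((c : QuadField Δ) * z) := by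
  obtain ⟨a, J, ha, hIJ⟩ := exists_eq_spanSingleton_mul I
  have key : ∀ A : Ideal (𝓞 (QuadField Δ)), A ≠ 0 → ∃ A1 : Ideal (𝓞 (QuadField Δ)), ∃ k : ℕ,
      A = v.asIdeal ^ k * A1 ∧ ¬ v.asIdeal ∣ A1 ∧ count (QuadField Δ) v (A : FracIdeal Δ) = k := by
    intro A hA
    obtain ⟨A1, hA1, hd⟩ :=
      (FiniteMultiplicity.of_prime_left v.prime hA).exists_eq_pow_mul_and_not_dvd
    refine ⟨A1, _, hA1, hd, ?_⟩
    have hA10 : A1 ≠ 0 := by rintro rfl; exact hd (dvd_zero _)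
    classical
    have h0 : count (QuadField Δ) v (A1 : FracIdeal Δ) = 0 := by
      rw [count_coe _ _ hA10]
      by_contra hne
      exact hd ((Associates.count_ne_zero_iff_dvd hA10 v.irreducible).1 (by exact_mod_cast hne))
    have hv0 : (v.asIdeal : FracIdeal Δ) ≠ 0 := coeIdeal_ne_zero.2 v.ne_bot
    nth_rewrite 1 [hA1]
    rw [coeIdeal_mul, count_mul _ _ (by rw [coeIdeal_pow]; exact pow_ne_zero _ hv0)
      (coeIdeal_ne_zero.2 hA10), h0, add_zero, coeIdeal_pow, count_pow, count_self, mul_one]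
  have ha' : (algebraMap (𝓞 (QuadField Δ)) (QuadField Δ) a) ≠ 0 := by simpa using ha
  have hJ0 : J ≠ 0 := by
    rintro rfl
    apply hI
    rw [hIJ]; simp
  have hsa : Ideal.span {a} ≠ 0 := by simpa using ha
  obtain ⟨J1, k, hJ1, hJd, hJc⟩ := key J hJ0
  obtain ⟨A1, j, hA1, hAd, hAc⟩ := key _ hsa
  have haI : ((Ideal.span {a} : Ideal (𝓞 (QuadField Δ))) : FracIdeal Δ) * I = J := by
    rw [hIJ, coeIdeal_span_singleton, ← mul_assoc, spanSingleton_mul_spanSingleton,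
      mul_inv_cancel₀ ha', spanSingleton_one, one_mul]
  have hkj : k = j := by
    have := congrArg (count (QuadField Δ) v) haI
    rw [count_mul _ _ (coeIdeal_ne_zero.2 hsa) hI, h, hAc, hJc, add_zero] at this
    exact_mod_cast this.symm
  subst hkj
  have hAI : (A1 : FracIdeal Δ) * I = J1 := by
    have hv0 : ((v.asIdeal : FracIdeal Δ)) ^ k ≠ 0 :=
      pow_ne_zero _ (coeIdeal_ne_zero.2 v.ne_bot)
    apply mul_left_cancel₀ hv0
    rw [hA1, hJ1, coeIdeal_mul, coeIdeal_mul, coeIdeal_pow, mul_assoc] at haI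
    exact haI
  have hnle : ¬ A1 ≤ v.asIdeal := fun hle => hAd (Ideal.dvd_iff_le.2 hle)
  obtain ⟨c, hc, hcv⟩ := Set.not_subset.1 hnle
  refine ⟨c, hcv, fun z hz => mem_one_iff.1 ?_⟩
  have : (algebraMap (𝓞 (QuadField Δ)) (QuadField Δ) c) * z ∈ (A1 : FracIdeal Δ) * I :=
    mul_mem_mul (mem_coeIdeal_of_mem _ hc) hz
  rw [hAI] at this
  exact coeIdeal_le_one this

/-- A multiplier `c ≡ 1 mod 𝔡` with `c𝔞 ⊆ 𝓞`. -/
def IsMultiplier (c : QuadField Δ) (I : FracIdeal Δ) : Prop :=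
  CongOne c ∧ ∀ z ∈ I, IsIntegral ℤ (c * z)

lemma IsMultiplier.conj {c : QuadField Δ} {I : FracIdeal Δ} (h : IsMultiplier c I) :
    IsMultiplier (conj Δ c) (conjIdeal Δ I) := by
  refine ⟨h.1.conj, fun z hz => ?_⟩
  have := isIntegral_conj (h.2 _ (mem_conjIdeal.1 hz))
  rwa [map_mul, conj_conj] at this

lemma IsMultiplier.mul {c d : QuadField Δ} {I J : FracIdeal Δ} (h : IsMultiplier c I)
    (h' : IsMultiplier d J) : IsMultiplier (c * d) (I * J) := by
  refine ⟨h.1.mul h'.1, fun z hz => ?_⟩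
  refine FractionalIdeal.mul_induction_on hz (fun i hi j hj => ?_) (fun x y hx hy => ?_)
  · have := (h.2 i hi).mul (h'.2 j hj)
    rwa [show c * i * (d * j) = c * d * (i * j) by ring] at this
  · rw [mul_add]; exact hx.add hy

open IsDedekindDomain in
-- The elements that multiply I into 𝒪 form an ideal contained in no prime that contains √Δ, so this
-- ideal is comaximal with √Δ𝒪. Splitting 1 accordingly yields c ≡ 1 mod 𝔡.
lemma exists_isMultiplier {I : (FracIdeal Δ)ˣ} (hI : I ∈ coprimeIdeals Δ) :
    ∃ c, IsMultiplier c (I : FracIdeal Δ) := by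
  let M : Ideal (𝓞 (QuadField Δ)) :=
    { carrier := {c | ∀ z ∈ (I : FracIdeal Δ), IsIntegral ℤ ((c : QuadField Δ) * z)}
      add_mem' := fun {a b} ha hb z hz => by
        have := (ha z hz).add (hb z hz)
        rwa [← add_mul] at this
      zero_mem' := fun z hz => by
        have : IsIntegral ℤ ((0 : QuadField Δ) * z) := by rw [zero_mul]; exact isIntegral_zero
        exact this
      smul_mem' := fun a b hb z hz => by
        have := (NumberField.RingOfIntegers.isIntegral_coe a).mul (hb z hz)
        rwa [← mul_assoc] at this }
  let s : 𝓞 (QuadField Δ) := ⟨sqrtDisc Δ, isIntegral_sqrtDisc⟩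
  have htop : M ⊔ Ideal.span {s} = ⊤ := by
    by_contra hne
    obtain ⟨m, hm, hle⟩ := Ideal.exists_le_maximal _ hne
    have hsm : s ∈ m := hle (Ideal.mem_sup_right (Ideal.mem_span_singleton_self s))
    have hm0 : m ≠ ⊥ := by
      rintro rfl
      have : s = 0 := by simpa using hsm
      exact sqrtDisc_ne_zero (congrArg (fun x : 𝓞 (QuadField Δ) => (x : QuadField Δ)) this)
    let v : HeightOneSpectrum (𝓞 (QuadField Δ)) := ⟨m, hm.isPrime, hm0⟩
    have h0 := hI v (by
      rw [different, FractionalIdeal.spanSingleton_le_iff_mem]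
      exact FractionalIdeal.mem_coeIdeal_of_mem _ hsm)
    obtain ⟨c, hcv, hc⟩ := exists_not_mem_of_count_eq_zero v I.ne_zero h0
    exact hcv (hle (Ideal.mem_sup_left hc))
  obtain ⟨c, hc, d, hd, hcd⟩ := Submodule.mem_sup.1 ((Ideal.eq_top_iff_one _).1 htop)
  obtain ⟨e, rfl⟩ := Ideal.mem_span_singleton'.1 hd
  refine ⟨c, ?_, hc⟩
  have : (c : QuadField Δ) + e * sqrtDisc Δ = 1 :=
    congrArg (fun x : 𝓞 (QuadField Δ) => (x : QuadField Δ)) hcd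
  have h2 : ((c : QuadField Δ) - 1) / sqrtDisc Δ = -e := by
    rw [div_eq_iff sqrtDisc_ne_zero]; linear_combination this
  rw [CongOne, h2]
  exact (NumberField.RingOfIntegers.isIntegral_coe e).neg

lemma exists_isMultiplier_nmMinus {I : (FracIdeal Δ)ˣ} (hI : I ∈ coprimeIdeals Δ) :
    ∃ c, IsMultiplier c (nmMinus Δ (I : FracIdeal Δ)) := by
  obtain ⟨c, hc⟩ := exists_isMultiplier hI
  obtain ⟨d, hd⟩ := exists_isMultiplier ((coprimeIdeals Δ).inv_mem hI)
  refine ⟨c * conj Δ d, ?_⟩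
  rw [nmMinus_eq, ← conjIdeal_inv I.ne_zero]
  rw [Units.val_inv_eq_inv_val] at hd
  exact hc.mul hd.conj

end Ideals
end HeckeTheta

namespace HeckeTheta

/-! ### Cosets 𝔞 + h and their elements of given norm -/

section Cosets

set_option linter.unusedSectionVars false

variable {Δ : ℤ} [hΔ : Fact (IsFundamentalDiscriminant Δ)] [hΔ1 : Fact (1 < Δ)]

lemma discModule_mk_eq {x y : invDiffModule Δ} :
    DiscModule.mk Δ x = DiscModule.mk Δ y ↔ IsIntegral ℤ ((x : QuadField Δ) - y) := by
  rw [Submodule.Quotient.eq, Submodule.mem_comap, ← mem_one_iff,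
    ← FractionalIdeal.coe_one (S := (𝓞 (QuadField Δ))⁰) (P := QuadField Δ)]
  exact Iff.rfl

/-- The class of `α/√Δ` in `A_Δ`, for integral `α`. -/
noncomputable def discClass (α : QuadField Δ) (hα : IsIntegral ℤ α) : DiscModule Δ :=
  DiscModule.mk Δ ⟨α / sqrtDisc Δ, by
    have : α / sqrtDisc Δ ∈ invDifferent Δ := by
      rwa [mem_invDifferent, mul_div_cancel₀ _ sqrtDisc_ne_zero]
    exact this⟩

lemma discModule_mk_eq_discClass (x : invDiffModule Δ) :
    ∃ hα : IsIntegral ℤ (sqrtDisc Δ * x), DiscModule.mk Δ x = discClass _ hα := by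
  have hx : (x : QuadField Δ) ∈ invDifferent Δ := x.2
  refine ⟨mem_invDifferent.1 hx, ?_⟩
  rw [discClass, discModule_mk_eq]
  simp [mul_div_cancel_left₀ _ (sqrtDisc_ne_zero (Δ := Δ)), isIntegral_zero]

lemma exists_discClass (h : DiscModule Δ) : ∃ α, ∃ hα : IsIntegral ℤ α, h = discClass α hα := by
  obtain ⟨x, rfl⟩ := Submodule.Quotient.mk_surjective _ h
  obtain ⟨hα, hx⟩ := discModule_mk_eq_discClass x
  exact ⟨_, hα, hx⟩

lemma discClass_eq {α β : QuadField Δ} {hα : IsIntegral ℤ α} {hβ : IsIntegral ℤ β} :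
    discClass α hα = discClass β hβ ↔ IsIntegral ℤ ((α - β) / sqrtDisc Δ) := by
  rw [discClass, discClass, discModule_mk_eq, sub_div]

lemma nsmul_discClass (ℓ : ℕ) {α : QuadField Δ} (hα : IsIntegral ℤ α) :
    ℓ • discClass α hα = discClass ((ℓ : QuadField Δ) * α)
      ((isIntegral_natCast ℓ).mul hα) := by
  rw [discClass, discClass, DiscModule.mk, ← Submodule.Quotient.mk_smul]
  congr 1
  apply Subtype.ext
  simp [mul_div_assoc]

/-- Since c ≡ 1 mod 𝔡, the element cl is congruent to l modulo 𝔞 and lies in (𝔞 ∩ 𝒪)𝔡⁻¹: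
multiplication by c realises the identification of 𝔞𝔡⁻¹/𝔞 with A_Δ. -/
lemma mem_coset_iff {c : QuadField Δ} {I : FracIdeal Δ} (hc : IsMultiplier c I)
    {α : QuadField Δ} {hα : IsIntegral ℤ α} {l : QuadField Δ} :
    l ∈ coset Δ I (discClass α hα) ↔
      sqrtDisc Δ * l ∈ I ∧ IsIntegral ℤ ((c * (sqrtDisc Δ * l) - α) / sqrtDisc Δ) := by
  have hs := sqrtDisc_ne_zero (Δ := Δ)
  constructor
  · rintro ⟨x, hx, hx1, hx2⟩
    rw [discClass, discModule_mk_eq] at hx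
    rw [mem_mul_invDifferent] at hx1
    have hxI : sqrtDisc Δ * (x : QuadField Δ) ∈ I := hx1.1
    have hx1' : IsIntegral ℤ (sqrtDisc Δ * (x : QuadField Δ)) := mem_one_iff.1 hx1.2
    have hsl : sqrtDisc Δ * l ∈ I := by
      have h1 := (I : Submodule (𝓞 (QuadField Δ)) (QuadField Δ)).add_mem hxI
        (smul_mem_fracIdeal hx2 isIntegral_sqrtDisc)
      rwa [← mul_add, add_sub_cancel] at h1
    refine ⟨hsl, ?_⟩
    have e : (c * (sqrtDisc Δ * l) - α) / sqrtDisc Δ =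
        c * (l - x) + (c - 1) / sqrtDisc Δ * (sqrtDisc Δ * x) + (x - α / sqrtDisc Δ) := by
      field_simp; ring
    rw [e]
    exact ((hc.2 _ hx2).add (IsIntegral.mul hc.1 hx1')).add hx
  · rintro ⟨h1, h2⟩
    have hci := hc.2 _ h1
    have hci2 := smul_mem_fracIdeal h1 hc.1.isIntegral
    have hcl : c * l ∈ invDifferent Δ := by
      rw [mem_invDifferent, mul_left_comm]; exact hci
    refine ⟨⟨c * l, hcl⟩, ?_, ?_, ?_⟩
    · rw [discClass, discModule_mk_eq]
      convert h2 using 1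
      simp only; field_simp
    · simp only
      rw [mem_mul_invDifferent, mul_left_comm]
      exact ⟨hci2, mem_one_iff.2 hci⟩
    · have e : l - c * l = -((c - 1) / sqrtDisc Δ) * (sqrtDisc Δ * l) := by
        field_simp; ring
      simp only [e]
      exact smul_mem_fracIdeal h1 (IsIntegral.neg hc.1)

/-- Elements of `𝔞 + h` of norm `-m`. -/
def normSet (I : FracIdeal Δ) (h : DiscModule Δ) (m : ℚ) : Set (QuadField Δ) :=
  {l | l ∈ coset Δ I h ∧ nm Δ l = -(m : QuadField Δ)}

/-- As f ≡ 1 mod 𝔡, the elements t and ft agree for the purposes of A_Δ, so multiplication by t acts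
on classes as the integral element ft. -/
lemma mul_mem_coset {t f : QuadField Δ} (hf : CongOne f) (hg : IsIntegral ℤ (f * t))
    {I J : FracIdeal Δ} (hJ : J = FractionalIdeal.spanSingleton _ t * I)
    {c d : QuadField Δ} (hc : IsMultiplier c I) (hd : IsMultiplier d J)
    {α : QuadField Δ} {hα : IsIntegral ℤ α} {l : QuadField Δ}
    (hl : l ∈ coset Δ I (discClass α hα)) :
    t * l ∈ coset Δ J (discClass (f * t * α) (hg.mul hα)) := by
  have hs := sqrtDisc_ne_zero (Δ := Δ)
  rw [mem_coset_iff hc] at hl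
  have hJm : sqrtDisc Δ * (t * l) ∈ J := by
    rw [hJ, FractionalIdeal.mem_singleton_mul]
    exact ⟨_, hl.1, by ring⟩
  rw [mem_coset_iff hd]
  refine ⟨hJm, ?_⟩
  have e : (d * (sqrtDisc Δ * (t * l)) - f * t * α) / sqrtDisc Δ =
      -((f * c - 1) / sqrtDisc Δ) * (d * (sqrtDisc Δ * (t * l))) +
      f * t * (c * (sqrtDisc Δ * l)) * ((d - 1) / sqrtDisc Δ) +
      f * t * ((c * (sqrtDisc Δ * l) - α) / sqrtDisc Δ) := by
    field_simp; ring
  rw [e]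
  refine ((IsIntegral.mul (IsIntegral.neg (hf.mul hc.1)) (hd.2 _ hJm)).add ?_).add (hg.mul hl.2)
  exact (hg.mul (hc.2 _ hl.1)).mul hd.1

lemma discClass_congOne_mul {f α : QuadField Δ} (hf : CongOne f) {hα : IsIntegral ℤ α} 
    {hα' : IsIntegral ℤ (f * α)} : discClass (f * α) hα' = discClass α hα := by
  rw [discClass_eq]
  have : (f * α - α) / sqrtDisc Δ = (f - 1) / sqrtDisc Δ * α := by ring
  rw [this]
  exact IsIntegral.mul hf hα

/-- Since tt' = 1, the inverse map is multiplication by t', to which `mul_mem_coset` applies with f'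
in place of f. -/
lemma normSet_mul {t f : QuadField Δ} (ht : nm Δ t = 1) (hf : CongOne f)
    (hg : IsIntegral ℤ (f * t))
    {I J : FracIdeal Δ} (hJ : J = FractionalIdeal.spanSingleton _ t * I)
    {c d : QuadField Δ} (hc : IsMultiplier c I) (hd : IsMultiplier d J)
    {α : QuadField Δ} {hα : IsIntegral ℤ α} {m : ℚ} :
    normSet J (discClass (f * t * α) (hg.mul hα)) m =
      (fun l => t * l) '' normSet I (discClass α hα) m := by
  ext l
  constructor
  · rintro ⟨hl, hn⟩
    have htt : t * conj Δ t = 1 := ht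
    have htt' : conj Δ t * t = 1 := by rw [mul_comm]; exact ht
    have hg' : IsIntegral ℤ (conj Δ f * conj Δ t) := by
      rw [← map_mul]; exact isIntegral_conj hg
    have hI : I = FractionalIdeal.spanSingleton _ (conj Δ t) * J := by
      rw [hJ, ← mul_assoc, FractionalIdeal.spanSingleton_mul_spanSingleton, htt',
        FractionalIdeal.spanSingleton_one, one_mul]
    have h1 := mul_mem_coset hf.conj hg' hI hd hc hl
    have h2 : conj Δ f * conj Δ t * (f * t * α) = (conj Δ f * f) * α := by
      linear_combination conj Δ f * f * α * htt'
    refine ⟨conj Δ t * l, ⟨?_, ?_⟩, ?_⟩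
    · have h3 : discClass _ (hg'.mul (hg.mul hα)) = discClass α hα := by
        rw [discClass_eq, h2]
        have h4 := (discClass_congOne_mul (hf.conj.mul hf) (hα := hα)
          (hα' := (hf.conj.mul hf).isIntegral.mul hα))
        rwa [discClass_eq] at h4
      rwa [h3] at h1
    · rw [nm_mul, nm_conj, ht, one_mul, hn]
    · simp only; rw [← mul_assoc, htt, one_mul]
  · rintro ⟨l, ⟨hl, hn⟩, rfl⟩
    refine ⟨mul_mem_coset hf hg hJ hc hd hl, ?_⟩
    rw [nm_mul, ht, one_mul, hn]

lemma natCast_mul_mem_normSet {ℓ : ℕ} {c : QuadField Δ} {I : FracIdeal Δ}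
    (hc : IsMultiplier c I)
    {α : QuadField Δ} {hα : IsIntegral ℤ α} {m : ℚ} {l : QuadField Δ}
    (hl : l ∈ normSet I (discClass α hα) m) :
    (ℓ : QuadField Δ) * l ∈ normSet I (ℓ • discClass α hα) ((ℓ : ℚ) ^ 2 * m) := by
  obtain ⟨h1, h2⟩ := hl
  rw [mem_coset_iff hc] at h1
  refine ⟨?_, ?_⟩
  · rw [nsmul_discClass, mem_coset_iff hc]
    constructor
    · rw [mul_left_comm]; exact smul_mem_fracIdeal h1.1 (isIntegral_natCast ℓ)
    · have := IsIntegral.mul (isIntegral_natCast (R := ℤ) ℓ) h1.2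
      rwa [show (ℓ : QuadField Δ) * ((c * (sqrtDisc Δ * l) - α) / sqrtDisc Δ) =
        (c * (sqrtDisc Δ * (ℓ * l)) - ℓ * α) / sqrtDisc Δ by ring] at this
  · rw [nm_mul, h2, nm, map_natCast]; push_cast; ring

end Cosets

/-! ### Divisibility by ℓ when a single prime lies above it -/

section UniquePrime

set_option linter.unusedSectionVars false

variable {Δ : ℤ} [hΔ : Fact (IsFundamentalDiscriminant Δ)] [hΔ1 : Fact (1 < Δ)]

/-- The conjugation on `𝓞_F`. -/
noncomputable abbrev conjInt (Δ : ℤ) : 𝓞 (QuadField Δ) ≃+* 𝓞 (QuadField Δ) :=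
  NumberField.RingOfIntegers.mapRingEquiv (conj Δ).toRingEquiv

lemma coe_conjInt (x : 𝓞 (QuadField Δ)) :
    ((conjInt Δ x : 𝓞 (QuadField Δ)) : QuadField Δ) = conj Δ x := rfl

/-- `𝔩` is the only prime ideal of `𝓞_F` above `ℓ`. -/
def IsUniquePrimeAbove (ℓ : ℕ) (𝔩 : Ideal (𝓞 (QuadField Δ))) : Prop :=
  ∀ 𝔭 : Ideal (𝓞 (QuadField Δ)), (𝔭.IsPrime ∧ (ℓ : 𝓞 (QuadField Δ)) ∈ 𝔭) ↔ 𝔭 = 𝔩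

variable {ℓ : ℕ} {𝔩 : Ideal (𝓞 (QuadField Δ))}

lemma IsUniquePrimeAbove.isPrime (h : IsUniquePrimeAbove ℓ 𝔩) : 𝔩.IsPrime := ((h 𝔩).2 rfl).1

lemma IsUniquePrimeAbove.mem (h : IsUniquePrimeAbove ℓ 𝔩) : (ℓ : 𝓞 (QuadField Δ)) ∈ 𝔩 :=
  ((h 𝔩).2 rfl).2

lemma IsUniquePrimeAbove.comap (h : IsUniquePrimeAbove ℓ 𝔩) :
    𝔩.comap (conjInt Δ : 𝓞 (QuadField Δ) →+* 𝓞 (QuadField Δ)) = 𝔩 := by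
  have := h.isPrime
  refine (h _).1 ⟨Ideal.comap_isPrime _ _, ?_⟩
  rw [Ideal.mem_comap, map_natCast]
  exact h.mem

lemma IsUniquePrimeAbove.conj_mem (h : IsUniquePrimeAbove ℓ 𝔩) {x : 𝓞 (QuadField Δ)} :
    conjInt Δ x ∈ 𝔩 ↔ x ∈ 𝔩 := by
  conv_rhs => rw [← h.comap]
  exact Iff.rfl

/-- One of x, x' lies in 𝔩, and 𝔩 is stable under conjugation. -/
lemma IsUniquePrimeAbove.mem_of_norm (h : IsUniquePrimeAbove ℓ 𝔩) {x : 𝓞 (QuadField Δ)} {N : ℤ}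
    (hN : nm Δ x = (ℓ : QuadField Δ) * N) : x ∈ 𝔩 := by
  have : x * conjInt Δ x = (ℓ : 𝓞 (QuadField Δ)) * N := by
    apply NumberField.RingOfIntegers.coe_injective
    simpa [nm] using hN
  rcases h.isPrime.mem_or_mem (this ▸ 𝔩.mul_mem_right _ h.mem) with h1 | h1
  · exact h1
  · exact h.conj_mem.1 h1

lemma IsUniquePrimeAbove.dvd_of_mem (hℓ : ℓ.Prime) (h : IsUniquePrimeAbove ℓ 𝔩) {k : ℤ}
    (hk : (k : 𝓞 (QuadField Δ)) ∈ 𝔩) : (ℓ : ℤ) ∣ k := by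
  by_contra hne
  have hcop : IsCoprime (ℓ : ℤ) k :=
    (Nat.prime_iff_prime_int.1 hℓ).coprime_iff_not_dvd.2 hne
  obtain ⟨a, b, hab⟩ := hcop
  apply h.isPrime.ne_top
  rw [Ideal.eq_top_iff_one]
  have : (1 : 𝓞 (QuadField Δ)) = a * ℓ + b * k := by exact_mod_cast hab.symm
  rw [this]
  exact 𝔩.add_mem (𝔩.mul_mem_left _ h.mem) (𝔩.mul_mem_left _ hk)

/-- z lies in 𝔩, hence so does z + z', and 𝔩 ∩ ℤ = ℓℤ. Thus z/ℓ has integral trace and norm; the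
inert and ramified cases need no separation. -/
lemma IsUniquePrimeAbove.isIntegral_div (hℓ : ℓ.Prime) (h : IsUniquePrimeAbove ℓ 𝔩)
    {z : QuadField Δ} (hz : IsIntegral ℤ z) {N : ℤ} (hN : nm Δ z = (ℓ : QuadField Δ) ^ 2 * N) :
    IsIntegral ℤ (z / ℓ) := by
  have hℓ0 : (ℓ : QuadField Δ) ≠ 0 := by exact_mod_cast hℓ.ne_zero
  have hm : (⟨z, hz⟩ : 𝓞 (QuadField Δ)) ∈ 𝔩 :=
    h.mem_of_norm (N := ℓ * N) (by push_cast; rw [← mul_assoc, ← sq]; exact hN)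
  obtain ⟨T, B, hT, -, -⟩ := exists_trace_repr hz
  have hTm : (T : 𝓞 (QuadField Δ)) ∈ 𝔩 := by
    have := 𝔩.add_mem hm (h.conj_mem.2 hm)
    convert this using 1
    apply NumberField.RingOfIntegers.coe_injective
    have h1 : (((T : 𝓞 (QuadField Δ))) : QuadField Δ) = (T : QuadField Δ) := by simp
    refine h1.trans hT.symm
  obtain ⟨T', hT'⟩ := h.dvd_of_mem hℓ hTm
  refine isIntegral_of_trace_norm (T := T') (N := N) ?_ ?_
  · rw [map_div₀, map_natCast, ← add_div, hT, hT']
    push_cast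
    rw [mul_div_cancel_left₀ _ hℓ0]
  · rw [nm, map_div₀, map_natCast, div_mul_div_comm, ← sq, div_eq_iff (pow_ne_zero 2 hℓ0),
      mul_comm (N : QuadField Δ)]
    exact hN

/-- An element of `(𝔟/𝔟')𝔡⁻¹` times `ℓ` is divisible by `ℓ` as soon as its norm is divisible by `ℓ²`. -/
lemma IsUniquePrimeAbove.div_mem (hℓ : ℓ.Prime) (h : IsUniquePrimeAbove ℓ 𝔩)
    {I : FracIdeal Δ} (hI : I ≠ 0) {θ : QuadField Δ} (hθ : θ ∈ nmMinus Δ I)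
    {N : ℤ} (hN : nm Δ θ = (ℓ : QuadField Δ) ^ 2 * N) : θ / ℓ ∈ nmMinus Δ I := by
  have hA := nmMinus_ne_zero hI
  -- Divisibility is tested against each z ∈ 𝔞⁻¹, where 𝔞 = 𝔟/𝔟'. The product θz is integral, and
  -- Nm(z) is an integer because z' ∈ 𝔞, so ℓ² still divides Nm(θz).
  have key : FractionalIdeal.spanSingleton _ (θ / ℓ) * (nmMinus Δ I)⁻¹ ≤ 1 := by
    rw [FractionalIdeal.spanSingleton_mul_le_iff]
    intro z hz
    have hz' : conj Δ z ∈ nmMinus Δ I := by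
      rw [← conjIdeal_nmMinus hI, mem_conjIdeal] at hz
      exact hz
    have h1 : IsIntegral ℤ (θ * z) := by
      rw [← mem_one_iff, ← mul_inv_cancel₀ hA]
      exact FractionalIdeal.mul_mem_mul hθ hz
    have h2 : IsIntegral ℤ (nm Δ z) := by
      rw [← mem_one_iff, ← inv_mul_cancel₀ hA]
      exact FractionalIdeal.mul_mem_mul hz hz'
    have h3 : ∃ N' : ℤ, nm Δ z = N' := by
      obtain ⟨a, b, hab⟩ := exists_rat_repr z
      have h4 : nm Δ z = ((a ^ 2 - Δ * b ^ 2 : ℚ) : QuadField Δ) := by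
        rw [hab, nm, conj_rat_repr]; push_cast; rw [← sqrtDisc_sq]; ring
      rw [h4] at h2
      obtain ⟨k, hk⟩ := int_of_isIntegral_rat h2
      exact ⟨k, by rw [h4, hk]; simp⟩
    obtain ⟨N', hN'⟩ := h3
    rw [mem_one_iff, div_mul_eq_mul_div]
    refine h.isIntegral_div hℓ h1 (N := N * N') ?_
    rw [nm_mul, hN, hN']; push_cast; ring
  have h5 := mul_le_mul_left key (nmMinus Δ I)
  rw [mul_assoc, inv_mul_cancel₀ hA, mul_one, one_mul,
    FractionalIdeal.spanSingleton_le_iff_mem] at h5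
  exact h5

end UniquePrime
end HeckeTheta

namespace HeckeTheta

/-! ### Classes in A_Δ at an odd ramified prime, and the twist -/

section Arithmetic

set_option linter.unusedSectionVars false

variable {Δ : ℤ} [hΔ : Fact (IsFundamentalDiscriminant Δ)] [hΔ1 : Fact (1 < Δ)]

lemma conj_intCast_mul_sqrt (a b : ℤ) :
    conj Δ ((a : QuadField Δ) + (b : QuadField Δ) * sqrtDisc Δ) = a - b * sqrtDisc Δ := by
  rw [map_add, map_mul, conj_sqrt, map_intCast, map_intCast]; ring

lemma int_add_mul_sqrt_inj {a b c d : ℤ}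
    (h : (a : QuadField Δ) + (b : QuadField Δ) * sqrtDisc Δ = c + d * sqrtDisc Δ) :
    a = c ∧ b = d := by
  have := rat_add_mul_sqrt_inj (Δ := Δ) (a := a) (b := b) (c := c) (d := d) (by exact_mod_cast h)
  exact ⟨by exact_mod_cast this.1, by exact_mod_cast this.2⟩

lemma exists_half_repr {z : QuadField Δ} (hz : IsIntegral ℤ z) :
    ∃ T B : ℤ, 2 * z = T + B * sqrtDisc Δ ∧ 4 ∣ T ^ 2 - Δ * B ^ 2 := by
  obtain ⟨T, B, hT, hB, h⟩ := exists_trace_repr hz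
  exact ⟨T, B, by linear_combination hT + hB, h⟩

lemma isIntegral_iff_of_half_repr {z : QuadField Δ} {T B : ℤ}
    (h : 2 * z = T + B * sqrtDisc Δ) : IsIntegral ℤ z ↔ 4 ∣ T ^ 2 - Δ * B ^ 2 := by
  constructor
  · intro hz
    obtain ⟨T', B', h', hd⟩ := exists_half_repr hz
    obtain ⟨rfl, rfl⟩ := int_add_mul_sqrt_inj (h'.symm.trans h)
    exact hd
  · rintro ⟨N, hN⟩
    have hc : 2 * conj Δ z = T - B * sqrtDisc Δ := by
      rw [← conj_intCast_mul_sqrt, ← h, map_mul, map_ofNat]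
    refine isIntegral_of_trace_norm (T := T) (N := N) ?_ ?_
    · linear_combination (h + hc) / 2
    · have hN' : (T : QuadField Δ) ^ 2 - Δ * B ^ 2 = 4 * N := by exact_mod_cast hN
      have h4 : (2 * z) * (2 * conj Δ z) = T ^ 2 - Δ * B ^ 2 := by
        rw [h, hc, ← sqrtDisc_sq]; ring
      rw [nm]
      linear_combination (h4 + hN') / 4

lemma four_nm_eq {z : QuadField Δ} {T B N : ℤ} (h : 2 * z = T + B * sqrtDisc Δ)
    (hN : nm Δ z = N) : T ^ 2 - Δ * B ^ 2 = 4 * N := by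
  have hc : 2 * conj Δ z = T - B * sqrtDisc Δ := by
    rw [← conj_intCast_mul_sqrt, ← h, map_mul, map_ofNat]
  have h4 : (2 * z) * (2 * conj Δ z) = T ^ 2 - Δ * B ^ 2 := by
    rw [h, hc, ← sqrtDisc_sq]; ring
  have : (T : QuadField Δ) ^ 2 - Δ * B ^ 2 = 4 * N := by
    rw [← h4, ← hN, nm]; ring
  exact_mod_cast this

lemma isIntegral_div_sqrt_iff {z : QuadField Δ} {T B : ℤ}
    (h : 2 * z = T + B * sqrtDisc Δ) :
    IsIntegral ℤ (z / sqrtDisc Δ) ↔ ∃ b : ℤ, T = Δ * b ∧ 4 ∣ B ^ 2 - Δ * b ^ 2 := by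
  have hs := sqrtDisc_ne_zero (Δ := Δ)
  constructor
  · intro hz
    obtain ⟨B', b, h', hd⟩ := exists_half_repr hz
    have h2 : ((Δ * b : ℤ) : QuadField Δ) + B' * sqrtDisc Δ = T + B * sqrtDisc Δ := by
      rw [← h]
      push_cast
      rw [← sqrtDisc_mul_self]
      field_simp at h'
      linear_combination -h'
    obtain ⟨h3, rfl⟩ := int_add_mul_sqrt_inj h2
    exact ⟨b, h3.symm, hd⟩
  · rintro ⟨b, rfl, hd⟩
    refine (isIntegral_iff_of_half_repr (T := B) (B := b) ?_).2 hd
    push_cast at h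
    rw [← mul_div_assoc, h, ← sqrtDisc_mul_self]
    field_simp; ring

/-- Multiplication by ℓ is invertible on A_Δ, which is killed by Δ: use uℓ + vΔ = 1. -/
lemma div_sqrt_of_not_dvd {ℓ : ℕ} (hℓ : ℓ.Prime) (hd : ¬ (ℓ : ℤ) ∣ Δ) {δ : QuadField Δ}
    (hδ : IsIntegral ℤ δ) (h : IsIntegral ℤ (ℓ * δ / sqrtDisc Δ)) :
    IsIntegral ℤ (δ / sqrtDisc Δ) := by
  obtain ⟨u, v, huv⟩ := (Nat.prime_iff_prime_int.1 hℓ).coprime_iff_not_dvd.2 hd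
  have huv' : (u : QuadField Δ) * ℓ + v * Δ = 1 := by exact_mod_cast huv
  have e : δ / sqrtDisc Δ = u * (ℓ * δ / sqrtDisc Δ) + v * (sqrtDisc Δ * δ) := by
    have hs := sqrtDisc_ne_zero (Δ := Δ)
    rw [← sqrtDisc_mul_self] at huv'
    field_simp
    linear_combination -δ * huv'
  rw [e]
  exact ((isIntegral_intCast u).mul h).add
    ((isIntegral_intCast v).mul (isIntegral_sqrtDisc.mul hδ))

/-- An odd prime divides a fundamental discriminant at most once. -/
lemma odd_prime_coprime {ℓ : ℕ} (hℓ : ℓ.Prime) (hodd : ℓ ≠ 2) {Δ' : ℤ} (hd : Δ = ℓ * Δ') :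
    IsCoprime (ℓ : ℤ) Δ' := by
  rw [(Nat.prime_iff_prime_int.1 hℓ).coprime_iff_not_dvd]
  rintro ⟨x, rfl⟩
  have hnu : ¬ IsUnit (ℓ : ℤ) := (Nat.prime_iff_prime_int.1 hℓ).not_isUnit
  rcases hΔ.out with ⟨-, hs⟩ | ⟨m, hm, -, hs⟩
  · exact hnu (hs ℓ ⟨x, by rw [hd]; ring⟩)
  · refine hnu (hs ℓ ?_)
    have h1 : IsCoprime ((ℓ : ℤ) * ℓ) (2 * 2) := by
      have h2 : IsCoprime (ℓ : ℤ) 2 := by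
        have := (Nat.coprime_primes hℓ Nat.prime_two).2 hodd
        exact_mod_cast Nat.isCoprime_iff_coprime.2 this
      exact IsCoprime.mul_left (h2.mul_right h2) (h2.mul_right h2)
    exact h1.dvd_of_dvd_mul_left ⟨x, by linear_combination hd - hm⟩

/-- The ℓ-part of A_Δ has order ℓ and is detected by the trace `a` mod ℓ; integrality of ℓδ/√Δ takes
care of the other primes. -/
lemma div_sqrt_of_odd {ℓ : ℕ} (hℓ : ℓ.Prime) (hodd : ℓ ≠ 2) (hd : (ℓ : ℤ) ∣ Δ) {δ : QuadField Δ}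
    {a r : ℤ} (hδ : 2 * δ = a + r * sqrtDisc Δ) (h : IsIntegral ℤ (ℓ * δ / sqrtDisc Δ))
    (ha : (ℓ : ℤ) ∣ a) : IsIntegral ℤ (δ / sqrtDisc Δ) := by
  obtain ⟨Δ', hΔ'⟩ := hd
  have hcop := odd_prime_coprime hℓ hodd hΔ'
  have hℓ0 : (ℓ : ℤ) ≠ 0 := by exact_mod_cast hℓ.ne_zero
  rw [isIntegral_div_sqrt_iff (T := ℓ * a) (B := ℓ * r)
    (by push_cast; linear_combination (ℓ : QuadField Δ) * hδ)] at h
  obtain ⟨b, hb, h4⟩ := h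
  obtain ⟨a', rfl⟩ := ha
  have h1 : (ℓ : ℤ) * a' = Δ' * b := mul_left_cancel₀ hℓ0 (by rw [hb, ← mul_assoc, ← hΔ'])
  obtain ⟨b', rfl⟩ : (ℓ : ℤ) ∣ b := hcop.dvd_of_dvd_mul_left ⟨a', h1.symm⟩
  rw [isIntegral_div_sqrt_iff hδ]
  refine ⟨b', by rw [h1, hΔ']; ring, ?_⟩
  have h2 : IsCoprime (4 : ℤ) ((ℓ : ℤ) * ℓ) := by
    have h3 : IsCoprime (2 : ℤ) ℓ := by
      have := (Nat.coprime_primes Nat.prime_two hℓ).2 hodd.symm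
      exact_mod_cast Nat.isCoprime_iff_coprime.2 this
    have h4 : IsCoprime (2 * 2 : ℤ) ℓ := h3.mul_left h3
    have h5 : IsCoprime (4 : ℤ) ℓ := by simpa using h4
    exact h5.mul_right h5
  exact h2.dvd_of_dvd_mul_left (by
    rwa [show (ℓ : ℤ) * ℓ * (r ^ 2 - Δ * b' ^ 2) = (ℓ * r) ^ 2 - Δ * (ℓ * b') ^ 2 by ring])

lemma sqrt_pos_lt : 0 < ((sqrtDisc Δ : QuadField Δ) : ℝ) ∧
    ((sqrtDisc Δ : QuadField Δ) : ℝ) < (Δ : ℝ) + 1 := by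
  have h := disc_pos_real (Δ := Δ)
  have h1 : (1 : ℝ) < Δ := by exact_mod_cast hΔ1.out
  refine ⟨Real.sqrt_pos.2 h, ?_⟩
  have : √(Δ : ℝ) ≤ Δ := by
    rw [Real.sqrt_le_left (by linarith)]
    nlinarith
  change √(Δ : ℝ) < _
  linarith

/-- An element `y` of norm `ℓk`, with `kk' ≡ 1 mod Δ`: a totally positive generator of `𝔩` up to
factors prime to `𝔡`. -/
structure TwistDatum (Δ : ℤ) (ℓ : ℕ) where
  y : QuadField Δ
  k : ℤ
  k' : ℤ
  isIntegral : IsIntegral ℤ y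
  pos : IsTotallyPositive Δ y
  norm : nm Δ y = ℓ * k
  inv : Δ ∣ k * k' - 1
  isIntegral_sq : IsIntegral ℤ (y ^ 2 / ℓ)

/-- The multiplier by which the twist acts on `A_Δ`. -/
noncomputable def TwistDatum.g {ℓ : ℕ} (D : TwistDatum Δ ℓ) : QuadField Δ := D.k' * (D.y ^ 2 / ℓ)

lemma TwistDatum.isIntegral_g {ℓ : ℕ} (D : TwistDatum Δ ℓ) : IsIntegral ℤ D.g :=
  (isIntegral_intCast _).mul D.isIntegral_sq

lemma TwistDatum.congOne {ℓ : ℕ} (D : TwistDatum Δ ℓ) :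
    CongOne ((D.k : QuadField Δ) * (D.k' : QuadField Δ)) := by
  have := congOne_intCast (Δ := Δ) D.inv
  push_cast at this
  exact this

/-- Away from ℓ the twist acts trivially: ℓg = k'y² ≡ k'yy' = ℓkk' ≡ ℓ mod 𝔡, because y ≡ y' mod 𝔡
and kk' ≡ 1 mod Δ. -/
lemma TwistDatum.isIntegral_mul_sub {ℓ : ℕ} (hℓ : ℓ.Prime) (D : TwistDatum Δ ℓ) {α : QuadField Δ}
    (hα : IsIntegral ℤ α) : IsIntegral ℤ (ℓ * (D.g * α - α) / sqrtDisc Δ) := by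
  have hℓ0 : (ℓ : QuadField Δ) ≠ 0 := by exact_mod_cast hℓ.ne_zero
  have hs := sqrtDisc_ne_zero (Δ := Δ)
  have e : ℓ * (D.g * α - α) / sqrtDisc Δ =
      ℓ * α * (((D.k : QuadField Δ) * D.k' - 1) / sqrtDisc Δ) +
      D.k' * D.y * α * ((D.y - conj Δ D.y) / sqrtDisc Δ) := by
    have hn := D.norm
    rw [nm] at hn
    rw [TwistDatum.g]
    field_simp
    linear_combination α * D.k' * hn
  rw [e]
  refine IsIntegral.add (((isIntegral_natCast ℓ).mul hα).mul D.congOne) ?_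
  exact (((isIntegral_intCast _).mul D.isIntegral).mul hα).mul (sub_conj_dvd D.isIntegral)

/-- The twist acts on the classes `h ∈ A_Δ` of norm `-n/Δ mod ℤ_ℓ`, `ℓ ∤ n`, as the nontrivial
permutation of each of their fibres under multiplication by `ℓ`. -/
def TwistDatum.IsSwap {ℓ : ℕ} (D : TwistDatum Δ ℓ) : Prop :=
  ∀ {α β : QuadField Δ} {n N₁ N₂ d k j : ℤ}, IsIntegral ℤ α → IsIntegral ℤ β → nm Δ α = N₁ →
    nm Δ β = N₂ → ¬ (ℓ : ℤ) ∣ d → d * (n - N₁) = k * Δ → N₂ = n + Δ * j → ¬ (ℓ : ℤ) ∣ n →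
    IsIntegral ℤ (ℓ * (β - α) / sqrtDisc Δ) →
    (IsIntegral ℤ ((β - α) / sqrtDisc Δ) ∨ IsIntegral ℤ ((β - D.g * α) / sqrtDisc Δ)) ∧
    ¬ IsIntegral ℤ ((D.g * α - α) / sqrtDisc Δ)

/-- As a is the trace of α, a² - Δr² = 4 Nm(α). Local compatibility thus fixes a² mod ℓ, hence a up
to sign. -/
lemma trace_sq_congr {ℓ : ℕ} (hℓ : ℓ.Prime) (hd : (ℓ : ℤ) ∣ Δ) {α : QuadField Δ}
    {n N d k a r : ℤ} (hα : 2 * α = a + r * sqrtDisc Δ)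
    (hN : nm Δ α = N) (hdd : ¬ (ℓ : ℤ) ∣ d) (h : d * (n - N) = k * Δ) :
    (ℓ : ℤ) ∣ a ^ 2 - 4 * n := by
  have h1 := four_nm_eq hα hN
  have h2 : (ℓ : ℤ) ∣ n - N :=
    ((Nat.prime_iff_prime_int.1 hℓ).dvd_or_dvd (h ▸ hd.mul_left k)).resolve_left hdd
  have : a ^ 2 - 4 * n = Δ * r ^ 2 - 4 * (n - N) := by linarith
  rw [this]
  exact dvd_sub (hd.mul_right _) (h2.mul_left 4)

lemma trace_sq_congr' {ℓ : ℕ} (hd : (ℓ : ℤ) ∣ Δ) {β : QuadField Δ}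
    {n N j a r : ℤ} (hβ : 2 * β = a + r * sqrtDisc Δ)
    (hN : nm Δ β = N) (h : N = n + Δ * j) : (ℓ : ℤ) ∣ a ^ 2 - 4 * n := by
  have h1 := four_nm_eq hβ hN
  have : a ^ 2 - 4 * n = Δ * (r ^ 2 + 4 * j) := by rw [h] at h1; linarith
  rw [this]
  exact hd.mul_right _

/-- For ℓ ∣ n both traces vanish mod ℓ, so no sign is left to choose. -/
lemma class_unique_of_odd {ℓ : ℕ} (hℓ : ℓ.Prime) (hodd : ℓ ≠ 2) (hd : (ℓ : ℤ) ∣ Δ)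
    {α β : QuadField Δ} {n N₁ N₂ d k j : ℤ} (hα : IsIntegral ℤ α) (hβ : IsIntegral ℤ β)
    (hN₁ : nm Δ α = N₁) (hN₂ : nm Δ β = N₂) (hdd : ¬ (ℓ : ℤ) ∣ d) (h₁ : d * (n - N₁) = k * Δ)
    (h₂ : N₂ = n + Δ * j) (hn : (ℓ : ℤ) ∣ n)
    (h : IsIntegral ℤ (ℓ * (β - α) / sqrtDisc Δ)) : IsIntegral ℤ ((β - α) / sqrtDisc Δ) := by
  have hp := Nat.prime_iff_prime_int.1 hℓ
  obtain ⟨a, r, har, -⟩ := exists_half_repr hα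
  obtain ⟨b, q, hbq, -⟩ := exists_half_repr hβ
  have ha : (ℓ : ℤ) ∣ a := hp.dvd_of_dvd_pow
    ((dvd_sub_left (hn.mul_left 4)).1 (trace_sq_congr hℓ hd har hN₁ hdd h₁))
  have hb : (ℓ : ℤ) ∣ b := hp.dvd_of_dvd_pow
    ((dvd_sub_left (hn.mul_left 4)).1 (trace_sq_congr' hd hbq hN₂ h₂))
  refine div_sqrt_of_odd hℓ hodd hd (a := b - a) (r := q - r) ?_ h (dvd_sub hb ha)
  push_cast
  linear_combination hbq - har

lemma exists_twistDatum_of_odd {ℓ : ℕ} (hℓ : ℓ.Prime) (hodd : ℓ ≠ 2) (hd : (ℓ : ℤ) ∣ Δ) :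
    ∃ D : TwistDatum Δ ℓ, D.IsSwap := by
  have hp := Nat.prime_iff_prime_int.1 hℓ
  have hℓ0 : (ℓ : QuadField Δ) ≠ 0 := by exact_mod_cast hℓ.ne_zero
  have hs2 := sqrtDisc_mul_self (Δ := Δ)
  obtain ⟨Δ', hΔ'⟩ := id hd
  have hcop := odd_prime_coprime hℓ hodd hΔ'
  have hΔK : (Δ : QuadField Δ) = ℓ * Δ' := by
    have := congrArg (fun x : ℤ => (x : QuadField Δ)) hΔ'
    push_cast at this; exact this
  -- The factor Δ + 1 exceeds √Δ, which makes y totally positive, and it is 1 mod Δ. So k = ℓ(Δ+1)²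
  -- - Δ' is ≡ -Δ' mod ℓ and ≡ ℓ mod Δ', hence prime to Δ = ℓΔ'.
  obtain ⟨y, hy⟩ : ∃ y : QuadField Δ, y = ((ℓ * (Δ + 1) : ℤ) : QuadField Δ) +
    ((1 : ℤ) : QuadField Δ) * sqrtDisc Δ := ⟨_, rfl⟩
  have hyc : conj Δ y = ((ℓ * (Δ + 1) : ℤ) : QuadField Δ) -
    ((1 : ℤ) : QuadField Δ) * sqrtDisc Δ := by rw [hy, conj_intCast_mul_sqrt]
  obtain ⟨k, hk⟩ : ∃ k : ℤ, k = ℓ * (Δ + 1) ^ 2 - Δ' := ⟨_, rfl⟩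
  have hnorm : nm Δ y = ℓ * k := by
    rw [nm, hyc, hy, hk]; push_cast
    linear_combination -hs2 - hΔK
  have hkcop : IsCoprime k Δ := by
    rw [hΔ']
    refine IsCoprime.mul_right ?_ ?_
    · rw [hk, sub_eq_neg_add, IsCoprime.add_mul_left_left_iff]
      exact hcop.symm.neg_left
    · have : k = ℓ + Δ' * (ℓ * (ℓ * ℓ * Δ' + 2 * ℓ) - 1) := by rw [hk, hΔ']; ring
      rw [this, IsCoprime.add_mul_left_left_iff]
      exact hcop
  obtain ⟨k', v, hkv⟩ := hkcop
  have hsq : y ^ 2 / ℓ = ((k + 2 * Δ' : ℤ) : QuadField Δ) +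
      ((2 * (Δ + 1) : ℤ) : QuadField Δ) * sqrtDisc Δ := by
    rw [div_eq_iff hℓ0, hy, hk]; push_cast
    linear_combination hs2 + hΔK
  obtain ⟨hs0, hs1⟩ := sqrt_pos_lt (Δ := Δ)
  have hℓ1 : (1 : ℝ) ≤ ℓ := by exact_mod_cast hℓ.one_lt.le
  have hle : (Δ : ℝ) + 1 ≤ ℓ * (Δ + 1) := by
    have := disc_pos_real (Δ := Δ)
    nlinarith
  let D : TwistDatum Δ ℓ :=
    { y := y
      k := k
      k' := k'
      isIntegral := by
        rw [hy]
        exact (isIntegral_intCast _).add ((isIntegral_intCast _).mul isIntegral_sqrtDisc)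
      pos := by
        rw [IsTotallyPositive, hyc, hy]
        push_cast
        constructor <;> linarith
      norm := hnorm
      inv := ⟨-v, by linear_combination hkv⟩
      isIntegral_sq := by
        rw [hsq]
        exact (isIntegral_intCast _).add ((isIntegral_intCast _).mul isIntegral_sqrtDisc) }
  refine ⟨D, ?_⟩
  intro α β n N₁ N₂ d j' j hα hβ hN₁ hN₂ hdd h₁ h₂ hn h
  have hg : D.g = ((k' * (k + 2 * Δ') : ℤ) : QuadField Δ) +
      ((k' * (2 * (Δ + 1)) : ℤ) : QuadField Δ) * sqrtDisc Δ := by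
    change (k' : QuadField Δ) * (y ^ 2 / ℓ) = _
    rw [hsq]; push_cast; ring
  obtain ⟨a, r, har, -⟩ := exists_half_repr hα
  obtain ⟨b, q, hbq, -⟩ := exists_half_repr hβ
  obtain ⟨G, hG⟩ : ∃ G : ℤ, G = k' * (k + 2 * Δ') := ⟨_, rfl⟩
  obtain ⟨H, hH⟩ : ∃ H : ℤ, H = k' * (2 * (Δ + 1)) := ⟨_, rfl⟩
  rw [← hG, ← hH] at hg
  have hga : 2 * (D.g * α) = ((G * a + Δ * (H * r) : ℤ) : QuadField Δ) +
      ((G * r + H * a : ℤ) : QuadField Δ) * sqrtDisc Δ := by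
    rw [hg]; push_cast
    linear_combination ((G : QuadField Δ) + H * sqrtDisc Δ) * har + (H * r : QuadField Δ) * hs2
  -- From k ≡ -Δ' mod ℓ one gets k'(k + 2Δ') ≡ -k'k ≡ -1: the twist negates traces mod ℓ.
  have hGm : (ℓ : ℤ) ∣ G + 1 := by
    have : G + 1 = -(k' * k + v * Δ - 1) + k' * (2 * k + 2 * Δ') + v * Δ := by
      rw [hG]; ring
    rw [this, hkv, hk]
    have h3 : -(1 - 1) + k' * (2 * (↑ℓ * (Δ + 1) ^ 2 - Δ') + 2 * Δ') + v * Δ =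
      ℓ * (k' * (2 * (Δ + 1) ^ 2) + v * Δ') := by rw [hΔ']; ring
    exact ⟨_, h3⟩
  have ha := trace_sq_congr hℓ hd har hN₁ hdd h₁
  have hb := trace_sq_congr' hd hbq hN₂ h₂
  have h2 : ¬ (ℓ : ℤ) ∣ 2 := by
    intro h
    have := (Nat.prime_dvd_prime_iff_eq hℓ Nat.prime_two).1 (by exact_mod_cast h)
    exact hodd this
  have ha0 : ¬ (ℓ : ℤ) ∣ a := by
    intro h3
    have h4 : (ℓ : ℤ) ∣ 2 * 2 * n := by
      have := dvd_sub (h3.mul_right a) ha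
      rwa [show a * a - (a ^ 2 - 4 * n) = 2 * 2 * n by ring] at this
    rcases hp.dvd_or_dvd h4 with h5 | h5
    · rcases hp.dvd_or_dvd h5 with h6 | h6 <;> exact h2 h6
    · exact hn h5
  -- The two traces agree up to sign mod ℓ, and the sign decides between the class of α and that of
  -- gα. These differ because ℓ ∤ 2a.
  have hab : (ℓ : ℤ) ∣ (b - a) * (b + a) := by
    have := dvd_sub hb ha
    rwa [show b ^ 2 - 4 * n - (a ^ 2 - 4 * n) = (b - a) * (b + a) by ring] at this
  constructor
  · rcases hp.dvd_or_dvd hab with h3 | h3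
    · left
      refine div_sqrt_of_odd hℓ hodd hd (a := b - a) (r := q - r) ?_ h h3
      push_cast
      linear_combination hbq - har
    · right
      refine div_sqrt_of_odd hℓ hodd hd (a := b - (G * a + Δ * (H * r)))
        (r := q - (G * r + H * a)) ?_ ?_ ?_
      · push_cast at hga ⊢
        linear_combination hbq - hga
      · have := h.sub (D.isIntegral_mul_sub hℓ hα)
        rwa [← sub_div, ← mul_sub, sub_sub_sub_cancel_right] at this
      · have : b - (G * a + Δ * (H * r)) = (b + a) - (G + 1) * a - Δ * (H * r) := by ring
        rw [this]
        exact dvd_sub (dvd_sub h3 (hGm.mul_right a)) (hd.mul_right _)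
  · intro h3
    rw [isIntegral_div_sqrt_iff (T := G * a + Δ * (H * r) - a) (B := G * r + H * a - r)
      (by push_cast at hga ⊢; linear_combination hga - har)] at h3
    obtain ⟨b', hb', -⟩ := h3
    have h4 : (ℓ : ℤ) ∣ 2 * a := by
      have h5 : 2 * a = (G + 1) * a - Δ * (b' - H * r) := by linarith
      rw [h5]
      exact dvd_sub (hGm.mul_right a) (hd.mul_right _)
    rcases hp.dvd_or_dvd h4 with h6 | h6
    · exact h2 h6
    · exact ha0 h6

end Arithmetic
end HeckeTheta

namespace HeckeTheta

/-! ### The ramified prime 2, and both cases combined -/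

section Even

set_option linter.unusedSectionVars false

variable {Δ : ℤ} [hΔ : Fact (IsFundamentalDiscriminant Δ)] [hΔ1 : Fact (1 < Δ)]

lemma exists_even_repr {m : ℤ} (hm : Δ = 4 * m) {z : QuadField Δ} (hz : IsIntegral ℤ z) :
    ∃ a r : ℤ, 2 * z = ((2 * a : ℤ) : QuadField Δ) + r * sqrtDisc Δ := by
  obtain ⟨T, B, h, k, hk⟩ := exists_half_repr hz
  have h1 : (2 : ℤ) ∣ T ^ 2 := ⟨2 * (k + m * B ^ 2), by rw [hm] at hk; linear_combination hk⟩
  obtain ⟨a, rfl⟩ := Int.prime_two.dvd_of_dvd_pow h1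
  exact ⟨a, B, h⟩

lemma nm_even_repr {m : ℤ} (hm : Δ = 4 * m) {z : QuadField Δ} {a r N : ℤ}
    (h : 2 * z = ((2 * a : ℤ) : QuadField Δ) + r * sqrtDisc Δ) (hN : nm Δ z = N) :
    N = a ^ 2 - m * r ^ 2 := by
  have := four_nm_eq h hN
  rw [hm] at this
  linarith

/-- Consequently the 2-part of A_Δ is recorded by (a mod 4, r mod 2) if m ≡ 2 mod 4 and by (a mod 2,
r mod 2) if m ≡ 3 mod 4. -/
lemma even_div_sqrt_iff {m : ℤ} (hm : Δ = 4 * m) {z : QuadField Δ} {a r : ℤ}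
    (h : 2 * z = ((2 * a : ℤ) : QuadField Δ) + r * sqrtDisc Δ) :
    IsIntegral ℤ (z / sqrtDisc Δ) ↔ 2 * m ∣ a ∧ 2 ∣ r := by
  rw [isIntegral_div_sqrt_iff h]
  constructor
  · rintro ⟨b, hb, k, hk⟩
    refine ⟨⟨b, by rw [hm] at hb; linarith⟩, ?_⟩
    exact Int.prime_two.dvd_of_dvd_pow (n := 2)
      ⟨2 * (k + m * b ^ 2), by rw [hm] at hk; linear_combination hk⟩
  · rintro ⟨⟨b, rfl⟩, ⟨c, rfl⟩⟩
    exact ⟨b, by rw [hm]; ring, c ^ 2 - m * b ^ 2, by rw [hm]; ring⟩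

lemma even_two_mul_div_sqrt {m : ℤ} (hm : Δ = 4 * m) {z : QuadField Δ} {a r : ℤ}
    (h : 2 * z = ((2 * a : ℤ) : QuadField Δ) + r * sqrtDisc Δ)
    (hz : IsIntegral ℤ ((2 : ℕ) * z / sqrtDisc Δ)) : m ∣ a := by
  have h1 := (even_div_sqrt_iff hm (z := (2 : ℕ) * z) (a := 2 * a) (r := 2 * r) (by
    push_cast at h ⊢; linear_combination (2 : QuadField Δ) * h)).1 hz
  obtain ⟨⟨b, hb⟩, -⟩ := h1
  exact ⟨b, by linarith⟩

lemma even_sub_repr {x y : QuadField Δ} {a r b q : ℤ}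
    (h : 2 * x = ((2 * a : ℤ) : QuadField Δ) + r * sqrtDisc Δ)
    (h' : 2 * y = ((2 * b : ℤ) : QuadField Δ) + q * sqrtDisc Δ) :
    2 * (x - y) = ((2 * (a - b) : ℤ) : QuadField Δ) + ((r - q : ℤ) : QuadField Δ) * sqrtDisc Δ := by
  push_cast at h h' ⊢
  linear_combination h - h'

/-- Squares modulo `8`. -/
lemma sq_mod_eight (x : ℤ) :
    (∃ t, x = 2 * t ∧ x ^ 2 = 4 * t ^ 2) ∨ (∃ t, x % 2 = 1 ∧ x ^ 2 = 8 * t + 1) := by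
  rcases Int.even_or_odd x with ⟨t, ht⟩ | hx
  · exact Or.inl ⟨t, by omega, by rw [ht]; ring⟩
  · right
    obtain ⟨t, rfl⟩ := hx
    obtain ⟨u, hu⟩ := Int.even_mul_succ_self t
    exact ⟨u, by omega, by linear_combination 4 * hu⟩

lemma mul_sq_mod_eight {m : ℤ} (hm : m % 4 = 2) (r : ℤ) :
    (r % 2 = 0 ∧ (m * r ^ 2) % 8 = 0) ∨ (r % 2 = 1 ∧ (m * r ^ 2) % 8 = m % 8) := by
  obtain ⟨p, rfl⟩ : ∃ p, m = 2 * p := ⟨m / 2, by omega⟩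
  rcases sq_mod_eight r with ⟨t, h1, h2⟩ | ⟨t, h1, h2⟩
  · left
    rw [h2, show 2 * p * (4 * t ^ 2) = 8 * (p * t ^ 2) by ring]
    omega
  · right
    rw [h2, show 2 * p * (8 * t + 1) = 8 * (2 * p * t) + 2 * p by ring]
    omega

lemma sq_mod_eight_cases (a : ℤ) : (a % 2 = 1 ∧ a ^ 2 % 8 = 1) ∨ (a % 4 = 0 ∧ a ^ 2 % 8 = 0) ∨
    (a % 4 = 2 ∧ a ^ 2 % 8 = 4) := by
  rcases sq_mod_eight a with ⟨t, h1, h2⟩ | ⟨t, h1, h2⟩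
  · rcases sq_mod_eight t with ⟨u, h3, h4⟩ | ⟨u, h3, h4⟩ <;> omega
  · omega

lemma mul_sq_mod_four {m : ℤ} (hm : m % 4 = 3) (r : ℤ) :
    (r % 2 = 0 ∧ (m * r ^ 2) % 4 = 0) ∨ (r % 2 = 1 ∧ (m * r ^ 2) % 4 = 3) := by
  rcases sq_mod_eight r with ⟨t, h1, h2⟩ | ⟨t, h1, h2⟩
  · left
    rw [h2, show m * (4 * t ^ 2) = 4 * (m * t ^ 2) by ring]
    omega
  · right
    rw [h2, show m * (8 * t + 1) = 4 * (2 * m * t) + m by ring]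
    omega

/-- Extracts from local compatibility, where d is odd, the congruence of n and the norm modulo the
2-part of Δ, which is 8 or 4. -/
lemma odd_mul_dvd {d e k x m : ℤ} (hd : ¬ 2 ∣ d) (h : d * x = k * (e * m)) (he : e ∣ 8) :
    e ∣ x := by
  have h1 : IsCoprime (2 : ℤ) d := Int.prime_two.coprime_iff_not_dvd.2 hd
  have h2 : IsCoprime (8 : ℤ) d := by
    simpa using (h1.pow_left : IsCoprime ((2 : ℤ) ^ 3) d)
  exact (h2.of_isCoprime_of_dvd_left he).dvd_of_dvd_mul_left ⟨k * m, by rw [h]; ring⟩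

lemma two_mul_dvd_of_two_mod_four {m a : ℤ} (hm : m % 4 = 2) (h : m ∣ a) (h4 : a % 4 = 0) :
    2 * m ∣ a := by
  obtain ⟨p, hp⟩ : ∃ p, m = 2 * p := ⟨m / 2, by omega⟩
  obtain ⟨b, rfl⟩ := h
  have : (2 : ℤ) ∣ p * b := by
    rw [hp, mul_assoc] at h4
    omega
  rcases Int.prime_two.dvd_or_dvd this with h1 | ⟨c, rfl⟩
  · omega
  · exact ⟨c, by ring⟩

lemma two_mul_dvd_of_odd {m a : ℤ} (hm : m % 4 = 3) (h : m ∣ a) (h2 : a % 2 = 0) :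
    2 * m ∣ a := by
  obtain ⟨b, rfl⟩ := h
  rcases Int.prime_two.dvd_or_dvd (Int.dvd_of_emod_eq_zero h2) with h1 | ⟨c, rfl⟩
  · omega
  · exact ⟨c, by ring⟩

lemma class_unique_of_even (hd : ((2 : ℕ) : ℤ) ∣ Δ)
    {α β : QuadField Δ} {n N₁ N₂ d k j : ℤ} (hα : IsIntegral ℤ α) (hβ : IsIntegral ℤ β)
    (hN₁ : nm Δ α = N₁) (hN₂ : nm Δ β = N₂) (hdd : ¬ ((2 : ℕ) : ℤ) ∣ d)
    (h₁ : d * (n - N₁) = k * Δ)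
    (h₂ : N₂ = n + Δ * j) (hn : ((2 : ℕ) : ℤ) ∣ n)
    (h : IsIntegral ℤ ((2 : ℕ) * (β - α) / sqrtDisc Δ)) : IsIntegral ℤ ((β - α) / sqrtDisc Δ) := by
  rcases hΔ.out with ⟨h1, -⟩ | ⟨m, hm, hm4, -⟩
  · push_cast at hd; omega
  push_cast at hd hdd hn
  obtain ⟨a, r, har⟩ := exists_even_repr hm hα
  obtain ⟨b, q, hbq⟩ := exists_even_repr hm hβ
  have e₁ := nm_even_repr hm har hN₁
  have e₂ := nm_even_repr hm hbq hN₂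
  have hsub := even_sub_repr hbq har
  have hma := even_two_mul_div_sqrt hm hsub h
  rw [even_div_sqrt_iff hm hsub]
  rcases hm4 with hm4 | hm4
  · obtain ⟨p, hp⟩ : ∃ p, m = 2 * p := ⟨m / 2, by omega⟩
    have h8 : (8 : ℤ) ∣ n - N₁ :=
      odd_mul_dvd (m := p) hdd (k := k) (by rw [h₁, hm, hp]; ring) dvd_rfl
    have h8' : Δ * j = 8 * (p * j) := by rw [hm, hp]; ring
    -- Here n ≡ a² - mr² mod 8. For n even, a is even, and the four pairs (a mod 4, r mod 2) give
    -- four different values mod 8.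
    have key : (b - a) % 4 = 0 ∧ (q - r) % 2 = 0 := by
      rcases mul_sq_mod_eight hm4 r with h1 | h1 <;> rcases mul_sq_mod_eight hm4 q with h2 | h2 <;>
      rcases sq_mod_eight_cases a with h3 | h3 | h3 <;>
      rcases sq_mod_eight_cases b with h4 | h4 | h4 <;> omega
    exact ⟨two_mul_dvd_of_two_mod_four hm4 hma key.1, Int.dvd_of_emod_eq_zero key.2⟩
  · have h8 : (4 : ℤ) ∣ n - N₁ :=
      odd_mul_dvd (m := m) hdd (k := k) (by rw [h₁, hm]) (by norm_num)
    have h8' : Δ * j = 4 * (m * j) := by rw [hm]; ring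
    -- Here n ≡ a² + r² mod 4. For n even, a and r are both even (n ≡ 0) or both odd (n ≡ 2).
    have key : (b - a) % 2 = 0 ∧ (q - r) % 2 = 0 := by
      rcases mul_sq_mod_four hm4 r with h1 | h1 <;> rcases mul_sq_mod_four hm4 q with h2 | h2 <;>
      rcases sq_mod_eight_cases a with h3 | h3 | h3 <;>
      rcases sq_mod_eight_cases b with h4 | h4 | h4 <;> omega
    exact ⟨two_mul_dvd_of_odd hm4 hma key.1, Int.dvd_of_emod_eq_zero key.2⟩

lemma even_mul_repr {m : ℤ} (hm : Δ = 4 * m) {x y : QuadField Δ} {a r b q : ℤ}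
    (h : 2 * x = ((2 * a : ℤ) : QuadField Δ) + r * sqrtDisc Δ)
    (h' : 2 * y = ((2 * b : ℤ) : QuadField Δ) + q * sqrtDisc Δ) :
    2 * (x * y) = ((2 * (a * b + m * (r * q)) : ℤ) : QuadField Δ) +
      ((a * q + r * b : ℤ) : QuadField Δ) * sqrtDisc Δ := by
  have hs2 := sqrtDisc_mul_self (Δ := Δ)
  have hmK : (Δ : QuadField Δ) = 4 * m := by
    have := congrArg (fun x : ℤ => (x : QuadField Δ)) hm
    push_cast at this; exact this
  rw [hmK] at hs2
  push_cast at h h' ⊢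
  linear_combination y * h + ((2 * a + r * sqrtDisc Δ) / 2 : QuadField Δ) * h' + (r * q / 2 : QuadField Δ) * hs2

lemma conj_even_repr {x : QuadField Δ} {a r : ℤ}
    (h : 2 * x = ((2 * a : ℤ) : QuadField Δ) + r * sqrtDisc Δ) :
    2 * conj Δ x = ((2 * a : ℤ) : QuadField Δ) + ((-r : ℤ) : QuadField Δ) * sqrtDisc Δ := by
  have := congrArg (conj Δ) h
  rw [conj_intCast_mul_sqrt, map_mul, map_ofNat] at this
  rw [this]; push_cast; ring

lemma isIntegral_even {m : ℤ} (hm : Δ = 4 * m) {x : QuadField Δ} {a r : ℤ}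
    (h : 2 * x = ((2 * a : ℤ) : QuadField Δ) + r * sqrtDisc Δ) : IsIntegral ℤ x :=
  (isIntegral_iff_of_half_repr h).2 ⟨a ^ 2 - m * r ^ 2, by rw [hm]; ring⟩

/-- The twist datum attached to `y = b + √Δ/2`. -/
lemma exists_twistDatum_even {m b k : ℤ} (hm : Δ = 4 * m) (hb : Δ + 1 ≤ b)
    (hk : 2 * k = b ^ 2 - m) (hcop : IsCoprime k Δ) :
    ∃ D : TwistDatum Δ 2, D.k = k ∧
      2 * D.g = ((2 * (D.k' * (k + m)) : ℤ) : QuadField Δ) +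
        ((D.k' * b : ℤ) : QuadField Δ) * sqrtDisc Δ := by
  obtain ⟨y, hy⟩ : ∃ y : QuadField Δ, 2 * y = ((2 * b : ℤ) : QuadField Δ) +
    ((1 : ℤ) : QuadField Δ) * sqrtDisc Δ :=
    ⟨(((2 * b : ℤ) : QuadField Δ) + ((1 : ℤ) : QuadField Δ) * sqrtDisc Δ) / 2, by ring⟩
  have hyi := isIntegral_even hm hy
  have hyc := conj_even_repr hy
  have hy2 := even_mul_repr hm hy hy
  obtain ⟨k', v, hkv⟩ := hcop
  have hkK : (2 : QuadField Δ) * k = b ^ 2 - m := by exact_mod_cast hk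
  have hnorm : nm Δ y = (2 : ℕ) * k := by
    have h1 := even_mul_repr hm hy hyc
    rw [nm]
    push_cast at h1 ⊢
    linear_combination h1 / 2 - hkK
  have hsq : 2 * (y ^ 2 / (2 : ℕ)) = ((2 * (k + m) : ℤ) : QuadField Δ) +
      (b : QuadField Δ) * sqrtDisc Δ := by
    push_cast at hy2 ⊢
    linear_combination hy2 / 2 - hkK
  have h2r : ((2 : QuadField Δ) : ℝ) = 2 := rfl
  have hyr : 2 * (y : ℝ) = 2 * b + ((sqrtDisc Δ : QuadField Δ) : ℝ) := by
    have := congrArg (fun x : QuadField Δ => (x : ℝ)) hy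
    push_cast at this
    rw [h2r] at this
    linarith
  have hycr : 2 * ((conj Δ y : QuadField Δ) : ℝ) = 2 * b - ((sqrtDisc Δ : QuadField Δ) : ℝ) := by
    have := congrArg (fun x : QuadField Δ => (x : ℝ)) hyc
    push_cast at this
    rw [h2r] at this
    linarith
  obtain ⟨hs0, hs1⟩ := sqrt_pos_lt (Δ := Δ)
  have hbr : (Δ : ℝ) + 1 ≤ b := by exact_mod_cast hb
  have hΔr := disc_pos_real (Δ := Δ)
  refine ⟨{ y := y, k := k, k' := k', isIntegral := hyi, pos := ⟨?_, ?_⟩, norm := hnorm,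
            inv := ⟨-v, by linear_combination hkv⟩,
            isIntegral_sq := isIntegral_even hm hsq }, rfl, ?_⟩
  · linarith
  · linarith
  · simp only [TwistDatum.g]
    push_cast at hsq ⊢
    linear_combination (k' : QuadField Δ) * hsq

lemma exists_twistDatum_of_even (hd : ((2 : ℕ) : ℤ) ∣ Δ) :
    ∃ D : TwistDatum Δ 2, D.IsSwap := by
  rcases hΔ.out with ⟨h1, -⟩ | ⟨m, hm, hm4, -⟩
  · push_cast at hd; omega
  have hcop2 : ∀ k : ℤ, k % 2 = 1 → IsCoprime k 4 := fun k hk => by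
    have : IsCoprime (2 : ℤ) k := Int.prime_two.coprime_iff_not_dvd.2 (by omega)
    simpa using (this.pow_left : IsCoprime ((2 : ℤ) ^ 2) k).symm
  have hodd : ∀ D : TwistDatum Δ 2, D.k' % 2 = 1 ∧ 2 * m ∣ D.k * D.k' - 1 := by
    intro D
    obtain ⟨u, hu'⟩ := D.inv
    have hu : D.k * D.k' - 1 = 4 * m * u := hu'.trans (congrArg (· * u) hm)
    refine ⟨?_, ⟨2 * u, by rw [hu]; ring⟩⟩
    rcases Int.emod_two_eq_zero_or_one D.k' with h0 | h0
    · obtain ⟨t, ht⟩ := Int.dvd_of_emod_eq_zero h0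
      rw [ht] at hu
      have : 2 * (D.k * t - 2 * m * u) = 1 := by linear_combination hu
      omega
    · exact h0
  rcases hm4 with hm4 | hm4
  · obtain ⟨p, hp⟩ : ∃ p, m = 2 * p := ⟨m / 2, by omega⟩
    -- The choice is y = b + √Δ/2 with b = 2(Δ + 1). Then k = 2(Δ+1)² - p is odd because p is, and k
    -- ≡ 2 mod p, so k is prime to Δ = 8p.
    have hk2 : 2 * (2 * (Δ + 1) ^ 2 - p) = (2 * (Δ + 1)) ^ 2 - m := by rw [hp]; ring
    have hkodd : (2 * (Δ + 1) ^ 2 - p) % 2 = 1 := by omega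
    have hkcop : IsCoprime (2 * (Δ + 1) ^ 2 - p) Δ := by
      refine (congrArg (IsCoprime _) hm).mpr (IsCoprime.mul_right (hcop2 _ hkodd) ?_)
      rw [hm, hp]
      refine IsCoprime.mul_right ?_ ?_
      · exact (Int.prime_two.coprime_iff_not_dvd.2 (by omega)).symm
      · have : 2 * (4 * (2 * p) + 1) ^ 2 - p = 2 + p * (128 * p + 32 - 1) := by ring
        rw [this, IsCoprime.add_mul_left_left_iff]
        exact Int.prime_two.coprime_iff_not_dvd.2 (by omega)
    obtain ⟨D, hDk, hDg⟩ := exists_twistDatum_even hm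
      (by have := hΔ1.out; linarith) hk2 hkcop
    refine ⟨D, ?_⟩
    intro α β n N₁ N₂ d j' j hα hβ hN₁ hN₂ hdd h₁ h₂ hn h
    push_cast at hdd hn
    obtain ⟨hk'1, u, hu⟩ := hodd D
    obtain ⟨a, r, har⟩ := exists_even_repr hm hα
    obtain ⟨b, q, hbq⟩ := exists_even_repr hm hβ
    have e₁ := nm_even_repr hm har hN₁
    have e₂ := nm_even_repr hm hbq hN₂
    have hsub := even_sub_repr hbq har
    have hma := even_two_mul_div_sqrt hm hsub h
    have h8 : (8 : ℤ) ∣ n - N₁ :=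
      odd_mul_dvd (m := p) hdd (k := j') (by rw [h₁, hm, hp]; ring) dvd_rfl
    have h8' : Δ * j = 8 * (p * j) := by rw [hm, hp]; ring
    have hga := even_mul_repr hm hDg har
    obtain ⟨κ, hκ⟩ : ∃ κ, κ = D.k' := ⟨_, rfl⟩
    rw [← hκ] at hga hk'1
    rw [hDk, ← hκ] at hu
    -- In coordinates, since κk = 1 + 2mu, multiplication by g adds a multiple of m to a and an even
    -- number to r.
    have hA : κ * (2 * (Δ + 1) ^ 2 - p + m) * a + m * (κ * (2 * (Δ + 1)) * r) =
        a + m * (2 * u * a + κ * a + 2 * κ * (Δ + 1) * r) := by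
      linear_combination a * hu
    have hR : κ * (2 * (Δ + 1) ^ 2 - p + m) * r + κ * (2 * (Δ + 1)) * a =
        r + 2 * (m * u * r + κ * p * r + κ * (Δ + 1) * a) := by
      linear_combination r * hu + κ * r * hp
    rw [hA, hR] at hga
    have ha1 : a % 2 = 1 := by
      rcases mul_sq_mod_eight hm4 r with h1 | h1 <;>
      rcases sq_mod_eight_cases a with h3 | h3 | h3 <;> omega
    have key : (b % 2 = 1) ∧ (q - r) % 2 = 0 := by
      rcases mul_sq_mod_eight hm4 r with h1 | h1 <;> rcases mul_sq_mod_eight hm4 q with h2 | h2 <;>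
      rcases sq_mod_eight_cases a with h3 | h3 | h3 <;>
      rcases sq_mod_eight_cases b with h4 | h4 | h4 <;> omega
    have hκa : (κ * a) % 2 = 1 := by rw [Int.mul_emod, hk'1, ha1]; rfl
    -- As κa is odd, that multiple of m is ≡ 2 mod 4. The twist thus exchanges a ≡ 1 and a ≡ 3 mod
    -- 4, the only ambiguity that an odd n leaves.
    have hmm : (m * (2 * u * a + κ * a + 2 * κ * (Δ + 1) * r)) % 4 = 2 := by
      obtain ⟨t, ht⟩ : ∃ t, κ * a = 2 * t + 1 := ⟨κ * a / 2, by omega⟩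
      have : m * (2 * u * a + κ * a + 2 * κ * (Δ + 1) * r) =
        4 * (p * (u * a + t + κ * (Δ + 1) * r)) + m := by
        rw [hp]; linear_combination 2 * p * ht
      omega
    constructor
    · by_cases hba : (b - a) % 4 = 0
      · left
        rw [even_div_sqrt_iff hm hsub]
        exact ⟨two_mul_dvd_of_two_mod_four hm4 hma hba, Int.dvd_of_emod_eq_zero key.2⟩
      · right
        rw [even_div_sqrt_iff hm (even_sub_repr hbq hga)]
        refine ⟨two_mul_dvd_of_two_mod_four hm4 ?_ (by omega), by omega⟩
        rw [← sub_sub]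
        exact dvd_sub hma (dvd_mul_right _ _)
    · intro h3
      rw [even_div_sqrt_iff hm (even_sub_repr hga har)] at h3
      obtain ⟨⟨c, hc⟩, -⟩ := h3
      rw [add_sub_cancel_left] at hc
      rw [hc, hp, show 2 * (2 * p) * c = 4 * (p * c) by ring] at hmm
      omega
  -- For m ≡ 3 mod 4 take b = Δ + 1. Then b² - m ≡ 2 mod 4, so k is odd, and 2k ≡ 1 mod m, so k is
  -- prime to Δ = 4m.
  · obtain ⟨k, hk⟩ : ∃ k : ℤ, 2 * k = (Δ + 1) ^ 2 - m := by
      refine ⟨((Δ + 1) ^ 2 - m) / 2, ?_⟩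
      have : (Δ + 1) ^ 2 = 2 * (8 * m ^ 2 + 4 * m) + 1 := by rw [hm]; ring
      omega
    have hkodd : k % 2 = 1 := by
      have : (Δ + 1) ^ 2 = 4 * (4 * m ^ 2 + 2 * m) + 1 := by rw [hm]; ring
      omega
    have hkcop : IsCoprime k Δ := by
      refine (congrArg (IsCoprime _) hm).mpr (IsCoprime.mul_right (hcop2 _ hkodd) ?_)
      have : IsCoprime (2 * k) m := by
        have : 2 * k = 1 + m * (16 * m + 8 - 1) := by rw [hk, hm]; ring
        rw [this, IsCoprime.add_mul_left_left_iff]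
        exact isCoprime_one_left
      exact this.of_mul_left_right
    obtain ⟨D, hDk, hDg⟩ := exists_twistDatum_even hm le_rfl hk hkcop
    refine ⟨D, ?_⟩
    intro α β n N₁ N₂ d j' j hα hβ hN₁ hN₂ hdd h₁ h₂ hn h
    push_cast at hdd hn
    obtain ⟨hk'1, u, hu⟩ := hodd D
    obtain ⟨a, r, har⟩ := exists_even_repr hm hα
    obtain ⟨b, q, hbq⟩ := exists_even_repr hm hβ
    have e₁ := nm_even_repr hm har hN₁
    have e₂ := nm_even_repr hm hbq hN₂
    have hsub := even_sub_repr hbq har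
    have hma := even_two_mul_div_sqrt hm hsub h
    have h8 : (4 : ℤ) ∣ n - N₁ :=
      odd_mul_dvd (m := m) hdd (k := j') (by rw [h₁, hm]) (by norm_num)
    have h8' : Δ * j = 4 * (m * j) := by rw [hm]; ring
    have hga := even_mul_repr hm hDg har
    obtain ⟨κ, hκ⟩ : ∃ κ, κ = D.k' := ⟨_, rfl⟩
    rw [← hκ] at hga hk'1
    rw [hDk, ← hκ] at hu
    obtain ⟨t, ht⟩ : ∃ t, κ = 2 * t + 1 := ⟨κ / 2, by omega⟩
    obtain ⟨m', hm'⟩ : ∃ m', m = 2 * m' + 1 := ⟨m / 2, by omega⟩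
    have hA : κ * (k + m) * a + m * (κ * (Δ + 1) * r) =
        a + m * (2 * u * a + κ * a + κ * (Δ + 1) * r) := by
      linear_combination a * hu
    -- Modulo 2 the twist exchanges the coordinates a and r; for n odd exactly one of them is odd.
    have hA2 : a + m * (2 * u * a + κ * a + κ * (Δ + 1) * r) =
        r + 2 * (a + m * u * a + t * m * a + m' * a + 2 * m * m * κ * r + t * m * r + m' * r) := by
      rw [hm]
      linear_combination (m * a + m * r) * ht + (a + r) * hm'
    have hR : κ * (k + m) * r + κ * (Δ + 1) * a =
        a + 2 * (r + m * u * r + t * m * r + m' * r + 2 * κ * m * a + t * a) := by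
      rw [hm]
      linear_combination r * hu + (m * r + a) * ht + r * hm'
    rw [hA, hR] at hga
    have key : (a % 2 = 1 ∧ r % 2 = 0 ∨ a % 2 = 0 ∧ r % 2 = 1) ∧
        (b % 2 = 1 ∧ q % 2 = 0 ∨ b % 2 = 0 ∧ q % 2 = 1) := by
      rcases mul_sq_mod_four hm4 r with h1 | h1 <;> rcases mul_sq_mod_four hm4 q with h2 | h2 <;>
      rcases sq_mod_eight_cases a with h3 | h3 | h3 <;>
      rcases sq_mod_eight_cases b with h4 | h4 | h4 <;> omega
    constructor
    · by_cases hba : (b - a) % 2 = 0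
      · left
        rw [even_div_sqrt_iff hm hsub]
        exact ⟨two_mul_dvd_of_odd hm4 hma hba, by omega⟩
      · right
        rw [even_div_sqrt_iff hm (even_sub_repr hbq hga)]
        refine ⟨two_mul_dvd_of_odd hm4 ?_ (by omega), by omega⟩
        rw [← sub_sub]
        exact dvd_sub hma (dvd_mul_right _ _)
    · intro h3
      rw [even_div_sqrt_iff hm (even_sub_repr hga har)] at h3
      omega

lemma exists_twistDatum {ℓ : ℕ} (hℓ : ℓ.Prime) (hd : (ℓ : ℤ) ∣ Δ) :
    ∃ D : TwistDatum Δ ℓ, D.IsSwap := by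
  by_cases h : ℓ = 2
  · subst h; exact exists_twistDatum_of_even hd
  · exact exists_twistDatum_of_odd hℓ h hd

lemma class_unique {ℓ : ℕ} (hℓ : ℓ.Prime) (hd : (ℓ : ℤ) ∣ Δ)
    {α β : QuadField Δ} {n N₁ N₂ d k j : ℤ} (hα : IsIntegral ℤ α) (hβ : IsIntegral ℤ β)
    (hN₁ : nm Δ α = N₁) (hN₂ : nm Δ β = N₂) (hdd : ¬ (ℓ : ℤ) ∣ d) (h₁ : d * (n - N₁) = k * Δ)
    (h₂ : N₂ = n + Δ * j) (hn : (ℓ : ℤ) ∣ n)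
    (h : IsIntegral ℤ (ℓ * (β - α) / sqrtDisc Δ)) : IsIntegral ℤ ((β - α) / sqrtDisc Δ) := by
  by_cases h2 : ℓ = 2
  · subst h2; exact class_unique_of_even hd hα hβ hN₁ hN₂ hdd h₁ h₂ hn h
  · exact class_unique_of_odd hℓ h2 hd hα hβ hN₁ hN₂ hdd h₁ h₂ hn h

end Even
end HeckeTheta

namespace HeckeTheta

/-! ### Elements of norm -ℓ²n/Δ as ℓ-multiples -/

section Scaling

set_option linter.unusedSectionVars false

variable {Δ : ℤ} [hΔ : Fact (IsFundamentalDiscriminant Δ)] [hΔ1 : Fact (1 < Δ)]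

lemma nm_sqrtDisc : nm Δ (sqrtDisc Δ) = -(Δ : QuadField Δ) := by
  rw [nm, conj_sqrt, mul_neg, sqrtDisc_mul_self]

/-- The class of l is represented by c√Δl, whose norm is n Nm(c) ≡ n mod Δ. -/
lemma exists_class_of_mem_normSet {c : QuadField Δ} {I : FracIdeal Δ} (hc : IsMultiplier c I)
    {n : ℤ} {l : QuadField Δ} (hl : sqrtDisc Δ * l ∈ I)
    (hn : nm Δ l = -(((n : ℚ) / Δ : ℚ) : QuadField Δ)) :
    ∃ hβ : IsIntegral ℤ (c * (sqrtDisc Δ * l)),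
      l ∈ normSet I (discClass (c * (sqrtDisc Δ * l)) hβ) ((n : ℚ) / Δ) ∧
      ∃ N j : ℤ, nm Δ (c * (sqrtDisc Δ * l)) = N ∧ N = n + Δ * j := by
  refine ⟨hc.2 _ hl, ⟨?_, hn⟩, ?_⟩
  · rw [mem_coset_iff hc]
    exact ⟨hl, by rw [sub_self, zero_div]; exact isIntegral_zero⟩
  · obtain ⟨j, hj⟩ := hc.1.nm_congr
    refine ⟨n + Δ * (j * n), j * n, ?_, rfl⟩
    have hΔ0 := disc_ne_zero (Δ := Δ)
    rw [nm_mul, nm_mul, hj, nm_sqrtDisc, hn]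
    push_cast
    field_simp

variable {ℓ : ℕ} {𝔩 : Ideal (𝓞 (QuadField Δ))}

/-- √Δl has norm ℓ²n, so `IsUniquePrimeAbove.div_mem` divides it by ℓ; the class of the quotient
differs from that of α by ℓ-torsion. -/
lemma exists_div_of_mem_normSet (hℓ : ℓ.Prime) (h𝔩 : IsUniquePrimeAbove ℓ 𝔩) {I : FracIdeal Δ}
    (hI : I ≠ 0) {c : QuadField Δ} (hc : IsMultiplier c (nmMinus Δ I)) {α : QuadField Δ}
    {hα : IsIntegral ℤ α} {n : ℤ} {l : QuadField Δ}
    (hl : l ∈ normSet (nmMinus Δ I) (ℓ • discClass α hα) ((ℓ : ℚ) ^ 2 * n / Δ)) :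
    ∃ l' : QuadField Δ, l = ℓ * l' ∧ ∃ β : QuadField Δ, ∃ hβ : IsIntegral ℤ β,
      l' ∈ normSet (nmMinus Δ I) (discClass β hβ) ((n : ℚ) / Δ) ∧
      IsIntegral ℤ (ℓ * (β - α) / sqrtDisc Δ) ∧ ∃ N j : ℤ, nm Δ β = N ∧ N = n + Δ * j := by
  have hℓ0 : (ℓ : QuadField Δ) ≠ 0 := by exact_mod_cast hℓ.ne_zero
  have hΔ0 := disc_ne_zero (Δ := Δ)
  obtain ⟨h1, h2⟩ := hl
  rw [nsmul_discClass, mem_coset_iff hc] at h1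
  have h3 : sqrtDisc Δ * (l / ℓ) ∈ nmMinus Δ I := by
    rw [← mul_div_assoc]
    refine h𝔩.div_mem hℓ hI h1.1 (N := n) ?_
    rw [nm_mul, nm_sqrtDisc, h2]
    push_cast
    field_simp
  have h4 : nm Δ (l / ℓ) = -(((n : ℚ) / Δ : ℚ) : QuadField Δ) := by
    rw [div_eq_mul_inv, nm_mul, h2, nm, map_inv₀, map_natCast]
    push_cast
    field_simp
  obtain ⟨hβ, h5, h6⟩ := exists_class_of_mem_normSet hc h3 h4
  refine ⟨l / ℓ, by rw [mul_div_cancel₀ _ hℓ0], _, hβ, h5, ?_, h6⟩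
  have e : (ℓ : QuadField Δ) * (c * (sqrtDisc Δ * (l / ℓ)) - α) / sqrtDisc Δ =
      (c * (sqrtDisc Δ * l) - ℓ * α) / sqrtDisc Δ := by
    field_simp
  rw [e]
  exact h1.2

lemma IsLocallyCompatible.exists_repr {n : ℤ} {h : DiscModule Δ} (hc : IsLocallyCompatible ℓ n h) :
    ∃ α, ∃ hα : IsIntegral ℤ α, h = discClass α hα ∧ ∃ N d k : ℤ, nm Δ α = N ∧
      ¬ (ℓ : ℤ) ∣ d ∧ d * (n - N) = k * Δ := by
  obtain ⟨x, hx, d, k, hd, hk⟩ := hc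
  obtain ⟨hα, hx'⟩ := discModule_mk_eq_discClass x
  obtain ⟨N, hN⟩ := exists_norm_int hα
  refine ⟨_, hα, by rw [← hx, hx'], N, d, k, hN, hd, ?_⟩
  have hΔ0 := disc_ne_zero (Δ := Δ)
  rw [nm_mul, nm_sqrtDisc] at hN
  have : (d : QuadField Δ) * (n - N) = k * Δ := by
    rw [← hk, ← hN]; field_simp; ring
  exact_mod_cast this

lemma mul_image_subset_normSet {I : FracIdeal Δ} {c : QuadField Δ} (hc : IsMultiplier c I)
    {h : DiscModule Δ} {n : ℤ} {l : QuadField Δ} (hl : l ∈ normSet I h ((n : ℚ) / Δ)) :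
    (ℓ : QuadField Δ) * l ∈ normSet I (ℓ • h) ((ℓ : ℚ) ^ 2 * n / Δ) := by
  obtain ⟨α, hα, rfl⟩ := exists_discClass h
  rw [mul_div_assoc]
  exact natCast_mul_mem_normSet hc hl

lemma normSet_nsmul_eq_image (hℓ : ℓ.Prime) (h𝔩 : IsUniquePrimeAbove ℓ 𝔩) {I : (FracIdeal Δ)ˣ}
    (hI : I ∈ coprimeIdeals Δ) {n : ℤ} {h : DiscModule Δ}
    (hcomp : (ℓ : ℤ) ∣ Δ → IsLocallyCompatible ℓ n h) (hn : ¬ (ℓ : ℤ) ∣ Δ ∨ (ℓ : ℤ) ∣ n) :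
    normSet (nmMinus Δ (I : FracIdeal Δ)) (ℓ • h) ((ℓ : ℚ) ^ 2 * n / Δ) =
      (fun l => (ℓ : QuadField Δ) * l) '' normSet (nmMinus Δ (I : FracIdeal Δ)) h ((n : ℚ) / Δ) := by
  obtain ⟨c, hc⟩ := exists_isMultiplier_nmMinus hI
  refine Set.Subset.antisymm (fun l hl => ?_) ?_
  · by_cases hd : (ℓ : ℤ) ∣ Δ
    · obtain ⟨α, hα, rfl, N₁, d, k, hN₁, hdd, h₁⟩ := (hcomp hd).exists_repr
      obtain ⟨l', rfl, β, hβ, hl', h₃, N₂, j, hN₂, h₂⟩ :=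
        exists_div_of_mem_normSet hℓ h𝔩 I.ne_zero hc hl
      have h₄ := class_unique hℓ hd hα hβ hN₁ hN₂ hdd h₁ h₂ (hn.resolve_left (not_not.2 hd)) h₃
      rw [← discClass_eq (hα := hβ) (hβ := hα)] at h₄
      rw [h₄] at hl'
      exact ⟨l', hl', rfl⟩
    · obtain ⟨α, hα, rfl⟩ := exists_discClass h
      obtain ⟨l', rfl, β, hβ, hl', h₃, -⟩ :=
        exists_div_of_mem_normSet hℓ h𝔩 I.ne_zero hc hl
      have h₄ := div_sqrt_of_not_dvd hℓ hd (hβ.sub hα) h₃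
      rw [← discClass_eq (hα := hβ) (hβ := hα)] at h₄
      rw [h₄] at hl'
      exact ⟨l', hl', rfl⟩
  · rintro _ ⟨l, hl, rfl⟩
    exact mul_image_subset_normSet hc hl

lemma disjoint_of_not_integral {c : QuadField Δ} {I : FracIdeal Δ} (hc : IsMultiplier c I)
    {α β : QuadField Δ} {hα : IsIntegral ℤ α} {hβ : IsIntegral ℤ β} {m : ℚ} {l : QuadField Δ}
    (h1 : l ∈ normSet I (discClass α hα) m) (h2 : l ∈ normSet I (discClass β hβ) m) :
    IsIntegral ℤ ((β - α) / sqrtDisc Δ) := by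
  have h3 := ((mem_coset_iff hc).1 h1.1).2
  have h4 := ((mem_coset_iff hc).1 h2.1).2
  have := h3.sub h4
  rwa [← sub_div, sub_sub_sub_cancel_left] at this

/-- The twist datum and α are chosen before the ideal, so that one twisted class serves all ideals;
the sum over narrow classes needs this uniformity. -/
lemma normSet_nsmul_eq_image_union (hℓ : ℓ.Prime) (h𝔩 : IsUniquePrimeAbove ℓ 𝔩)
    (hd : (ℓ : ℤ) ∣ Δ) {n : ℤ} {h : DiscModule Δ}
    (hcomp : IsLocallyCompatible ℓ n h) (hn : ¬ (ℓ : ℤ) ∣ n) :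
    ∃ D : TwistDatum Δ ℓ, ∃ α, ∃ hα : IsIntegral ℤ α, h = discClass α hα ∧
    ∀ {I : (FracIdeal Δ)ˣ}, I ∈ coprimeIdeals Δ →
    normSet (nmMinus Δ (I : FracIdeal Δ)) (ℓ • h) ((ℓ : ℚ) ^ 2 * n / Δ) =
      (fun l => (ℓ : QuadField Δ) * l) '' (normSet (nmMinus Δ (I : FracIdeal Δ)) h ((n : ℚ) / Δ) ∪
      normSet (nmMinus Δ (I : FracIdeal Δ)) (discClass (D.g * α) (D.isIntegral_g.mul hα))
        ((n : ℚ) / Δ)) ∧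
    Disjoint (normSet (nmMinus Δ (I : FracIdeal Δ)) h ((n : ℚ) / Δ))
      (normSet (nmMinus Δ (I : FracIdeal Δ)) (discClass (D.g * α) (D.isIntegral_g.mul hα))
        ((n : ℚ) / Δ)) := by
  obtain ⟨D, hD⟩ := exists_twistDatum hℓ hd
  obtain ⟨α, hα, rfl, N₁, d, k, hN₁, hdd, h₁⟩ := hcomp.exists_repr
  refine ⟨D, α, hα, rfl, fun {I} hI => ⟨?_, ?_⟩⟩
  · obtain ⟨c, hc⟩ := exists_isMultiplier_nmMinus hI
    refine Set.Subset.antisymm (fun l hl => ?_) ?_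
    · obtain ⟨l', rfl, β, hβ, hl', h₃, N₂, j, hN₂, h₂⟩ :=
        exists_div_of_mem_normSet hℓ h𝔩 I.ne_zero hc hl
      refine ⟨l', ?_, rfl⟩
      rcases (hD hα hβ hN₁ hN₂ hdd h₁ h₂ hn h₃).1 with h₄ | h₄
      · rw [← discClass_eq (hα := hβ) (hβ := hα)] at h₄
        rw [h₄] at hl'
        exact Or.inl hl'
      · rw [← discClass_eq (hα := hβ) (hβ := D.isIntegral_g.mul hα)] at h₄
        rw [h₄] at hl'
        exact Or.inr hl'
    · rintro _ ⟨l, hl | hl, rfl⟩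
      · exact mul_image_subset_normSet hc hl
      · have h₅ := mul_image_subset_normSet (ℓ := ℓ) hc hl
        have h₆ : ℓ • discClass (D.g * α) (D.isIntegral_g.mul hα) = ℓ • discClass α hα := by
          rw [nsmul_discClass, nsmul_discClass, discClass_eq, ← mul_sub]
          exact D.isIntegral_mul_sub hℓ hα
        rwa [h₆] at h₅
  · obtain ⟨c, hc⟩ := exists_isMultiplier_nmMinus hI
    rw [Set.disjoint_left]
    intro l hl hl2
    -- The second clause of `TwistDatum.IsSwap` requires some admissible β; the class of the common
    -- element provides one.
    obtain ⟨hβ, h5, N₂, j, hN₂, h₂⟩ :=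
      exists_class_of_mem_normSet hc ((mem_coset_iff hc).1 hl.1).1 hl.2
    have h6 := disjoint_of_not_integral hc hl h5
    have h7 : IsIntegral ℤ ((ℓ : QuadField Δ) * (c * (sqrtDisc Δ * l) - α) / sqrtDisc Δ) := by
      rw [mul_div_assoc]
      exact (isIntegral_natCast ℓ).mul h6
    exact (hD hα hβ hN₁ hN₂ hdd h₁ h₂ hn h7).2 (disjoint_of_not_integral hc hl hl2)

end Scaling

/-! ### Multiplication by y/y' and independence of representatives -/

section Twist

set_option linter.unusedSectionVars false

variable {Δ : ℤ} [hΔ : Fact (IsFundamentalDiscriminant Δ)] [hΔ1 : Fact (1 < Δ)]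
variable {ℓ : ℕ} {𝔩 : Ideal (𝓞 (QuadField Δ))}

lemma IsTotallyPositive.ne_zero {x : QuadField Δ} (hx : IsTotallyPositive Δ x) : x ≠ 0 := by
  rintro rfl
  have := hx.1
  simp at this

lemma IsTotallyPositive.inv {x : QuadField Δ} (hx : IsTotallyPositive Δ x) :
    IsTotallyPositive Δ x⁻¹ := by
  constructor
  · simpa using hx.1
  · simpa using hx.2

lemma IsTotallyPositive.mul {x y : QuadField Δ} (hx : IsTotallyPositive Δ x)
    (hy : IsTotallyPositive Δ y) : IsTotallyPositive Δ (x * y) := by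
  constructor
  · simpa using mul_pos hx.1 hy.1
  · simpa using mul_pos hx.2 hy.2

lemma IsTotallyPositive.conj {x : QuadField Δ} (hx : IsTotallyPositive Δ x) :
    IsTotallyPositive Δ (conj Δ x) := by
  constructor
  · exact hx.2
  · simpa using hx.1

/-- The representative chosen in `narrowClass` differs from J by a quotient of two totally positive
elements. -/
lemma narrowClass_eq {I : FracIdeal Δ} {J : coprimeIdeals Δ} {x : QuadField Δ}
    (hx : IsTotallyPositive Δ x)
    (hI : I = FractionalIdeal.spanSingleton _ x * ((J : (FracIdeal Δ)ˣ) : FracIdeal Δ)) :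
    narrowClass Δ I = QuotientGroup.mk J := by
  have hex : ∃ J : coprimeIdeals Δ, ∃ x : QuadField Δ, IsTotallyPositive Δ x ∧
      I = FractionalIdeal.spanSingleton _ x * ((J : (FracIdeal Δ)ˣ) : FracIdeal Δ) :=
    ⟨J, x, hx, hI⟩
  rw [narrowClass, dif_pos hex]
  obtain ⟨z, hz, hI'⟩ := hex.choose_spec
  rw [QuotientGroup.eq]
  refine ⟨x⁻¹ * z, hx.inv.mul hz, ?_⟩
  have hJ := (hex.choose : (FracIdeal Δ)ˣ).ne_zero
  rw [hI'] at hI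
  simp only [Subgroup.coe_mul, Subgroup.coe_inv, Units.val_mul, Units.val_inv_eq_inv_val]
  have hx0 : FractionalIdeal.spanSingleton (𝓞 (QuadField Δ))⁰ x ≠ 0 := by
    rw [ne_eq, FractionalIdeal.spanSingleton_eq_zero_iff]; exact hx.ne_zero
  rw [← FractionalIdeal.spanSingleton_mul_spanSingleton, ← FractionalIdeal.spanSingleton_inv]
  rw [inv_mul_eq_iff_eq_mul₀ hJ]
  apply mul_left_cancel₀ hx0
  rw [← hI, mul_left_comm, mul_inv_cancel_left₀ hx0, mul_comm]

open IsDedekindDomain FractionalIdeal in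
-- c has valuation 0 at v, and cJ ⊆ 𝒪.
lemma count_nonneg_of_mul_le (v : HeightOneSpectrum (𝓞 (QuadField Δ))) {J : FracIdeal Δ}
    (hJ : J ≠ 0) {c : 𝓞 (QuadField Δ)} (hc : c ∉ v.asIdeal)
    (h : ∀ z ∈ J, IsIntegral ℤ ((c : QuadField Δ) * z)) : 0 ≤ count (QuadField Δ) v J := by
  have hc0 : Ideal.span {c} ≠ 0 := by
    intro h0
    have : c = 0 := by simpa using h0
    exact hc (this ▸ v.asIdeal.zero_mem)
  have h1 : count (QuadField Δ) v ((Ideal.span {c} : Ideal (𝓞 (QuadField Δ))) : FracIdeal Δ) = 0 := by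
    classical
    rw [count_coe _ _ hc0]
    by_contra hne
    have := (Associates.count_ne_zero_iff_dvd hc0 v.irreducible).1 (by exact_mod_cast hne)
    exact hc (Ideal.dvd_iff_le.1 this (Ideal.mem_span_singleton_self c))
  have hc0' := coeIdeal_ne_zero (K := QuadField Δ).2 hc0
  have h2 : ((Ideal.span {c} : Ideal (𝓞 (QuadField Δ))) : FracIdeal Δ) * J ≤ 1 := by
    rw [coeIdeal_span_singleton, spanSingleton_mul_le_iff]
    exact fun z hz => mem_one_iff.2 (h z hz)
  have h3 := count_mono (QuadField Δ) v (mul_ne_zero hc0' hJ) h2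
  rw [count_one, count_mul _ _ hc0' hJ, h1, zero_add] at h3
  exact h3

/-- Elements of 𝔩 have norm divisible by ℓ, so Nm(zw) is divisible by ℓ². -/
lemma IsUniquePrimeAbove.mul_div_isIntegral (hℓ : ℓ.Prime) (h : IsUniquePrimeAbove ℓ 𝔩)
    {z w : 𝓞 (QuadField Δ)} (hz : z ∈ 𝔩) (hw : w ∈ 𝔩) :
    IsIntegral ℤ ((z : QuadField Δ) * w / ℓ) := by
  have key : ∀ z ∈ 𝔩, ∃ N : ℤ, nm Δ (z : QuadField Δ) = ℓ * N := by
    intro z hz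
    obtain ⟨N, hN⟩ := exists_norm_int (NumberField.RingOfIntegers.isIntegral_coe z)
    have h1 : (N : 𝓞 (QuadField Δ)) ∈ 𝔩 := by
      have := 𝔩.mul_mem_right (conjInt Δ z) hz
      convert this using 1
      apply NumberField.RingOfIntegers.coe_injective
      have h1 : (((N : 𝓞 (QuadField Δ))) : QuadField Δ) = (N : QuadField Δ) := by simp
      exact h1.trans hN.symm
    obtain ⟨N', rfl⟩ := h.dvd_of_mem hℓ h1
    exact ⟨N', by rw [hN]; push_cast; ring⟩
  obtain ⟨N, hN⟩ := key z hz
  obtain ⟨M, hM⟩ := key w hw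
  refine h.isIntegral_div hℓ ((NumberField.RingOfIntegers.isIntegral_coe z).mul
    (NumberField.RingOfIntegers.isIntegral_coe w)) (N := N * M) ?_
  rw [nm_mul, hN, hM]; push_cast; ring

lemma IsUniquePrimeAbove.conjIdeal_eq (h : IsUniquePrimeAbove ℓ 𝔩) :
    conjIdeal Δ (𝔩 : FracIdeal Δ) = 𝔩 := by
  have key : ∀ z : QuadField Δ, z ∈ (𝔩 : FracIdeal Δ) → conj Δ z ∈ (𝔩 : FracIdeal Δ) := by
    intro z hz
    obtain ⟨x, hx, rfl⟩ := (FractionalIdeal.mem_coeIdeal _).1 hz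
    exact (FractionalIdeal.mem_coeIdeal _).2 ⟨conjInt Δ x, h.conj_mem.2 hx, rfl⟩
  ext z
  rw [mem_conjIdeal]
  exact ⟨fun hz => by simpa using key _ hz, key z⟩

open IsDedekindDomain FractionalIdeal in
/-- The ideal `𝔠 = y𝔩⁻¹`, prime to `𝔡`. -/
lemma TwistDatum.exists_ideal (hℓ : ℓ.Prime) (h : IsUniquePrimeAbove ℓ 𝔩) (D : TwistDatum Δ ℓ) :
    ∃ J : coprimeIdeals Δ, narrowClass Δ (𝔩 : FracIdeal Δ) = (QuotientGroup.mk J)⁻¹ ∧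
      nmMinus Δ ((J : (FracIdeal Δ)ˣ) : FracIdeal Δ) = spanSingleton _ (D.y / conj Δ D.y) := by
  have hℓ0 : (ℓ : QuadField Δ) ≠ 0 := by exact_mod_cast hℓ.ne_zero
  have hy0 := D.pos.ne_zero
  have hl0 : (𝔩 : FracIdeal Δ) ≠ 0 := by
    rw [coeIdeal_ne_zero]
    rintro rfl
    have := h.mem
    rw [Submodule.mem_bot] at this
    exact hℓ0 (by simpa using congrArg (fun x : 𝓞 (QuadField Δ) => (x : QuadField Δ)) this)
  have hsy : spanSingleton (𝓞 (QuadField Δ))⁰ D.y ≠ 0 := by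
    rwa [ne_eq, spanSingleton_eq_zero_iff]
  let J : (FracIdeal Δ)ˣ := Units.mk0
    (spanSingleton (𝓞 (QuadField Δ))⁰ D.y * ((𝔩 : FracIdeal Δ))⁻¹ : FracIdeal Δ) (mul_ne_zero hsy (inv_ne_zero hl0))
  obtain ⟨yI, hyI⟩ : ∃ x : 𝓞 (QuadField Δ), (x : QuadField Δ) = D.y := ⟨⟨D.y, D.isIntegral⟩, rfl⟩
  have hym : yI ∈ 𝔩 := h.mem_of_norm (hyI ▸ D.norm)
  have hJ : J ∈ coprimeIdeals Δ := by
    intro v hv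
    have hle : (J : FracIdeal Δ) ≤ 1 := by
      have h1 : spanSingleton _ D.y ≤ (𝔩 : FracIdeal Δ) := by
        rw [spanSingleton_le_iff_mem, ← hyI]
        exact mem_coeIdeal_of_mem _ hym
      have := mul_le_mul_left h1 (𝔩 : FracIdeal Δ)⁻¹
      rwa [mul_inv_cancel₀ hl0] at this
    refine le_antisymm ?_ ?_
    · have hinv : ((J⁻¹ : (FracIdeal Δ)ˣ) : FracIdeal Δ) =
          spanSingleton (𝓞 (QuadField Δ))⁰ D.y⁻¹ * (𝔩 : FracIdeal Δ) := by
        rw [Units.val_inv_eq_inv_val, Units.val_mk0, mul_inv, inv_inv, spanSingleton_inv]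
      -- Upper bound for the valuation of J: kJ⁻¹ = ky⁻¹𝔩 = (y'/ℓ)𝔩 is integral because y' ∈ 𝔩, and
      -- k lies in no prime dividing 𝔡.
      have hk : (D.k : 𝓞 (QuadField Δ)) ∉ v.asIdeal := by
        intro hk
        have hs : (⟨sqrtDisc Δ, isIntegral_sqrtDisc⟩ : 𝓞 (QuadField Δ)) ∈ v.asIdeal := by
          rw [different, spanSingleton_le_iff_mem] at hv
          obtain ⟨x, hx, hxs⟩ := (mem_coeIdeal _).1 hv
          have : x = ⟨sqrtDisc Δ, isIntegral_sqrtDisc⟩ :=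
            NumberField.RingOfIntegers.coe_injective hxs
          rwa [← this]
        have hD : (Δ : 𝓞 (QuadField Δ)) ∈ v.asIdeal := by
          have := v.asIdeal.mul_mem_left ⟨sqrtDisc Δ, isIntegral_sqrtDisc⟩ hs
          convert this using 1
          apply NumberField.RingOfIntegers.coe_injective
          have h1 : (((Δ : 𝓞 (QuadField Δ))) : QuadField Δ) = (Δ : QuadField Δ) := by simp
          exact h1.trans sqrtDisc_mul_self.symm
        obtain ⟨u, hu⟩ := D.inv
        apply v.isPrime.ne_top
        rw [Ideal.eq_top_iff_one]
        have h1 : (1 : 𝓞 (QuadField Δ)) = D.k' * D.k + (-u : ℤ) * Δ := by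
          have : (1 : ℤ) = D.k' * D.k + (-u) * Δ := by linarith
          exact_mod_cast this
        rw [h1]
        exact v.asIdeal.add_mem (v.asIdeal.mul_mem_left _ hk) (v.asIdeal.mul_mem_left _ hD)
      have h2 := count_nonneg_of_mul_le v (J := ((J⁻¹ : (FracIdeal Δ)ˣ) : FracIdeal Δ))
        (Units.ne_zero _) hk (fun z hz => by
          rw [hinv, mem_singleton_mul] at hz
          obtain ⟨w, hw, rfl⟩ := hz
          obtain ⟨x, hx, rfl⟩ := (mem_coeIdeal _).1 hw
          have h3 := h.mul_div_isIntegral hℓ (h.conj_mem.2 hym) hx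
          have h4 : ((conjInt Δ yI : 𝓞 (QuadField Δ)) : QuadField Δ) = conj Δ D.y := by
            rw [coe_conjInt, hyI]
          rw [h4] at h3
          have hn := D.norm
          rw [nm] at hn
          have h5 : (((D.k : 𝓞 (QuadField Δ))) : QuadField Δ) = (D.k : QuadField Δ) := by simp
          rw [h5]
          have h6 : (D.k : QuadField Δ) * (D.y⁻¹ * (algebraMap (𝓞 (QuadField Δ)) (QuadField Δ)) x) =
            conj Δ D.y * x / ℓ := by
            field_simp
            linear_combination -(x : QuadField Δ) * hn
          rw [h6]
          exact h3)
      rw [Units.val_inv_eq_inv_val, count_inv] at h2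
      linarith
    · have h3 := count_mono (QuadField Δ) v J.ne_zero hle
      rwa [count_one] at h3
  refine ⟨⟨J, hJ⟩, ?_, ?_⟩
  · rw [← QuotientGroup.mk_inv]
    refine narrowClass_eq D.pos ?_
    rw [Subgroup.coe_inv, Units.val_inv_eq_inv_val, Units.val_mk0, mul_inv, inv_inv, ← mul_assoc,
      mul_inv_cancel₀ hsy, one_mul]
  · change nmMinus Δ (spanSingleton _ D.y * (𝔩 : FracIdeal Δ)⁻¹) = _
    rw [nmMinus_mul, nmMinus_spanSingleton, nmMinus_eq, conjIdeal_inv hl0, h.conjIdeal_eq,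
      mul_inv_cancel₀ (inv_ne_zero hl0), mul_one]

/-- Multiplication by `y/y'` carries the class `h` to its twist. -/
lemma TwistDatum.normSet_twist (hℓ : ℓ.Prime) (D : TwistDatum Δ ℓ) {I J : (FracIdeal Δ)ˣ}
    (hI : I ∈ coprimeIdeals Δ) (hJ : J ∈ coprimeIdeals Δ)
    (hJD : nmMinus Δ (J : FracIdeal Δ) =
      FractionalIdeal.spanSingleton _ (D.y / conj Δ D.y)) {α : QuadField Δ}
    (hα : IsIntegral ℤ α) (m : ℚ) :
    normSet (nmMinus Δ ((I * J : (FracIdeal Δ)ˣ) : FracIdeal Δ))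
      (discClass (D.g * α) (D.isIntegral_g.mul hα)) m =
      (fun l => D.y / conj Δ D.y * l) '' normSet (nmMinus Δ (I : FracIdeal Δ)) (discClass α hα) m := by
  have hℓ0 : (ℓ : QuadField Δ) ≠ 0 := by exact_mod_cast hℓ.ne_zero
  obtain ⟨c, hc⟩ := exists_isMultiplier_nmMinus hI
  obtain ⟨d, hd⟩ := exists_isMultiplier_nmMinus ((coprimeIdeals Δ).mul_mem hI hJ)
  have hy0 := D.pos.ne_zero
  have hy0' := D.pos.conj.ne_zero
  have hn := D.norm
  rw [nm] at hn
  -- kk' ≡ 1 mod 𝔡 plays the role of f in `normSet_mul`; the relation yy' = ℓk turns kk'y/y' into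
  -- k'y²/ℓ = g.
  have hg : (D.k : QuadField Δ) * (D.k' : QuadField Δ) * (D.y / conj Δ D.y) = D.g := by
    rw [TwistDatum.g]
    field_simp
    linear_combination -(D.k' : QuadField Δ) * hn
  have ht : nm Δ (D.y / conj Δ D.y) = 1 := by
    rw [nm, map_div₀, conj_conj]
    field_simp
  have key := normSet_mul (m := m) ht D.congOne (by rw [hg]; exact D.isIntegral_g)
    (by rw [Units.val_mul, nmMinus_mul, hJD, mul_comm]) hc hd (hα := hα)
  simp only [hg] at key
  exact key

/-- Independence of the representative of a narrow class. -/
lemma normSet_principal {I J : (FracIdeal Δ)ˣ}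
    (hI : I ∈ coprimeIdeals Δ) (hJ : J ∈ coprimeIdeals Δ) {x : QuadField Δ}
    (hx : IsTotallyPositive Δ x)
    (hJx : (J : FracIdeal Δ) = FractionalIdeal.spanSingleton _ x) (h : DiscModule Δ) (m : ℚ) :
    normSet (nmMinus Δ ((I * J : (FracIdeal Δ)ˣ) : FracIdeal Δ)) h m =
      (fun l => x / conj Δ x * l) '' normSet (nmMinus Δ (I : FracIdeal Δ)) h m := by
  obtain ⟨α, hα, rfl⟩ := exists_discClass h
  obtain ⟨c, hc⟩ := exists_isMultiplier_nmMinus hI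
  obtain ⟨d, hd⟩ := exists_isMultiplier_nmMinus ((coprimeIdeals Δ).mul_mem hI hJ)
  obtain ⟨e, he⟩ := exists_isMultiplier hJ
  obtain ⟨e', he'⟩ := exists_isMultiplier ((coprimeIdeals Δ).inv_mem hJ)
  rw [Units.val_inv_eq_inv_val, hJx, FractionalIdeal.spanSingleton_inv] at he'
  rw [hJx] at he
  have hx0 := hx.ne_zero
  have hx0' := hx.conj.ne_zero
  have h1 : IsIntegral ℤ (e * x) := he.2 _ (FractionalIdeal.mem_spanSingleton_self _ _)
  have h2 : IsIntegral ℤ (e' * x⁻¹) := he'.2 _ (FractionalIdeal.mem_spanSingleton_self _ _)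
  have hf : CongOne (e * conj Δ e') := he.1.mul he'.1.conj
  have hft : e * conj Δ e' * (x / conj Δ x) = (e * x) * conj Δ (e' * x⁻¹) := by
    rw [map_mul, map_inv₀]; ring
  have hg : IsIntegral ℤ (e * conj Δ e' * (x / conj Δ x)) := by
    rw [hft]; exact h1.mul (isIntegral_conj h2)
  -- Integral z satisfy z ≡ z' mod 𝔡, so (ex)(e'x⁻¹)' ≡ (ex)(e'x⁻¹) = ee' ≡ 1: multiplication by
  -- x/x' fixes every class.
  have hg1 : CongOne (e * conj Δ e' * (x / conj Δ x)) := by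
    refine (he.1.mul he'.1).of_congr ?_
    have : (e * conj Δ e' * (x / conj Δ x) - e * e') / sqrtDisc Δ =
        -(e * x) * ((e' * x⁻¹ - conj Δ (e' * x⁻¹)) / sqrtDisc Δ) := by
      rw [hft]; field_simp; ring
    rw [this]
    exact h1.neg.mul (sub_conj_dvd h2)
  have ht : nm Δ (x / conj Δ x) = 1 := by
    rw [nm, map_div₀, conj_conj]
    field_simp
  have key := normSet_mul (m := m) ht hf hg
    (by rw [Units.val_mul, nmMinus_mul, hJx, nmMinus_spanSingleton, mul_comm]) hc hd (hα := hα)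
  rwa [discClass_congOne_mul hg1 (hα := hα)] at key

/-- Squares of totally positive units act on `normSet`. -/
lemma normSet_unit {I : (FracIdeal Δ)ˣ} (hI : I ∈ coprimeIdeals Δ) {u : QuadField Δ}
    (hu : IsIntegral ℤ u) (hun : nm Δ u = 1) (h : DiscModule Δ) (m : ℚ) :
    normSet (nmMinus Δ (I : FracIdeal Δ)) h m =
      (fun l => u ^ 2 * l) '' normSet (nmMinus Δ (I : FracIdeal Δ)) h m := by
  obtain ⟨α, hα, rfl⟩ := exists_discClass h
  obtain ⟨c, hc⟩ := exists_isMultiplier_nmMinus hI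
  have hun' : u * conj Δ u = 1 := hun
  -- As uu' = 1, u² - 1 = u(u - u'), a multiple of √Δ.
  have hc1 : CongOne (u ^ 2) := by
    have : (u ^ 2 - 1) / sqrtDisc Δ = u * ((u - conj Δ u) / sqrtDisc Δ) := by
      rw [← hun']; ring
    rw [CongOne, this]
    exact hu.mul (sub_conj_dvd hu)
  have h1 : CongOne (1 : QuadField Δ) := by
    rw [CongOne, sub_self, zero_div]; exact isIntegral_zero
  have hspan : nmMinus Δ (I : FracIdeal Δ) =
      FractionalIdeal.spanSingleton _ (u ^ 2) * nmMinus Δ (I : FracIdeal Δ) := by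
    have h2 : FractionalIdeal.spanSingleton (𝓞 (QuadField Δ))⁰ (u ^ 2) = 1 := by
      refine le_antisymm ?_ ?_
      · rw [FractionalIdeal.spanSingleton_le_iff_mem, mem_one_iff]
        exact hu.pow 2
      · rw [FractionalIdeal.one_le]
        have h3 := smul_mem_fracIdeal (FractionalIdeal.mem_spanSingleton_self
          (𝓞 (QuadField Δ))⁰ (u ^ 2)) ((isIntegral_conj hu).pow 2)
        rwa [← mul_pow, mul_comm, hun', one_pow] at h3
    rw [h2, one_mul]
  have key := normSet_mul (m := m) (t := u ^ 2) (by rw [sq, nm_mul, hun, one_mul]) h1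
    (by rw [one_mul]; exact hc1.isIntegral) hspan hc hc (hα := hα)
  simp only [one_mul] at key
  rwa [discClass_congOne_mul hc1 (hα := hα)] at key

end Twist
end HeckeTheta

namespace HeckeTheta

/-! ### Gaussian primitives and Fourier coefficients of theta integrals -/

section Analysis

open Real Set

/-- A primitive of the Gaussian `exp(-πs²)`. -/
noncomputable def gaussPrim (y : ℝ) : ℝ := ∫ s in (0 : ℝ)..y, exp (-π * s ^ 2)

lemma continuous_gauss : Continuous fun s : ℝ => exp (-π * s ^ 2) := by fun_prop

lemma hasDerivAt_gaussPrim (y : ℝ) : HasDerivAt gaussPrim (exp (-π * y ^ 2)) y :=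
  (continuous_gauss.integral_hasStrictDerivAt 0 y).hasDerivAt

/-- Half of the exponent absorbs the linear factor: with S = x² + x'², |x| + |x'| ≤ 1 + S ≤ (1 +
1/δ)(1 + δS) ≤ (1 + 1/δ)e^{δS}. -/
lemma linear_mul_exp_le {δ : ℝ} (hδ : 0 < δ) (x x' : ℝ) :
    (|x| + |x'|) * exp (-(2 * δ) * (x ^ 2 + x' ^ 2)) ≤
      (1 + 1 / δ) * exp (-δ * (x ^ 2 + x' ^ 2)) := by
  have h1 : |x| + |x'| ≤ 1 + (x ^ 2 + x' ^ 2) := by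
    nlinarith [sq_abs x, sq_abs x', sq_nonneg (|x| - 1 / 2), sq_nonneg (|x'| - 1 / 2)]
  have h2 : 1 + (x ^ 2 + x' ^ 2) ≤ (1 + 1 / δ) * (δ * (x ^ 2 + x' ^ 2) + 1) := by
    have : (1 + 1 / δ) * (δ * (x ^ 2 + x' ^ 2) + 1) =
        1 + (x ^ 2 + x' ^ 2) + (δ * (x ^ 2 + x' ^ 2) + 1 / δ) := by field_simp; ring
    rw [this]
    have : 0 ≤ δ * (x ^ 2 + x' ^ 2) + 1 / δ := by positivity
    linarith
  have h3 := add_one_le_exp (δ * (x ^ 2 + x' ^ 2))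
  have h4 : exp (-δ * (x ^ 2 + x' ^ 2)) =
      exp (δ * (x ^ 2 + x' ^ 2)) * exp (-(2 * δ) * (x ^ 2 + x' ^ 2)) := by
    rw [← exp_add]; ring_nf
  rw [h4, ← mul_assoc]
  refine mul_le_mul_of_nonneg_right ?_ (exp_pos _).le
  exact h1.trans (h2.trans (mul_le_mul_of_nonneg_left h3 (by positivity)))

/-- Mean value inequality. Each point of the segment is ax + bx' with a, b ∈ [c, C], and (ax + bx')²
≥ c²(x² + x'²) - 2C²|xx'|. So for fixed xx' the difference decays like a Gaussian in (x, x'),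
although `gaussPrim` itself does not tend to 0. -/
lemma gaussPrim_sub_le {c C t t' : ℝ} (hc : 0 < c) (hc1 : c ≤ 1) (hct : c ≤ t) (hct' : c ≤ t')
    (hC1 : 1 ≤ C) (htC : t ≤ C) (htC' : t' ≤ C) (x x' : ℝ) :
    |gaussPrim (t * x + t' * x') - gaussPrim (x + x')| ≤
      exp (2 * π * C ^ 2 * |x * x'|) * C *
        ((|x| + |x'|) * exp (-(π * c ^ 2) * (x ^ 2 + x' ^ 2))) := by
  have hseg : ∀ y ∈ segment ℝ (x + x') (t * x + t' * x'),
      ‖exp (-π * y ^ 2)‖ ≤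
        exp (2 * π * C ^ 2 * |x * x'|) * exp (-(π * c ^ 2) * (x ^ 2 + x' ^ 2)) := by
    rintro _ ⟨p, q, hp, hq, hpq, rfl⟩
    rw [Real.norm_eq_abs, abs_exp, ← exp_add]
    apply exp_le_exp.2
    obtain ⟨a, ha⟩ : ∃ a, a = p + q * t := ⟨_, rfl⟩
    obtain ⟨b, hb⟩ : ∃ b, b = p + q * t' := ⟨_, rfl⟩
    have e : p • (x + x') + q • (t * x + t' * x') = a * x + b * x' := by
      simp only [smul_eq_mul, ha, hb]; ring
    have hq' : p = 1 - q := by linarith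
    have ha1 : c ≤ a := by rw [ha]; nlinarith
    have hb1 : c ≤ b := by rw [hb]; nlinarith
    have ha2 : a ≤ C := by rw [ha]; nlinarith
    have hb2 : b ≤ C := by rw [hb]; nlinarith
    rw [e]
    have h1 : c ^ 2 * x ^ 2 ≤ a ^ 2 * x ^ 2 :=
      mul_le_mul_of_nonneg_right (pow_le_pow_left₀ hc.le ha1 2) (sq_nonneg _)
    have h2 : c ^ 2 * x' ^ 2 ≤ b ^ 2 * x' ^ 2 :=
      mul_le_mul_of_nonneg_right (pow_le_pow_left₀ hc.le hb1 2) (sq_nonneg _)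
    have h3 : a * b * |x * x'| ≤ C ^ 2 * |x * x'| := by
      refine mul_le_mul_of_nonneg_right ?_ (abs_nonneg _)
      rw [sq]
      exact mul_le_mul ha2 hb2 (by linarith) (by linarith)
    have h4 : -(a * b * |x * x'|) ≤ a * b * (x * x') := by
      have := neg_abs_le (x * x')
      have hab : 0 ≤ a * b := mul_nonneg (by linarith) (by linarith)
      nlinarith
    have h5 : c ^ 2 * (x ^ 2 + x' ^ 2) - 2 * C ^ 2 * |x * x'| ≤ (a * x + b * x') ^ 2 := by
      nlinarith
    nlinarith [mul_le_mul_of_nonneg_left h5 pi_pos.le]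
  have key := (convex_segment (𝕜 := ℝ) (x + x') (t * x + t' * x')).norm_image_sub_le_of_norm_hasDerivWithin_le
    (fun y _ => (hasDerivAt_gaussPrim y).hasDerivWithinAt) hseg
    (left_mem_segment _ _ _) (right_mem_segment _ _ _)
  rw [Real.norm_eq_abs] at key
  refine key.trans ?_
  have h6 : ‖t * x + t' * x' - (x + x')‖ ≤ C * (|x| + |x'|) := by
    rw [Real.norm_eq_abs, show t * x + t' * x' - (x + x') = (t - 1) * x + (t' - 1) * x' by ring]
    refine (abs_add_le _ _).trans ?_
    rw [abs_mul, abs_mul, mul_add]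
    have h7 : |t - 1| ≤ C := abs_le.2 ⟨by linarith, by linarith⟩
    have h8 : |t' - 1| ≤ C := abs_le.2 ⟨by linarith, by linarith⟩
    exact add_le_add (mul_le_mul_of_nonneg_right h7 (abs_nonneg _))
      (mul_le_mul_of_nonneg_right h8 (abs_nonneg _))
  refine (mul_le_mul_of_nonneg_left h6 (by positivity)).trans (le_of_eq ?_)
  ring

lemma summable_gaussPrim_sub {ι : Type*} {x x' : ι → ℝ}
    (hs : ∀ c : ℝ, 0 < c → Summable fun i => exp (-c * (x i ^ 2 + x' i ^ 2)))
    {m : ℝ} (hm : ∀ i, x i * x' i = m) {t t' : ℝ} (ht : 0 < t) (ht' : 0 < t') :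
    Summable fun i => gaussPrim (t * x i + t' * x' i) - gaussPrim (x i + x' i) := by
  obtain ⟨c, hc⟩ : ∃ c, c = min 1 (min t t') := ⟨_, rfl⟩
  obtain ⟨C, hC⟩ : ∃ C, C = max 1 (max t t') := ⟨_, rfl⟩
  have hc0 : 0 < c := by rw [hc]; exact lt_min one_pos (lt_min ht ht')
  have hδ : 0 < π * c ^ 2 / 2 := by positivity
  refine Summable.of_norm_bounded
    (g := fun i => exp (2 * π * C ^ 2 * |m|) * C * ((1 + 1 / (π * c ^ 2 / 2)) *
      exp (-(π * c ^ 2 / 2) * (x i ^ 2 + x' i ^ 2))))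
    (((hs _ hδ).mul_left _).mul_left _) (fun i => ?_)
  have h1 := gaussPrim_sub_le (t := t) (t' := t') hc0 (hc ▸ min_le_left _ _)
    (hc ▸ (min_le_right _ _).trans (min_le_left _ _))
    (hc ▸ (min_le_right _ _).trans (min_le_right _ _)) (C := C) (hC ▸ le_max_left _ _)
    (hC ▸ (le_max_left _ _).trans (le_max_right _ _))
    (hC ▸ (le_max_right _ _).trans (le_max_right _ _)) (x i) (x' i)
  rw [hm] at h1
  have hC0 : 0 ≤ C := by
    have : 1 ≤ C := hC ▸ le_max_left _ _
    linarith
  refine h1.trans (mul_le_mul_of_nonneg_left ?_ (by positivity))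
  have := linear_mul_exp_le hδ (x i) (x' i)
  rwa [show 2 * (π * c ^ 2 / 2) = π * c ^ 2 by ring] at this

/-- The theta kernel attached to `(x, x')`, at `Im τ = 1`. -/
noncomputable def kern (x x' w : ℝ) : ℝ :=
  (x * exp (-w) - x' * exp w) * exp (-(π / 2) * ((x * exp (-w) - x' * exp w) ^ 2 +
    (x * exp (-w) + x' * exp w) ^ 2))

lemma continuous_kern (x x' : ℝ) : Continuous (kern x x') := by
  unfold kern; fun_prop

lemma abs_kern_le {L w : ℝ} (hw : |w| ≤ L) (x x' : ℝ) :
    |kern x x' w| ≤ exp L * ((|x| + |x'|) * exp (-(π * exp (-L) ^ 2) * (x ^ 2 + x' ^ 2))) := by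
  obtain ⟨h1, h2⟩ := abs_le.1 hw
  have a1 : exp (-w) ≤ exp L := exp_le_exp.2 (by linarith)
  have a2 : exp w ≤ exp L := exp_le_exp.2 h2
  have b1 : exp (-L) ≤ exp (-w) := exp_le_exp.2 (by linarith)
  have b2 : exp (-L) ≤ exp w := exp_le_exp.2 h1
  rw [kern, abs_mul, abs_exp, ← mul_assoc]
  refine mul_le_mul ?_ (exp_le_exp.2 ?_) (exp_pos _).le (by positivity)
  · refine (abs_sub _ _).trans ?_
    rw [abs_mul, abs_mul, abs_exp, abs_exp]
    nlinarith [abs_nonneg x, abs_nonneg x']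
  · have c1 : exp (-L) ^ 2 * x ^ 2 ≤ exp (-w) ^ 2 * x ^ 2 :=
      mul_le_mul_of_nonneg_right (pow_le_pow_left₀ (exp_pos _).le b1 2) (sq_nonneg _)
    have c2 : exp (-L) ^ 2 * x' ^ 2 ≤ exp w ^ 2 * x' ^ 2 :=
      mul_le_mul_of_nonneg_right (pow_le_pow_left₀ (exp_pos _).le b2 2) (sq_nonneg _)
    nlinarith [mul_le_mul_of_nonneg_left (add_le_add c1 c2) pi_pos.le]

/-- Put X = xe^{-w} - x'e^{w} and Y = xe^{-w} + x'e^{w}. Then dY/dw = -X and Y² - X² = 4xx', so the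
factor e^{-2πxx'} completes (π/2)(X² + Y²) to πY², and the integrand is the derivative of
-`gaussPrim` Y. -/
lemma integral_kern (x x' L : ℝ) :
    (∫ w in (0 : ℝ)..L, kern x x' w) * exp (2 * π * -(x * x')) =
      gaussPrim (x + x') - gaussPrim (x * exp (-L) + x' * exp L) := by
  have hd : ∀ w ∈ uIcc (0 : ℝ) L, HasDerivAt
      (fun w => -gaussPrim (x * exp (-w) + x' * exp w))
      (kern x x' w * exp (2 * π * -(x * x'))) w := by
    intro w _
    have h1 : HasDerivAt (fun w => x * exp (-w) + x' * exp w) (x * (exp (-w) * -1) + x' * exp w) w :=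
      (((hasDerivAt_neg w).exp).const_mul x).add ((Real.hasDerivAt_exp w).const_mul x')
    have h2 := ((hasDerivAt_gaussPrim _).comp w h1).neg
    refine h2.congr_deriv ?_
    have h3 : exp (-w) * exp w = 1 := by rw [← exp_add]; simp
    have h4 : -π * (x * exp (-w) + x' * exp w) ^ 2 = -(π / 2) * ((x * exp (-w) - x' * exp w) ^ 2 +
        (x * exp (-w) + x' * exp w) ^ 2) + 2 * π * -(x * x') := by
      linear_combination (-2 * π * x * x') * h3
    rw [h4, exp_add, kern]; ring
  rw [← intervalIntegral.integral_mul_const,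
    intervalIntegral.integral_eq_sub_of_hasDerivAt hd
      (((continuous_kern x x').mul_const _).intervalIntegrable _ _)]
  simp; ring

variable {ι : Type*} [Countable ι] {x x' : ι → ℝ}

lemma summable_kern_bound (hs : ∀ c : ℝ, 0 < c → Summable fun i => exp (-c * (x i ^ 2 + x' i ^ 2)))
    (L : ℝ) : Summable fun i =>
      exp L * ((|x i| + |x' i|) * exp (-(π * exp (-L) ^ 2) * (x i ^ 2 + x' i ^ 2))) := by
  have hδ : 0 < π * exp (-L) ^ 2 / 2 := by positivity
  refine Summable.mul_left _ (Summable.of_nonneg_of_le (fun i => by positivity) (fun i => ?_)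
    ((hs _ hδ).mul_left (1 + 1 / (π * exp (-L) ^ 2 / 2))))
  have := linear_mul_exp_le hδ (x i) (x' i)
  rwa [show 2 * (π * exp (-L) ^ 2 / 2) = π * exp (-L) ^ 2 by ring] at this

lemma summable_integral_kern
    (hs : ∀ c : ℝ, 0 < c → Summable fun i => exp (-c * (x i ^ 2 + x' i ^ 2))) (L : ℝ) :
    Summable fun i => |∫ w in (0 : ℝ)..L, kern (x i) (x' i) w| := by
  refine Summable.of_nonneg_of_le (fun i => abs_nonneg _) (fun i => ?_)
    ((summable_kern_bound hs |L|).mul_right |L - 0|)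
  rw [← Real.norm_eq_abs]
  refine intervalIntegral.norm_integral_le_of_norm_le_const fun w hw => ?_
  rw [Real.norm_eq_abs]
  refine abs_kern_le ?_ _ _
  rcases mem_uIoc.1 hw with h | h
  · exact abs_le_abs h.2 (by linarith)
  · rw [abs_of_nonpos h.2, abs_of_neg (h.1.trans_le h.2)]; linarith

/-- The phase `e(-xx'u)`. -/
noncomputable def phase (k u : ℝ) : ℂ := Complex.exp (2 * π * Complex.I * ((k * u : ℝ) : ℂ))

lemma norm_phase (k u : ℝ) : ‖phase k u‖ = 1 := by
  rw [phase, show 2 * (π : ℂ) * Complex.I * ((k * u : ℝ) : ℂ) =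
    ((2 * π * (k * u) : ℝ) : ℂ) * Complex.I by push_cast; ring, Complex.norm_exp_ofReal_mul_I]

lemma continuous_phase (k : ℝ) : Continuous (phase k) := by
  unfold phase; fun_prop

lemma phase_add (k k' u : ℝ) : phase k u * phase k' u = phase (k + k') u := by
  rw [phase, phase, phase, ← Complex.exp_add]; congr 1; push_cast; ring

lemma integral_phase {k N : ℝ} (h : ∃ j : ℤ, k * N = j) :
    ∫ u in (0 : ℝ)..N, phase k u = if k = 0 then (N : ℂ) else 0 := by
  split_ifs with hk
  · simp [phase, hk]
  · have hc : 2 * (π : ℂ) * Complex.I * k ≠ 0 := by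
      simp [hk, pi_ne_zero]
    have : ∀ u, phase k u = Complex.exp (2 * π * Complex.I * k * u) := fun u => by
      rw [phase]; congr 1; push_cast; ring
    simp only [this]
    rw [integral_exp_mul_complex hc]
    obtain ⟨j, hj⟩ := h
    have h1 : 2 * (π : ℂ) * Complex.I * k * N = j * (2 * π * Complex.I) := by
      have : (k : ℂ) * N = j := by exact_mod_cast congrArg (fun r : ℝ => (r : ℂ)) hj
      linear_combination 2 * (π : ℂ) * Complex.I * this
    rw [h1, Complex.exp_int_mul_two_pi_mul_I]
    simp

lemma integral_theta_eq
    (hs : ∀ c : ℝ, 0 < c → Summable fun i => exp (-c * (x i ^ 2 + x' i ^ 2))) (L : ℝ) (u : ℝ) :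
    ∫ w in (0 : ℝ)..L, ∑' i, (kern (x i) (x' i) w : ℂ) * phase (-(x i * x' i)) u =
      ∑' i, ((∫ w in (0 : ℝ)..L, kern (x i) (x' i) w : ℝ) : ℂ) * phase (-(x i * x' i)) u := by
  have hb := summable_kern_bound hs |L|
  have hle : ∀ i, ∀ w ∈ uIoc 0 L, ‖(kern (x i) (x' i) w : ℂ) * phase (-(x i * x' i)) u‖ ≤
      exp |L| * ((|x i| + |x' i|) * exp (-(π * exp (-|L|) ^ 2) * (x i ^ 2 + x' i ^ 2))) := by
    intro i w hw
    rw [norm_mul, norm_phase, mul_one, Complex.norm_real, Real.norm_eq_abs]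
    refine abs_kern_le ?_ _ _
    rcases mem_uIoc.1 hw with h | h
    · exact abs_le_abs h.2 (by linarith)
    · rw [abs_of_nonpos h.2, abs_of_neg (h.1.trans_le h.2)]; linarith
  have key := intervalIntegral.hasSum_integral_of_dominated_convergence (a := 0) (b := L)
    (μ := MeasureTheory.volume)
    (F := fun i w => (kern (x i) (x' i) w : ℂ) * phase (-(x i * x' i)) u)
    (f := fun w => ∑' i, (kern (x i) (x' i) w : ℂ) * phase (-(x i * x' i)) u)
    (fun i _ => exp |L| * ((|x i| + |x' i|) * exp (-(π * exp (-|L|) ^ 2) * (x i ^ 2 + x' i ^ 2))))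
    (fun i => ((Complex.continuous_ofReal.comp (continuous_kern _ _)).mul
      continuous_const).aestronglyMeasurable)
    (fun i => Filter.Eventually.of_forall (hle i))
    (Filter.Eventually.of_forall fun _ _ => hb)
    (intervalIntegrable_const)
    (Filter.Eventually.of_forall fun w hw =>
      (Summable.of_norm_bounded hb (fun i => hle i w hw)).hasSum)
  rw [← key.tsum_eq]
  refine tsum_congr fun i => ?_
  rw [intervalIntegral.integral_mul_const, intervalIntegral.integral_ofReal]

lemma continuous_theta
    (hs : ∀ c : ℝ, 0 < c → Summable fun i => exp (-c * (x i ^ 2 + x' i ^ 2))) (L : ℝ) :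
    Continuous fun u : ℝ =>
      ∑' i, ((∫ w in (0 : ℝ)..L, kern (x i) (x' i) w : ℝ) : ℂ) * phase (-(x i * x' i)) u := by
  refine continuous_tsum (fun i => continuous_const.mul (continuous_phase _))
    (summable_integral_kern hs L) (fun i u => ?_)
  rw [norm_mul, norm_phase, mul_one, Complex.norm_real, Real.norm_eq_abs]

/-- Dominated convergence exchanges sum and integral, and orthogonality of the phases over [0, N]
keeps the indices with xx' = -m. For these, the factor e^{2πm} coming from Im τ = 1 is the one
required by `integral_kern`. -/
lemma fourier_theta
    (hs : ∀ c : ℝ, 0 < c → Summable fun i => exp (-c * (x i ^ 2 + x' i ^ 2))) (L : ℝ)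
    {m N : ℝ} (hN : N ≠ 0) (hint : ∀ i, ∃ j : ℤ, (x i * x' i + m) * N = j) :
    (1 / (N : ℂ)) * ∫ u in (0 : ℝ)..N,
      (∑' i, ((∫ w in (0 : ℝ)..L, kern (x i) (x' i) w : ℝ) : ℂ) * phase (-(x i * x' i)) u) *
        Complex.exp (-(2 * π * Complex.I * m * (u + Complex.I))) =
      ∑' i : {i | x i * x' i = -m},
        ((gaussPrim (x i + x' i) - gaussPrim (x i * exp (-L) + x' i * exp L) : ℝ) : ℂ) := by
  have hsum := summable_integral_kern hs L
  have hexp : ∀ u : ℝ, Complex.exp (-(2 * π * Complex.I * m * (u + Complex.I))) =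
      ((exp (2 * π * m) : ℝ) : ℂ) * phase (-m) u := by
    intro u
    rw [phase, Complex.ofReal_exp, ← Complex.exp_add]
    congr 1
    push_cast
    linear_combination (-(2 * π * m) : ℂ) * Complex.I_mul_I
  have key := intervalIntegral.hasSum_integral_of_dominated_convergence (a := 0) (b := N)
    (μ := MeasureTheory.volume)
    (F := fun i u => ((∫ w in (0 : ℝ)..L, kern (x i) (x' i) w : ℝ) : ℂ) * phase (-(x i * x' i)) u *
      Complex.exp (-(2 * π * Complex.I * m * (u + Complex.I))))
    (f := fun u => (∑' i, ((∫ w in (0 : ℝ)..L, kern (x i) (x' i) w : ℝ) : ℂ) *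
      phase (-(x i * x' i)) u) * Complex.exp (-(2 * π * Complex.I * m * (u + Complex.I))))
    (fun i _ => |∫ w in (0 : ℝ)..L, kern (x i) (x' i) w| * exp (2 * π * m))
    (fun i => ((continuous_const.mul (continuous_phase _)).mul (by fun_prop)).aestronglyMeasurable)
    (fun i => Filter.Eventually.of_forall fun u _ => by
      rw [hexp, norm_mul, norm_mul, norm_mul, norm_phase, norm_phase, mul_one, mul_one,
        Complex.norm_real, Complex.norm_real, Real.norm_eq_abs, Real.norm_eq_abs, abs_exp])
    (Filter.Eventually.of_forall fun _ _ => hsum.mul_right _)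
    (intervalIntegrable_const)
    (Filter.Eventually.of_forall fun u _ => by
      refine HasSum.mul_right _ (Summable.hasSum (Summable.of_norm_bounded hsum fun i => ?_))
      rw [norm_mul, norm_phase, mul_one, Complex.norm_real, Real.norm_eq_abs])
  rw [← key.tsum_eq, ← tsum_mul_left]
  rw [tsum_subtype {i | x i * x' i = -m} (fun i =>
    ((gaussPrim (x i + x' i) - gaussPrim (x i * exp (-L) + x' i * exp L) : ℝ) : ℂ))]
  refine tsum_congr fun i => ?_
  have hN' : (N : ℂ) ≠ 0 := by exact_mod_cast hN
  have hterm : ∀ u : ℝ, ((∫ w in (0 : ℝ)..L, kern (x i) (x' i) w : ℝ) : ℂ) *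
      phase (-(x i * x' i)) u * Complex.exp (-(2 * π * Complex.I * m * (u + Complex.I))) =
      (((∫ w in (0 : ℝ)..L, kern (x i) (x' i) w) * exp (2 * π * m) : ℝ) : ℂ) *
        phase (-(x i * x' i) + -m) u := by
    intro u
    rw [hexp, ← phase_add]; push_cast; ring
  simp only [hterm]
  rw [intervalIntegral.integral_const_mul, integral_phase (by
    obtain ⟨j, hj⟩ := hint i
    exact ⟨-j, by push_cast; rw [← hj]; ring⟩)]
  by_cases h : x i * x' i = -m
  · rw [indicator_of_mem (by exact h), if_pos (by rw [h]; ring), ← integral_kern, h, neg_neg]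
    field_simp
  · rw [indicator_of_notMem (by exact h), if_neg (fun h' => h (by linarith)), mul_zero, mul_zero]

end Analysis
end HeckeTheta

namespace HeckeTheta

/-! ### Sums over lattice subsets of F, orbit sums, the unit -/

section Lattice

open Real

set_option linter.unusedSectionVars false

variable {Δ : ℤ} [hΔ : Fact (IsFundamentalDiscriminant Δ)] [hΔ1 : Fact (1 < Δ)]

lemma summable_int_gauss {a : ℝ} (ha : 0 < a) : Summable fun n : ℤ => exp (-a * (n : ℝ) ^ 2) := by
  have h : Summable fun n : ℕ => exp (-a * (n : ℝ) ^ 2) := by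
    refine Summable.of_nonneg_of_le (fun n => (exp_pos _).le) (fun n => ?_)
      (summable_geometric_of_lt_one (exp_pos (-a)).le (by rw [exp_lt_one_iff]; linarith))
    rw [← exp_nat_mul]
    apply exp_le_exp.2
    have : (n : ℝ) ≤ (n : ℝ) ^ 2 := by
      have : n ≤ n ^ 2 := Nat.le_self_pow two_ne_zero n
      exact_mod_cast this
    nlinarith
  exact Summable.of_nat_of_neg (by simpa using h) (by simpa using h)

/-- Writing 2Dl = T + B√Δ makes l² + l'² a positive definite diagonal form in integers, which bounds
Gaussian sums over S by sums over ℤ². -/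
lemma exists_lattice_coords {D : ℤ} (hD : D ≠ 0) {S : Set (QuadField Δ)}
    (hS : ∀ l ∈ S, IsIntegral ℤ ((D : QuadField Δ) * l)) :
    ∃ φ : S → ℤ × ℤ, Function.Injective φ ∧ ∀ l : S, (l : ℝ) ^ 2 + (conj Δ l : ℝ) ^ 2 =
      (((φ l).1 : ℝ) ^ 2 + Δ * ((φ l).2 : ℝ) ^ 2) / (2 * D ^ 2) := by
  have hex : ∀ l : S, ∃ p : ℤ × ℤ, 2 * ((D : QuadField Δ) * l) = p.1 + p.2 * sqrtDisc Δ := by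
    intro l
    obtain ⟨T, B, h, -⟩ := exists_half_repr (hS l l.2)
    exact ⟨(T, B), h⟩
  choose φ hφ using hex
  have hDK : (D : QuadField Δ) ≠ 0 := by exact_mod_cast hD
  have hDr : (D : ℝ) ≠ 0 := by exact_mod_cast hD
  refine ⟨φ, fun l l' h => ?_, fun l => ?_⟩
  · apply Subtype.ext
    have h1 := hφ l
    rw [h, ← hφ l'] at h1
    exact mul_left_cancel₀ hDK (mul_left_cancel₀ two_ne_zero h1)
  · have h2r : ((2 : QuadField Δ) : ℝ) = 2 := rfl
    have h1 := congrArg (fun x : QuadField Δ => (x : ℝ)) (hφ l)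
    have h2 := congrArg (fun x : QuadField Δ => (x : ℝ)) (congrArg (conj Δ) (hφ l))
    simp only [conj_intCast_mul_sqrt, map_mul, map_ofNat, map_intCast] at h2
    push_cast at h1 h2
    rw [h2r] at h1 h2
    have hs : ((sqrtDisc Δ : QuadField Δ) : ℝ) ^ 2 = Δ := by
      have := congrArg (fun x : QuadField Δ => (x : ℝ)) (sqrtDisc_sq (Δ := Δ))
      push_cast at this
      exact this
    rw [eq_div_iff (by positivity), ← hs]
    linear_combination (2 * (D * (l : ℝ)) + (φ l).1 + (φ l).2 * ((sqrtDisc Δ : QuadField Δ) : ℝ)) / 2 * h1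
      + (2 * (D * (conj Δ l : ℝ)) + (φ l).1 - (φ l).2 * ((sqrtDisc Δ : QuadField Δ) : ℝ)) / 2 * h2

/-- Subsets of a lattice in `F`. -/
def IsLatticeSet (S : Set (QuadField Δ)) : Prop :=
  ∃ D : ℤ, D ≠ 0 ∧ ∀ l ∈ S, IsIntegral ℤ ((D : QuadField Δ) * l)

lemma IsLatticeSet.mono {S T : Set (QuadField Δ)} (hT : IsLatticeSet T) (h : S ⊆ T) :
    IsLatticeSet S := by
  obtain ⟨D, hD, hT⟩ := hT
  exact ⟨D, hD, fun l hl => hT l (h hl)⟩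

lemma IsLatticeSet.countable {S : Set (QuadField Δ)} (hS : IsLatticeSet S) : Countable S := by
  obtain ⟨D, hD, hS⟩ := hS
  obtain ⟨φ, hφ, -⟩ := exists_lattice_coords hD hS
  exact hφ.countable

lemma IsLatticeSet.summable {S : Set (QuadField Δ)} (hS : IsLatticeSet S) {c : ℝ} (hc : 0 < c) :
    Summable fun l : S => exp (-c * ((l : ℝ) ^ 2 + (conj Δ l : ℝ) ^ 2)) := by
  obtain ⟨D, hD, hS⟩ := hS
  obtain ⟨φ, hφ, h⟩ := exists_lattice_coords hD hS
  have hDr : (D : ℝ) ≠ 0 := by exact_mod_cast hD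
  have hΔr := disc_pos_real (Δ := Δ)
  have ha : 0 < c / (2 * (D : ℝ) ^ 2) := by positivity
  have hb : 0 < c * Δ / (2 * (D : ℝ) ^ 2) := by positivity
  have key := ((summable_int_gauss ha).mul_of_nonneg (summable_int_gauss hb)
    (fun _ => (exp_pos _).le) (fun _ => (exp_pos _).le)).comp_injective hφ
  refine key.congr fun l => ?_
  simp only [Function.comp_apply]
  rw [h l, ← exp_add]
  congr 1
  field_simp
  ring

/-- The Gaussian primitive of the trace. -/
noncomputable def tracePrim (l : QuadField Δ) : ℝ := gaussPrim ((l : ℝ) + (conj Δ l : ℝ))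

lemma summable_tracePrim_sub {S : Set (QuadField Δ)} (hS : IsLatticeSet S) {m : QuadField Δ}
    (hm : ∀ l ∈ S, nm Δ l = m) {t : QuadField Δ} (ht : IsTotallyPositive Δ t) :
    Summable fun l : S => tracePrim (t * (l : QuadField Δ)) - tracePrim (l : QuadField Δ) := by
  have := summable_gaussPrim_sub (ι := S) (x := fun l => (l : ℝ)) (x' := fun l => (conj Δ l : ℝ))
    (fun c hc => hS.summable hc) (m := (m : ℝ))
    (fun l => by rw [← hm l l.2]; rfl) ht.1 ht.2
  refine this.congr fun l => ?_
  rw [tracePrim, tracePrim, map_mul]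
  rfl

/-- The sum over `S` of the theta integrals over a period given by the unit `η`. -/
noncomputable def orbitSum (η : QuadField Δ) (S : Set (QuadField Δ)) : ℝ :=
  ∑' l : S, (tracePrim (l : QuadField Δ) - tracePrim (η * (l : QuadField Δ)))

lemma summable_orbit {S : Set (QuadField Δ)} (hS : IsLatticeSet S) {m : QuadField Δ}
    (hm : ∀ l ∈ S, nm Δ l = m) {η : QuadField Δ} (hη : IsTotallyPositive Δ η) :
    Summable fun l : S => tracePrim (l : QuadField Δ) - tracePrim (η * (l : QuadField Δ)) := by
  refine (summable_tracePrim_sub hS hm hη).neg.congr fun l => ?_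
  ring

/-- The orbit sums are invariant under scaling by totally positive elements. -/
lemma orbitSum_image_mul {S : Set (QuadField Δ)} (hS : IsLatticeSet S) {m : QuadField Δ}
    (hm : ∀ l ∈ S, nm Δ l = m) {η t : QuadField Δ} (hη : IsTotallyPositive Δ η)
    (hηS : S = (fun l => η * l) '' S) (ht : IsTotallyPositive Δ t) :
    orbitSum η ((fun l => t * l) '' S) = orbitSum η S := by
  have hη0 := hη.ne_zero
  have hinj : Function.Injective fun l : QuadField Δ => t * l := mul_right_injective₀ ht.ne_zero
  rw [orbitSum, tsum_image (fun l => tracePrim l - tracePrim (η * l)) hinj.injOn, orbitSum]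
  have hmem : ∀ l ∈ S, η * l ∈ S := fun l hl => hηS ▸ Set.mem_image_of_mem _ hl
  have hbij : Function.Bijective (fun l : S => (⟨η * l, hmem l l.2⟩ : S)) := by
    constructor
    · intro a b hab
      exact Subtype.ext (mul_left_cancel₀ hη0 (congrArg Subtype.val hab))
    · rintro ⟨b, hb⟩
      obtain ⟨a, ha, hab⟩ := (Set.ext_iff.1 hηS b).1 hb
      exact ⟨⟨a, ha⟩, Subtype.ext hab⟩
  let e : S ≃ S := Equiv.ofBijective _ hbij
  have hd := summable_tracePrim_sub hS hm ht
  have hde : Summable fun l : S =>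
      tracePrim (t * (e l : QuadField Δ)) - tracePrim (e l : QuadField Δ) :=
    (Equiv.summable_iff e).2 hd
  have hW := summable_orbit hS hm hη
  -- With d(l) = `tracePrim (t * l) - tracePrim l`, scaling by t changes the term at l by d(l) -
  -- d(ηl). As d is summable and η permutes S, the total change is 0.
  have e1 : ∀ l : S, tracePrim (t * (l : QuadField Δ)) - tracePrim (η * (t * (l : QuadField Δ))) =
      (tracePrim (l : QuadField Δ) - tracePrim (η * (l : QuadField Δ))) +
      ((tracePrim (t * (l : QuadField Δ)) - tracePrim (l : QuadField Δ)) -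
        (tracePrim (t * (e l : QuadField Δ)) - tracePrim (e l : QuadField Δ))) := by
    intro l
    have : (e l : QuadField Δ) = η * l := rfl
    rw [this, mul_left_comm t η]
    ring
  rw [tsum_congr e1, hW.tsum_add (hd.sub hde), hd.tsum_sub hde, Equiv.tsum_eq e
    (fun l : S => tracePrim (t * (l : QuadField Δ)) - tracePrim (l : QuadField Δ)), sub_self,
    add_zero]

lemma orbitSum_union {S T : Set (QuadField Δ)} (hS : IsLatticeSet S) (hT : IsLatticeSet T)
    {m : QuadField Δ} (hm : ∀ l ∈ S, nm Δ l = m) (hm' : ∀ l ∈ T, nm Δ l = m) {η : QuadField Δ}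
    (hη : IsTotallyPositive Δ η) (hST : Disjoint S T) :
    orbitSum η (S ∪ T) = orbitSum η S + orbitSum η T :=
  Summable.tsum_union_disjoint (f := fun l : QuadField Δ => tracePrim l - tracePrim (η * l)) hST
    (summable_orbit hS hm hη) (summable_orbit hT hm' hη)

lemma isLatticeSet_coset {I : FracIdeal Δ} {c : QuadField Δ} (hc : IsMultiplier c I)
    (h : DiscModule Δ) : IsLatticeSet (coset Δ I h) := by
  obtain ⟨α, hα, rfl⟩ := exists_discClass h
  obtain ⟨a, ha, ha'⟩ := I.2
  have ha0 : (a : QuadField Δ) ≠ 0 := by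
    have := nonZeroDivisors.ne_zero ha
    simpa using this
  obtain ⟨N, hN⟩ := exists_norm_int (NumberField.RingOfIntegers.isIntegral_coe a)
  have hN0 : N ≠ 0 := by
    rintro rfl
    rw [nm] at hN
    simp [ha0] at hN
  -- With aI ⊆ 𝒪 the element a√Δl is integral; multiplying it by a'√Δ produces the rational
  -- denominator Nm(a)Δ.
  refine ⟨N * Δ, mul_ne_zero hN0 (by have := hΔ1.out; omega), fun l hl => ?_⟩
  obtain ⟨b, hb⟩ := ha' _ ((mem_coset_iff hc).1 hl).1
  have h1 : IsIntegral ℤ ((a : QuadField Δ) * (sqrtDisc Δ * l)) := by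
    rw [Algebra.smul_def] at hb
    rw [← hb]
    exact NumberField.RingOfIntegers.isIntegral_coe b
  have h2 := ((isIntegral_conj (NumberField.RingOfIntegers.isIntegral_coe a)).mul
    isIntegral_sqrtDisc).mul h1
  have e : conj Δ (a : QuadField Δ) * sqrtDisc Δ * ((a : QuadField Δ) * (sqrtDisc Δ * l)) =
      ((N * Δ : ℤ) : QuadField Δ) * l := by
    push_cast
    rw [← hN, nm, ← sqrtDisc_mul_self]; ring
  rwa [← e]

lemma isTotallyPositive_natCast {n : ℕ} (hn : 0 < n) : IsTotallyPositive Δ (n : QuadField Δ) := by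
  rw [IsTotallyPositive, map_natCast]
  have : (0 : ℝ) < ((n : QuadField Δ) : ℝ) := by push_cast; exact_mod_cast hn
  exact ⟨this, this⟩

lemma nm_unit_eq_one (u : (𝓞 (QuadField Δ))ˣ)
    (hu : IsTotallyPositive Δ ((u : 𝓞 (QuadField Δ)) : QuadField Δ)) :
    nm Δ ((u : 𝓞 (QuadField Δ)) : QuadField Δ) = 1 := by
  obtain ⟨N, hN⟩ := exists_norm_int (NumberField.RingOfIntegers.isIntegral_coe (u : 𝓞 (QuadField Δ)))
  obtain ⟨M, hM⟩ := exists_norm_int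
    (NumberField.RingOfIntegers.isIntegral_coe ((u⁻¹ : (𝓞 (QuadField Δ))ˣ) : 𝓞 (QuadField Δ)))
  have huu : ((u : 𝓞 (QuadField Δ)) : QuadField Δ) *
      (((u⁻¹ : (𝓞 (QuadField Δ))ˣ) : 𝓞 (QuadField Δ)) : QuadField Δ) = 1 := by
    simp
  have hNM : N * M = 1 := by
    have h1 := congrArg (nm Δ) huu
    rw [nm_mul, hN, hM, nm, map_one, mul_one] at h1
    exact_mod_cast h1
  have hpos : 0 < N := by
    have h1 : (0 : ℝ) < ((nm Δ ((u : 𝓞 (QuadField Δ)) : QuadField Δ) : QuadField Δ) : ℝ) :=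
      mul_pos hu.1 hu.2
    rw [hN] at h1
    push_cast at h1
    exact_mod_cast h1
  have : N = 1 := by
    rcases Int.eq_one_or_neg_one_of_mul_eq_one hNM with h | h
    · exact h
    · omega
  rw [hN, this]; simp

/-- The number `ε_Δ` is the square of a totally positive unit. -/
lemma exists_unit_epsDisc : ∃ u : QuadField Δ, IsIntegral ℤ u ∧ IsTotallyPositive Δ u ∧
    nm Δ u = 1 ∧ log (epsDisc Δ) = log ((u : ℝ) ^ 2) := by
  obtain ⟨A, hA⟩ : ∃ A : Set ℝ, A = {x : ℝ | 1 < x ∧ ∃ u : (𝓞 (QuadField Δ))ˣ,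
    IsTotallyPositive Δ ((u : 𝓞 (QuadField Δ)) : QuadField Δ) ∧
      x = (((u : 𝓞 (QuadField Δ)) : QuadField Δ) : ℝ)} := ⟨_, rfl⟩
  have heps : epsPlus Δ = sInf A := by rw [epsPlus, hA]
  rcases A.eq_empty_or_nonempty with hE | ⟨x₀, hx₀⟩
  -- On the empty set `sInf` is 0, and `log 0 = 0 = log 1`, so u = 1 serves and Dirichlet's unit
  -- theorem is not needed.
  · refine ⟨1, isIntegral_one, ?_, ?_, ?_⟩
    · rw [IsTotallyPositive, map_one]; simp
    · rw [nm, map_one, mul_one]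
    · rw [epsDisc, heps, hE]; simp
  · obtain ⟨S, hS⟩ : ∃ S : Set (QuadField Δ), S = {z | IsIntegral ℤ z} := ⟨_, rfl⟩
    have hSl : IsLatticeSet S := ⟨1, one_ne_zero, fun l hl => by
      rw [hS] at hl; simpa using hl⟩
    -- The terms of a convergent Gaussian sum over 𝒪_F tend to 0, so only finitely many integers
    -- satisfy u² + u'² ≤ x₀² + 1. Totally positive units in (1, x₀] do, since u' = 1/u ≤ 1; hence
    -- the infimum is attained.
    have hfin : {l : S | exp (-(x₀ ^ 2 + 1)) ≤ exp (-1 * ((l : ℝ) ^ 2 + (conj Δ l : ℝ) ^ 2))}.Finite := by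
      have := (hSl.summable one_pos).tendsto_cofinite_zero.eventually
        (gt_mem_nhds (exp_pos (-(x₀ ^ 2 + 1))))
      rw [Filter.eventually_cofinite] at this
      simpa only [not_lt] using this
    have hAfin : (A ∩ Set.Iic x₀).Finite := by
      refine (hfin.image fun l : S => ((l : QuadField Δ) : ℝ)).subset ?_
      rintro x ⟨hx, hxx⟩
      rw [hA] at hx
      obtain ⟨hx1, u, hu, rfl⟩ := hx
      refine ⟨⟨((u : 𝓞 (QuadField Δ)) : QuadField Δ), by
        rw [hS]; exact NumberField.RingOfIntegers.isIntegral_coe _⟩, ?_, rfl⟩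
      apply exp_le_exp.2
      have h1 := congrArg (fun x : QuadField Δ => (x : ℝ)) (nm_unit_eq_one u hu)
      have h2 : (((u : 𝓞 (QuadField Δ)) : QuadField Δ) : ℝ) *
        (conj Δ ((u : 𝓞 (QuadField Δ)) : QuadField Δ) : ℝ) = 1 := h1
      have h3 := hu.2
      have h4 : (conj Δ ((u : 𝓞 (QuadField Δ)) : QuadField Δ) : ℝ) ≤ 1 := by nlinarith
      simp only [Set.mem_Iic] at hxx
      nlinarith
    obtain ⟨y, hy, hmin⟩ := hAfin.exists_minimal ⟨x₀, hx₀, le_refl x₀⟩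
    have hleast : IsLeast A y := by
      refine ⟨hy.1, fun z hz => ?_⟩
      rcases le_total z x₀ with h | h
      · by_contra hlt
        push Not at hlt
        exact absurd (hmin ⟨hz, h⟩ hlt.le) (not_le.2 hlt)
      · exact le_trans hy.2 h
    have hyA := hy.1
    rw [hA] at hyA
    obtain ⟨-, u, hu, hyu⟩ := hyA
    refine ⟨_, NumberField.RingOfIntegers.isIntegral_coe (u : 𝓞 (QuadField Δ)), hu,
      nm_unit_eq_one u hu, ?_⟩
    rw [epsDisc, heps, hleast.csInf_eq, hyu]

end Lattice

/-! ### Finiteness of the narrow class group -/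

section Finiteness

set_option linter.unusedSectionVars false

variable {Δ : ℤ} [hΔ : Fact (IsFundamentalDiscriminant Δ)] [hΔ1 : Fact (1 < Δ)]

/-- A narrow class is determined by its ordinary class and the signs of x and x', where x relates
the chosen representatives of the two classes. -/
instance finite_narrowClassGroup : Finite (NarrowClassGroup Δ) := by
  let Q := (FracIdeal Δ)ˣ ⧸ (toPrincipalIdeal (𝓞 (QuadField Δ)) (QuadField Δ)).range
  have hQ : Finite Q := Finite.of_equiv _ (ClassGroup.equiv (R := 𝓞 (QuadField Δ)) (QuadField Δ)).toEquiv
  let cls : NarrowClassGroup Δ → Q := fun q => QuotientGroup.mk ((Quotient.out q : coprimeIdeals Δ) : (FracIdeal Δ)ˣ)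
  have hex : ∀ q : NarrowClassGroup Δ, ∃ x : QuadField Δ, x ≠ 0 ∧
      (((Quotient.out q : coprimeIdeals Δ) : (FracIdeal Δ)ˣ) : FracIdeal Δ) =
        FractionalIdeal.spanSingleton _ x * ((Quotient.out (cls q) : (FracIdeal Δ)ˣ) : FracIdeal Δ) := by
    intro q
    have h1 : (QuotientGroup.mk (Quotient.out (cls q)) : Q) = cls q := Quotient.out_eq _
    rw [QuotientGroup.eq] at h1
    obtain ⟨x, hx⟩ := h1
    refine ⟨x, x.ne_zero, ?_⟩
    rw [← coe_toPrincipalIdeal, hx, ← Units.val_mul, mul_comm, mul_inv_cancel_left]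
  choose x hx0 hx using hex
  refine Finite.of_injective (β := Q × Prop × Prop)
    (fun q => (cls q, 0 < (x q : ℝ), 0 < (conj Δ (x q) : ℝ))) ?_
  intro p q hpq
  simp only [Prod.mk.injEq, eq_iff_iff] at hpq
  obtain ⟨h1, h2, h3⟩ := hpq
  have key : (QuotientGroup.mk (Quotient.out p) : NarrowClassGroup Δ) =
      QuotientGroup.mk (Quotient.out q) := by
    rw [QuotientGroup.eq]
    refine ⟨(x p)⁻¹ * x q, ?_, ?_⟩
    · have hs : ∀ a b : ℝ, a ≠ 0 → b ≠ 0 → (0 < a ↔ 0 < b) → 0 < a⁻¹ * b := by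
        intro a b ha hb hab
        rcases lt_or_gt_of_ne ha with h | h
        · have hb' : b < 0 := lt_of_le_of_ne (not_lt.1 fun h' => absurd (hab.2 h') (not_lt.2 h.le)) hb
          exact mul_pos_of_neg_of_neg (inv_lt_zero.2 h) hb'
        · exact mul_pos (inv_pos.2 h) (hab.1 h)
      have hne : ∀ z : QuadField Δ, z ≠ 0 → (z : ℝ) ≠ 0 := fun z hz => by
        simpa using hz
      constructor
      · have := hs _ _ (hne _ (hx0 p)) (hne _ (hx0 q)) h2
        simpa using this
      · have := hs _ _ (hne _ (conj_ne_zero (hx0 p))) (hne _ (conj_ne_zero (hx0 q))) h3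
        rw [map_mul, map_inv₀]
        simpa using this
    · have hp := hx p
      have hq := hx q
      rw [h1] at hp
      simp only [Subgroup.coe_mul, Subgroup.coe_inv, Units.val_mul, Units.val_inv_eq_inv_val]
      rw [hp, hq, mul_inv, FractionalIdeal.spanSingleton_inv,
        ← FractionalIdeal.spanSingleton_mul_spanSingleton, mul_mul_mul_comm,
        inv_mul_cancel₀ (Units.ne_zero _), mul_one]
  rwa [QuotientGroup.out_eq', QuotientGroup.out_eq'] at key

end Finiteness

/-! ### Fourier coefficients as orbit sums -/

section Coefficients

open Real

set_option linter.unusedSectionVars false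

variable {Δ : ℤ} [hΔ : Fact (IsFundamentalDiscriminant Δ)] [hΔ1 : Fact (1 < Δ)]

/-- At τ = u + i with A = 1 the exponent is (πiu/2)(X² - Y²) - (π/2)(X² + Y²), and X² - Y² = -4λλ'.
-/
lemma thetaKernelMinus_eq {I : FracIdeal Δ} (hI : FractionalIdeal.absNorm I = 1)
    (h : DiscModule Δ) (u w : ℝ) :
    thetaKernelMinus Δ I h (u + Complex.I) w = ∑' l : coset Δ I h,
      (kern (l : ℝ) (conj Δ l : ℝ) w : ℂ) * phase (-((l : ℝ) * (conj Δ l : ℝ))) u := by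
  have him : ((u : ℂ) + Complex.I).im = 1 := by simp
  simp only [thetaKernelMinus]
  rw [him, hI, Real.sqrt_one, Complex.ofReal_one, one_mul]
  refine tsum_congr fun l => ?_
  obtain ⟨X, hX⟩ : ∃ X : ℝ, X = (l.1 : ℝ) * exp (-w) - (conj Δ l.1 : ℝ) * exp w := ⟨_, rfl⟩
  obtain ⟨Y, hY⟩ : ∃ Y : ℝ, Y = (l.1 : ℝ) * exp (-w) + (conj Δ l.1 : ℝ) * exp w := ⟨_, rfl⟩
  have hXY : Y ^ 2 - X ^ 2 = 4 * ((l.1 : ℝ) * (conj Δ l.1 : ℝ)) := by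
    have h3 : exp (-w) * exp w = 1 := by rw [← exp_add]; simp
    rw [hX, hY]
    linear_combination 4 * ((l.1 : ℝ) * (conj Δ l.1 : ℝ)) * h3
  rw [kern, ← hX, ← hY, phase, Complex.ofReal_mul, Complex.ofReal_exp, mul_assoc (X : ℂ),
    ← Complex.exp_add]
  have hXY' : (Y : ℂ) ^ 2 - (X : ℂ) ^ 2 = 4 * (((l.1 : ℝ) * (conj Δ l.1 : ℝ) : ℝ) : ℂ) := by
    exact_mod_cast congrArg (fun r : ℝ => (r : ℂ)) hXY
  congr 1
  · simp
  · congr 1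
    simp only [map_add, Complex.conj_ofReal, Complex.conj_I, Rat.cast_one]
    push_cast at hXY' ⊢
    linear_combination (-(2 * π * Complex.I * u) / 4 : ℂ) * hXY' +
      ((π / 2 : ℂ) * (X ^ 2 + Y ^ 2)) * Complex.I_mul_I

/-- √Δl lies in 𝔞 = 𝔟/𝔟' and its conjugate in 𝔞⁻¹, so its norm is a rational integer. This provides
the period needed in `fourier_theta`. -/
lemma nm_mul_disc_int {I : FracIdeal Δ} (hI : I ≠ 0) {c : QuadField Δ}
    (hc : IsMultiplier c (nmMinus Δ I)) {h : DiscModule Δ} {l : QuadField Δ}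
    (hl : l ∈ coset Δ (nmMinus Δ I) h) : ∃ j : ℤ, (l : ℝ) * (conj Δ l : ℝ) * Δ = j := by
  obtain ⟨α, hα, rfl⟩ := exists_discClass h
  have h1 := ((mem_coset_iff hc).1 hl).1
  have h2 : conj Δ (sqrtDisc Δ * l) ∈ (nmMinus Δ I)⁻¹ := by
    rw [← conjIdeal_nmMinus hI, mem_conjIdeal, conj_conj]
    exact h1
  have h3 : IsIntegral ℤ (nm Δ (sqrtDisc Δ * l)) := by
    rw [← mem_one_iff, ← mul_inv_cancel₀ (nmMinus_ne_zero hI)]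
    exact FractionalIdeal.mul_mem_mul h1 h2
  obtain ⟨a, b, hab⟩ := exists_rat_repr l
  have h4 : nm Δ (sqrtDisc Δ * l) = ((-Δ * (a ^ 2 - Δ * b ^ 2) : ℚ) : QuadField Δ) := by
    rw [nm_mul, nm_sqrtDisc, hab, nm, conj_rat_repr]; push_cast; rw [← sqrtDisc_sq]; ring
  rw [h4] at h3
  obtain ⟨k, hk⟩ := int_of_isIntegral_rat h3
  rw [hk, nm_mul, nm_sqrtDisc, nm] at h4
  refine ⟨-k, ?_⟩
  have := congrArg (fun x : QuadField Δ => (x : ℝ)) h4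
  push_cast at this
  push_cast
  linarith

/-- With L = log u², λe^{-L} = u'²λ and λ'e^{L} is its conjugate; so the endpoint w = L amounts to
multiplying λ by η = u'². -/
lemma log_unit {u : QuadField Δ} (hu : IsTotallyPositive Δ u) (hun : nm Δ u = 1) :
    exp (log ((u : ℝ) ^ 2)) = (u : ℝ) ^ 2 ∧ exp (-log ((u : ℝ) ^ 2)) = (conj Δ u : ℝ) ^ 2 := by
  have hpos : 0 < (u : ℝ) ^ 2 := pow_pos hu.1 2
  have h1 : (u : ℝ) * (conj Δ u : ℝ) = 1 := congrArg (fun x : QuadField Δ => (x : ℝ)) hun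
  refine ⟨exp_log hpos, ?_⟩
  rw [exp_neg, exp_log hpos]
  refine inv_eq_of_mul_eq_one_right ?_
  rw [← mul_pow, h1, one_pow]

variable {u : QuadField Δ}

lemma continuous_heckeTheta {I : (FracIdeal Δ)ˣ} (hI : I ∈ coprimeIdeals Δ) (h : DiscModule Δ) :
    Continuous fun t : ℝ => heckeThetaMinus Δ (nmMinus Δ (I : FracIdeal Δ)) h (t + Complex.I) := by
  obtain ⟨c, hc⟩ := exists_isMultiplier_nmMinus hI
  have hlat := isLatticeSet_coset hc h
  have := hlat.countable
  simp only [heckeThetaMinus, thetaKernelMinus_eq (absNorm_nmMinus I.ne_zero)]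
  simp only [integral_theta_eq (ι := coset Δ (nmMinus Δ (I : FracIdeal Δ)) h)
    (x := fun l => (l : ℝ)) (x' := fun l => (conj Δ l : ℝ)) (fun c hc => hlat.summable hc)]
  exact continuous_theta (ι := coset Δ (nmMinus Δ (I : FracIdeal Δ)) h)
    (x := fun l => (l : ℝ)) (x' := fun l => (conj Δ l : ℝ)) (fun c hc => hlat.summable hc) _

lemma fourier_heckeTheta {I : (FracIdeal Δ)ˣ} (hI : I ∈ coprimeIdeals Δ) (h : DiscModule Δ)
    (hu : IsTotallyPositive Δ u) (hun : nm Δ u = 1)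
    (hlog : log (epsDisc Δ) = log ((u : ℝ) ^ 2)) (m : ℚ) :
    (1 / (((Δ : ℝ) * (m.den : ℝ) : ℝ) : ℂ)) * ∫ t in (0 : ℝ)..((Δ : ℝ) * (m.den : ℝ)),
      heckeThetaMinus Δ (nmMinus Δ (I : FracIdeal Δ)) h (t + Complex.I) *
        Complex.exp (-(2 * π * Complex.I * (m : ℂ) * (t + Complex.I))) =
      (orbitSum (conj Δ u ^ 2) (normSet (nmMinus Δ (I : FracIdeal Δ)) h m) : ℂ) := by
  obtain ⟨c, hc⟩ := exists_isMultiplier_nmMinus hI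
  have hlat := isLatticeSet_coset hc h
  have := hlat.countable
  obtain ⟨he1, he2⟩ := log_unit hu hun
  have hΔr := disc_pos_real (Δ := Δ)
  have hN : (Δ : ℝ) * (m.den : ℝ) ≠ 0 :=
    mul_ne_zero hΔr.ne' (by exact_mod_cast m.den_nz)
  simp only [heckeThetaMinus, thetaKernelMinus_eq (absNorm_nmMinus I.ne_zero)]
  simp only [integral_theta_eq (ι := coset Δ (nmMinus Δ (I : FracIdeal Δ)) h)
    (x := fun l => (l : ℝ)) (x' := fun l => (conj Δ l : ℝ)) (fun c hc => hlat.summable hc)]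
  have key := fourier_theta (ι := coset Δ (nmMinus Δ (I : FracIdeal Δ)) h)
    (x := fun l => (l : ℝ)) (x' := fun l => (conj Δ l : ℝ)) (fun c hc => hlat.summable hc)
    (log (epsDisc Δ)) (m := (m : ℝ)) hN (fun l => by
      obtain ⟨j, hj⟩ := nm_mul_disc_int I.ne_zero hc l.2
      refine ⟨j * m.den + Δ * m.num, ?_⟩
      have hm : (m : ℝ) * m.den = m.num := by exact_mod_cast Rat.mul_den_eq_num m
      push_cast
      linear_combination (m.den : ℝ) * hj + (Δ : ℝ) * hm)
  rw [Complex.ofReal_ratCast] at key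
  rw [key, orbitSum, Complex.ofReal_tsum]
  let e : {l : coset Δ (nmMinus Δ (I : FracIdeal Δ)) h | (l : ℝ) * (conj Δ l : ℝ) = -(m : ℝ)} ≃
      normSet (nmMinus Δ (I : FracIdeal Δ)) h m :=
    { toFun := fun l => ⟨l.1.1, l.1.2, by
        apply Subtype.ext
        have := l.2
        simp only [Set.mem_ofPred_eq] at this
        push_cast
        exact this⟩
      invFun := fun l => ⟨⟨l.1, l.2.1⟩, by
        have := congrArg (fun x : QuadField Δ => (x : ℝ)) l.2.2
        push_cast at this
        exact this⟩
      left_inv := fun _ => rfl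
      right_inv := fun _ => rfl }
  rw [← Equiv.tsum_eq e]
  refine tsum_congr fun l => ?_
  have hle : ((e l : normSet (nmMinus Δ (I : FracIdeal Δ)) h m) : QuadField Δ) = l.1.1 := rfl
  rw [hle, hlog, he1, he2, tracePrim, tracePrim, map_mul, map_pow, conj_conj]
  push_cast
  rw [mul_comm ((l.1.1 : ℝ)), mul_comm ((conj Δ l.1.1 : ℝ))]

/-- The Fourier coefficients of `ϑ_χ` as sums of orbit sums. -/
lemma coeffChi_eq [Fintype (NarrowClassGroup Δ)] (χ : NarrowClassGroup Δ →* ℤˣ) (m : ℚ)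
    (h : DiscModule Δ)
    (hu : IsTotallyPositive Δ u) (hun : nm Δ u = 1)
    (hlog : log (epsDisc Δ) = log ((u : ℝ) ^ 2)) :
    coeffChi χ m h = ∑ q : NarrowClassGroup Δ, (((χ q : ℤˣ) : ℤ) : ℂ) *
      (orbitSum (conj Δ u ^ 2)
        (normSet (nmMinus Δ (((Quotient.out q : coprimeIdeals Δ) : (FracIdeal Δ)ˣ) : FracIdeal Δ))
          h m) : ℂ) := by
  simp only [coeffChi, thetaChi, finsum_eq_sum_of_fintype, Finset.sum_mul]
  rw [intervalIntegral.integral_finsetSum, Finset.mul_sum]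
  · refine Finset.sum_congr rfl fun q _ => ?_
    rw [← fourier_heckeTheta (Quotient.out q).2 h hu hun hlog m]
    simp only [heckeThetaClass, mul_assoc]
    rw [intervalIntegral.integral_const_mul]
    ring
  · intro q _
    refine Continuous.intervalIntegrable ?_ _ _
    refine Continuous.mul (continuous_const.mul ?_) (by fun_prop)
    exact continuous_heckeTheta (Quotient.out q).2 h

end Coefficients
end HeckeTheta

namespace HeckeTheta

/-! ### Comparison of the coefficients at n/Δ and ℓ²n/Δ -/

section HeckeAction

open Real

set_option linter.unusedSectionVars false

variable {Δ : ℤ} [hΔ : Fact (IsFundamentalDiscriminant Δ)] [hΔ1 : Fact (1 < Δ)]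
variable {ℓ : ℕ} {𝔩 : Ideal (𝓞 (QuadField Δ))} {η : QuadField Δ}

/-- The contribution of the ideal `I` to a Fourier coefficient. -/
noncomputable def idealSum (η : QuadField Δ) (I : coprimeIdeals Δ) (h : DiscModule Δ) (m : ℚ) : ℝ :=
  orbitSum η (normSet (nmMinus Δ ((I : (FracIdeal Δ)ˣ) : FracIdeal Δ)) h m)

lemma isLatticeSet_normSet (I : coprimeIdeals Δ) (h : DiscModule Δ) (m : ℚ) :
    IsLatticeSet (normSet (nmMinus Δ ((I : (FracIdeal Δ)ˣ) : FracIdeal Δ)) h m) := by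
  obtain ⟨c, hc⟩ := exists_isMultiplier_nmMinus I.2
  exact (isLatticeSet_coset hc h).mono fun l hl => hl.1

lemma isTotallyPositive_div_conj {x : QuadField Δ} (hx : IsTotallyPositive Δ x) :
    IsTotallyPositive Δ (x / conj Δ x) := by
  rw [div_eq_mul_inv]
  exact hx.mul hx.conj.inv

/-- A totally positive element that acts on all the sets `normSet`, as squares of totally positive
units do. -/
structure ActsOnNormSets (η : QuadField Δ) : Prop where
  pos : IsTotallyPositive Δ η
  stable : ∀ (I : coprimeIdeals Δ) (h : DiscModule Δ) (m : ℚ),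
    normSet (nmMinus Δ ((I : (FracIdeal Δ)ˣ) : FracIdeal Δ)) h m =
      (fun l => η * l) '' normSet (nmMinus Δ ((I : (FracIdeal Δ)ˣ) : FracIdeal Δ)) h m

lemma actsOnNormSets_conj_sq {u : QuadField Δ} (hu : IsIntegral ℤ u)
    (hpos : IsTotallyPositive Δ u) (hun : nm Δ u = 1) : ActsOnNormSets (conj Δ u ^ 2) := by
  refine ⟨by rw [sq]; exact hpos.conj.mul hpos.conj, fun I h m => ?_⟩
  exact normSet_unit I.2 (isIntegral_conj hu) (by rw [nm, conj_conj, mul_comm]; exact hun) h m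

lemma ActsOnNormSets.orbitSum_image (hη : ActsOnNormSets η) (I : coprimeIdeals Δ) (h : DiscModule Δ)
    (m : ℚ) {t : QuadField Δ} (ht : IsTotallyPositive Δ t) :
    orbitSum η ((fun l => t * l) '' normSet (nmMinus Δ ((I : (FracIdeal Δ)ˣ) : FracIdeal Δ)) h m) =
      idealSum η I h m :=
  orbitSum_image_mul (isLatticeSet_normSet I h m) (fun _ hl => hl.2) hη.pos (hη.stable I h m) ht

/-- The representatives differ by (x) with x totally positive, which scales the set by x/x', again
totally positive. -/
lemma idealSum_eq_of_class_eq (hη : ActsOnNormSets η) {I J : coprimeIdeals Δ}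
    (hIJ : (QuotientGroup.mk I : NarrowClassGroup Δ) = QuotientGroup.mk J) (h : DiscModule Δ)
    (m : ℚ) : idealSum η J h m = idealSum η I h m := by
  rw [QuotientGroup.eq] at hIJ
  obtain ⟨x, hx, hK⟩ := hIJ
  have key := normSet_principal I.2 (I⁻¹ * J).2 hx hK h m
  rw [Subgroup.coe_mul, Subgroup.coe_inv, mul_inv_cancel_left] at key
  rw [idealSum, key]
  exact hη.orbitSum_image I h m (isTotallyPositive_div_conj hx)

lemma idealSum_nsmul (hη : ActsOnNormSets η) (hℓ : ℓ.Prime) (h𝔩 : IsUniquePrimeAbove ℓ 𝔩)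
    (I : coprimeIdeals Δ) {n : ℤ} {h : DiscModule Δ}
    (hcomp : (ℓ : ℤ) ∣ Δ → IsLocallyCompatible ℓ n h) (hn : ¬ (ℓ : ℤ) ∣ Δ ∨ (ℓ : ℤ) ∣ n) :
    idealSum η I (ℓ • h) ((ℓ : ℚ) ^ 2 * n / Δ) = idealSum η I h ((n : ℚ) / Δ) := by
  rw [idealSum, normSet_nsmul_eq_image hℓ h𝔩 I.2 hcomp hn]
  exact hη.orbitSum_image I h _ (isTotallyPositive_natCast hℓ.pos)

/-- h' is the twisted class and J = y𝔩⁻¹. Neither depends on I, so the last equation can be summed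
over all narrow classes. -/
lemma exists_idealSum_nsmul_eq_add (hη : ActsOnNormSets η) (hℓ : ℓ.Prime)
    (h𝔩 : IsUniquePrimeAbove ℓ 𝔩) (hd : (ℓ : ℤ) ∣ Δ) {n : ℤ} {h : DiscModule Δ}
    (hcomp : IsLocallyCompatible ℓ n h) (hn : ¬ (ℓ : ℤ) ∣ n) :
    ∃ (J : coprimeIdeals Δ) (h' : DiscModule Δ),
      narrowClass Δ (𝔩 : FracIdeal Δ) = (QuotientGroup.mk J)⁻¹ ∧ ∀ I : coprimeIdeals Δ,
        idealSum η I (ℓ • h) ((ℓ : ℚ) ^ 2 * n / Δ) =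
          idealSum η I h ((n : ℚ) / Δ) + idealSum η I h' ((n : ℚ) / Δ) ∧
        idealSum η (I * J) h' ((n : ℚ) / Δ) = idealSum η I h ((n : ℚ) / Δ) := by
  obtain ⟨D, α, hα, rfl, hD⟩ := normSet_nsmul_eq_image_union hℓ h𝔩 hd hcomp hn
  obtain ⟨J, hJ, hJD⟩ := D.exists_ideal hℓ h𝔩
  refine ⟨J, discClass (D.g * α) (D.isIntegral_g.mul hα), hJ, fun I => ⟨?_, ?_⟩⟩
  · obtain ⟨hset, hdisj⟩ := hD I.2
    have ht := isTotallyPositive_natCast (Δ := Δ) hℓ.pos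
    rw [idealSum, hset, Set.image_union]
    have himage : ∀ h : DiscModule Δ, IsLatticeSet ((fun l => (ℓ : QuadField Δ) * l) ''
        normSet (nmMinus Δ ((I : (FracIdeal Δ)ˣ) : FracIdeal Δ)) h ((n : ℚ) / Δ)) := by
      intro h
      obtain ⟨E, hE, hEl⟩ := isLatticeSet_normSet I h ((n : ℚ) / Δ)
      refine ⟨E, hE, ?_⟩
      rintro _ ⟨l, hl, rfl⟩
      rw [mul_left_comm]
      exact (isIntegral_natCast ℓ).mul (hEl l hl)
    have hnorm : ∀ h : DiscModule Δ, ∀ l ∈ (fun l => (ℓ : QuadField Δ) * l) ''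
        normSet (nmMinus Δ ((I : (FracIdeal Δ)ˣ) : FracIdeal Δ)) h ((n : ℚ) / Δ),
        nm Δ l = nm Δ (ℓ : QuadField Δ) * -(((n : ℚ) / Δ : ℚ) : QuadField Δ) := by
      rintro h _ ⟨l, hl, rfl⟩
      rw [nm_mul, hl.2]
    rw [orbitSum_union (himage _) (himage _) (hnorm _) (hnorm _) hη.pos
      ((Set.disjoint_image_iff (mul_right_injective₀ ht.ne_zero)).2 hdisj),
      hη.orbitSum_image I _ _ ht, hη.orbitSum_image I _ _ ht]
  · rw [idealSum, Subgroup.coe_mul, D.normSet_twist hℓ I.2 J.2 hJD hα]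
    exact hη.orbitSum_image I _ _ (isTotallyPositive_div_conj D.pos)

theorem coeffChi_nsmul [Fintype (NarrowClassGroup Δ)] (χ : NarrowClassGroup Δ →* ℤˣ)
    (hℓ : ℓ.Prime) (h𝔩 : IsUniquePrimeAbove ℓ 𝔩) {n : ℤ} {h : DiscModule Δ}
    (hcomp : (ℓ : ℤ) ∣ Δ → IsLocallyCompatible ℓ n h) (hn : ¬ (ℓ : ℤ) ∣ Δ ∨ (ℓ : ℤ) ∣ n) :
    coeffChi χ ((ℓ : ℚ) ^ 2 * n / Δ) (ℓ • h) = coeffChi χ ((n : ℚ) / Δ) h := by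
  obtain ⟨u, hui, hu, hun, hlog⟩ := exists_unit_epsDisc (Δ := Δ)
  have hη := actsOnNormSets_conj_sq hui hu hun
  rw [coeffChi_eq χ _ _ hu hun hlog, coeffChi_eq χ _ _ hu hun hlog]
  refine Finset.sum_congr rfl fun q _ => ?_
  have := idealSum_nsmul hη hℓ h𝔩 (Quotient.out q) hcomp hn
  rw [idealSum, idealSum] at this
  rw [this]

theorem coeffChi_nsmul_of_dvd_disc [Fintype (NarrowClassGroup Δ)] (χ : NarrowClassGroup Δ →* ℤˣ)
    (hℓ : ℓ.Prime) (h𝔩 : IsUniquePrimeAbove ℓ 𝔩) (hd : (ℓ : ℤ) ∣ Δ) {n : ℤ} {h : DiscModule Δ}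
    (hcomp : IsLocallyCompatible ℓ n h) (hn : ¬ (ℓ : ℤ) ∣ n) :
    coeffChi χ ((ℓ : ℚ) ^ 2 * n / Δ) (ℓ • h) =
      (1 + (((χ (narrowClass Δ (𝔩 : FracIdeal Δ)) : ℤˣ) : ℤ) : ℂ)) *
        coeffChi χ ((n : ℚ) / Δ) h := by
  obtain ⟨u, hui, hu, hun, hlog⟩ := exists_unit_epsDisc (Δ := Δ)
  have hη := actsOnNormSets_conj_sq hui hu hun
  obtain ⟨J, h', hJ, hI⟩ := exists_idealSum_nsmul_eq_add hη hℓ h𝔩 hd hcomp hn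
  have hcoeff : ∀ (h : DiscModule Δ) (m : ℚ), coeffChi χ m h = ∑ q : NarrowClassGroup Δ,
      (((χ q : ℤˣ) : ℤ) : ℂ) * (idealSum (conj Δ u ^ 2) (Quotient.out q) h m : ℂ) :=
    fun h m => coeffChi_eq χ m h hu hun hlog
  -- Reindexing by q ↦ q[J] turns h' into h and produces χ([J]) = χ([𝔩])⁻¹, which is χ([𝔩]) because
  -- χ takes the values ±1. `Quotient.out` is not multiplicative, hence the appeal to
  -- `idealSum_eq_of_class_eq`.
  have htwist : ∑ q : NarrowClassGroup Δ, (((χ q : ℤˣ) : ℤ) : ℂ) *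
      (idealSum (conj Δ u ^ 2) (Quotient.out q) h' ((n : ℚ) / Δ) : ℂ) =
      (((χ (narrowClass Δ (𝔩 : FracIdeal Δ)) : ℤˣ) : ℤ) : ℂ) * coeffChi χ ((n : ℚ) / Δ) h := by
    rw [hcoeff, Finset.mul_sum, ← Equiv.sum_comp (Equiv.mulRight (QuotientGroup.mk J))]
    refine Finset.sum_congr rfl fun q _ => ?_
    have hq : (QuotientGroup.mk (Quotient.out q * J) : NarrowClassGroup Δ) =
        QuotientGroup.mk (Quotient.out (q * QuotientGroup.mk J)) := by
      rw [QuotientGroup.out_eq', QuotientGroup.mk_mul, QuotientGroup.out_eq']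
    rw [Equiv.coe_mulRight, idealSum_eq_of_class_eq hη hq, (hI _).2, hJ, map_inv,
      Int.units_inv_eq_self, map_mul]
    push_cast
    ring
  rw [hcoeff, add_mul, one_mul, ← htwist, hcoeff, ← Finset.sum_add_distrib]
  refine Finset.sum_congr rfl fun q _ => ?_
  rw [(hI _).1]
  push_cast
  ring

end HeckeAction
end HeckeTheta

theorem proposition3p4 (Δ : ℤ) (hΔ : HeckeTheta.IsFundamentalDiscriminant Δ) (hΔ1 : 1 < Δ)
    (χ : HeckeTheta.NarrowClassGroup Δ →* ℤˣ) (hχ : HeckeTheta.IsGenusCharacter Δ χ)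
    (ℓ : ℕ) (hℓ : ℓ.Prime) (𝔩 : Ideal (𝓞 (HeckeTheta.QuadField Δ)))
    (h𝔩 : ∀ 𝔭 : Ideal (𝓞 (HeckeTheta.QuadField Δ)),
      (𝔭.IsPrime ∧ (ℓ : 𝓞 (HeckeTheta.QuadField Δ)) ∈ 𝔭) ↔ 𝔭 = 𝔩)
    (n : ℤ) (h : HeckeTheta.DiscModule Δ)
    (hcomp : (ℓ : ℤ) ∣ Δ → HeckeTheta.IsLocallyCompatible ℓ n h) :
    ((¬ (ℓ : ℤ) ∣ Δ ∨ ℓ ∣ Int.gcd Δ n) →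
      HeckeTheta.coeffChi χ ((ℓ : ℚ) ^ 2 * (n : ℚ) / (Δ : ℚ)) (ℓ • h) =
        HeckeTheta.coeffChi χ ((n : ℚ) / (Δ : ℚ)) h) ∧
    ((ℓ : ℤ) ∣ Δ ∧ ¬ (ℓ : ℤ) ∣ n →
      HeckeTheta.coeffChi χ ((ℓ : ℚ) ^ 2 * (n : ℚ) / (Δ : ℚ)) (ℓ • h) =
        (1 + (((χ (HeckeTheta.narrowClass Δ (𝔩 : HeckeTheta.FracIdeal Δ)) : ℤˣ) : ℤ) : ℂ)) *
          HeckeTheta.coeffChi χ ((n : ℚ) / (Δ : ℚ)) h) := by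
  have : Fact (HeckeTheta.IsFundamentalDiscriminant Δ) := ⟨hΔ⟩
  have : Fact (1 < Δ) := ⟨hΔ1⟩
  have : Fintype (HeckeTheta.NarrowClassGroup Δ) := Fintype.ofFinite _
  refine ⟨fun hn => ?_, fun hn => ?_⟩
  · exact HeckeTheta.coeffChi_nsmul χ hℓ h𝔩 hcomp (hn.imp_right fun hg =>
      (Int.natCast_dvd_natCast.2 hg).trans (Int.gcd_dvd_right Δ n))
  · exact HeckeTheta.coeffChi_nsmul_of_dvd_disc χ hℓ h𝔩 hn.1 (hcomp hn.1) hn.2
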